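/- Let $X_0$ be a reduced algebraic variety over a field of characteristic zero, or a reduced complex- or real-analytic variety. Let $\sigma:(X,E)\to(X_0,\mathrm{Sing}\,X_0)$ be a resolution of singularities of $X_0$: $\sigma: X\to X_0$ is a proper birational (or bimeromorphic) morphism, $X$ is smooth of (pure) dimension $n=\dim X_0$, $\sigma$ is an isomorphism over $X_0\setminus\mathrm{Sing}\,X_0$, and $\sigma^{-1}(\mathrm{Sing}\,X_0)$ is the support of a simple normal crossings divisor $E$ on $X$. Local coordinates $(u,v)=(u_1,\dots,u_s,v_1,\dots,v_{n-s})$ of $X$ at a (closed) point $a$, vanishing at $a$, are called adapted to $E$ if $(u_1=0),\dots,(u_s=0)$ are the components of $E$ near $a$. Let $\sigma^*\Omega^1_{X_0}\subset\Omega^1_X$ denote the submodule generated by the pullbacks by $\sigma$ of the differentials of functions on $X_0$. For $k=0,\dots,n-1$, let $\mathcal F_k(\sigma)\subset\mathcal O_X$ denote the logarithmic Fitting ideal, generated locally by the minors of order $n-k$ of the logarithmic Jacobian matrix of $\sigma$, i.e. of the matrix whose rows are the coefficients of $d\sigma_1,\dots,d\sigma_N$ with respect to the logarithmic basis $du_i/u_i$,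 $dv_j$, where $(u,v)$ are adapted coordinates and $\sigma_1,\dots,\sigma_N$ are the components of $\sigma$ with respect to a local embedding of $X_0$ in a smooth variety with local coordinates. (This ideal does not depend on the choices.) Then the following conditions are equivalent. (1) The ideals $\mathcal F_k(\sigma)$, $k=0,\dots,n-1$, are all principal monomial ideals: at every point $a$, in adapted coordinates, each $\mathcal F_k(\sigma)_a$ is generated by a monomial $u^{\gamma}$, $\gamma\in\mathbb N^s$. (2) $\sigma$ is a resolution of singularities of the cotangent sheaf of $X_0$: at every (closed) point $a$ of $X$ there are local coordinates $(u,v)=(u_1,\dots,u_s,v_1,\dots,v_{n-s})$ vanishing at $a$ (analytic coordinates in the analytic case, étale coordinates, i.e. coordinates on an étale neighbourhood of $a$, in the algebraic case) such that $\mathrm{supp}\,E=(u_1\cdots u_s=0)$, and there are multiindices $\alpha_1,\dots,\alpha_s,\beta_1,\dots,\beta_{n-s}\in\mathbb N^s$ such that $\alpha_1,\dots,\alpha_s$ are linearly independent over $\mathbb Q$, the set $\{\alpha_i,\beta_j\}$ is totally ordered by the componentwise partial order of $\mathbb N^s$, and $\sigma^*\Omega^1_{X_0}$ is generated at $a$ by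 the differential monomials $$d(u^{\alpha_i}),\ i=1,\dots,s,\qquad d(u^{\beta_j}v_j),\ j=1,\dots,n-s.$$ -/

import Mathlib

open CategoryTheory AlgebraicGeometry TopologicalSpace Opposite Topology

universe u v

section AnalyticModel

variable (𝕜 : Type u) [RCLike 𝕜] (N : ℕ)

/-- A function on an open subset `U` of `𝕜^N` is analytic if near each point of `U` it agrees with
a function that is analytic at that point. -/
def IsAnalyticFun {U : Opens (Fin N → 𝕜)} (f : U → 𝕜) : Prop :=
  ∀ x : U, ∃ F : (Fin N → 𝕜) → 𝕜, AnalyticAt 𝕜 F x ∧ ∀ᶠ y : U in 𝓝 x, f y = F y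

/-- The ring of analytic functions on an open subset of `𝕜^N`. -/
def analyticFunctions (U : Opens (Fin N → 𝕜)) : Subring (U → 𝕜) where
  carrier := {f | IsAnalyticFun 𝕜 N f}
  mul_mem' {f g} hf hg x := by
    obtain ⟨F, hF, h1⟩ := hf x
    obtain ⟨G, hG, h2⟩ := hg x
    exact ⟨F * G, hF.mul hG, by filter_upwards [h1, h2] with y h1 h2; simp [h1, h2]⟩
  one_mem' x := ⟨fun _ => 1, analyticAt_const, by simp⟩
  add_mem' {f g} hf hg x := by
    obtain ⟨F, hF, h1⟩ := hf x
    obtain ⟨G, hG, h2⟩ := hg x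
    exact ⟨F + G, hF.add hG, by filter_upwards [h1, h2] with y h1 h2; simp [h1, h2]⟩
  zero_mem' x := ⟨fun _ => 0, analyticAt_const, by simp⟩
  neg_mem' {f} hf x := by
    obtain ⟨F, hF, h1⟩ := hf x
    exact ⟨-F, hF.neg, by filter_upwards [h1] with y h1; simp [h1]⟩

/-- Analyticity is a local condition. -/
def analyticLocalPredicate :
    TopCat.LocalPredicate fun _ : TopCat.of (Fin N → 𝕜) => 𝕜 where
  pred {U} f := IsAnalyticFun 𝕜 N (U := U) f
  res {U V} i f hf x := by
    obtain ⟨F, hF, h⟩ := hf ⟨x, leOfHom i x.2⟩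
    refine ⟨F, hF, ?_⟩
    have hc : Continuous (fun y : U => (⟨y, leOfHom i y.2⟩ : V)) :=
      continuous_subtype_val.subtype_mk _
    exact hc.continuousAt.eventually h
  locality {U} f hf x := by
    obtain ⟨V, hxV, i, hV⟩ := hf x
    obtain ⟨F, hF, h⟩ := hV ⟨x, hxV⟩
    refine ⟨F, hF, ?_⟩
    rw [nhds_subtype, Filter.eventually_comap] at h ⊢
    filter_upwards [h, V.isOpen.mem_nhds hxV] with y hy hyV z hz
    subst hz
    exact hy ⟨z, hyV⟩ rfl

/-- Restriction of analytic functions to a smaller open set. -/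
def analyticRestrict {U V : Opens (Fin N → 𝕜)} (h : U ≤ V) :
    analyticFunctions 𝕜 N V →+* analyticFunctions 𝕜 N U where
  toFun f := ⟨fun x => f.1 ⟨x, h x.2⟩,
    (analyticLocalPredicate 𝕜 N).res (homOfLE h) f.1 f.2⟩
  map_one' := rfl
  map_mul' _ _ := rfl
  map_zero' := rfl
  map_add' _ _ := rfl

/-- The presheaf of rings of analytic functions on `𝕜^N`. -/
def analyticPresheaf : TopCat.Presheaf CommRingCat.{u} (TopCat.of (Fin N → 𝕜)) where
  obj U := CommRingCat.of (analyticFunctions 𝕜 N (unop U))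
  map i := CommRingCat.ofHom (analyticRestrict 𝕜 N (leOfHom i.unop))
  map_id _ := rfl
  map_comp _ _ := rfl

theorem analyticPresheaf_isSheaf : (analyticPresheaf 𝕜 N).IsSheaf := by
  rw [TopCat.Presheaf.IsSheaf, CategoryTheory.Presheaf.isSheaf_iff_isSheaf_forget _ _
    (CategoryTheory.forget CommRingCat)]
  exact (TopCat.subsheafToTypes (analyticLocalPredicate 𝕜 N)).property

/-- The germ of an analytic function which does not vanish at `x` is a unit. -/
theorem analyticPresheaf_isUnit_germ {U : Opens (TopCat.of (Fin N → 𝕜))}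
    (x : TopCat.of (Fin N → 𝕜)) (hx : x ∈ U) (f : analyticFunctions 𝕜 N U)
    (hf : f.1 ⟨x, hx⟩ ≠ 0) :
    IsUnit ((analyticPresheaf 𝕜 N).germ U x hx f) := by
  obtain ⟨F, hF, h⟩ := f.2 ⟨x, hx⟩
  have hFx : F x ≠ 0 := by
    have := h.self_of_nhds
    rwa [this] at hf
  have h1 : ∀ᶠ y in 𝓝 (x : Fin N → 𝕜), AnalyticAt 𝕜 F y := hF.eventually_analyticAt
  have h2 : ∀ᶠ y in 𝓝 (x : Fin N → 𝕜), F y ≠ 0 := hF.continuousAt.eventually_ne hFx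
  rw [nhds_subtype, Filter.eventually_comap] at h
  obtain ⟨W, hW, hWo, hxW⟩ := eventually_nhds_iff.1 ((h1.and h2).and h)
  let V : Opens (Fin N → 𝕜) := ⟨W, hWo⟩ ⊓ U
  have hVU : V ≤ U := inf_le_right
  have hxV : (x : Fin N → 𝕜) ∈ V := ⟨hxW, hx⟩
  let g : analyticFunctions 𝕜 N V := ⟨fun y => (F y)⁻¹, fun y =>
    ⟨fun z => (F z)⁻¹, (hW y y.2.1).1.1.inv (hW y y.2.1).1.2, by simp⟩⟩
  have e : (analyticPresheaf 𝕜 N).germ U x hx f =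
      (analyticPresheaf 𝕜 N).germ V x hxV (analyticRestrict 𝕜 N hVU f) :=
    ((analyticPresheaf 𝕜 N).germ_res_apply (homOfLE hVU) x hxV f).symm
  rw [e]
  refine IsUnit.map ((analyticPresheaf 𝕜 N).germ V x hxV).hom
    (IsUnit.of_mul_eq_one (M := analyticFunctions 𝕜 N V) g ?_)
  ext y
  have hy := (hW y y.2.1).2 ⟨y, y.2.2⟩ rfl
  change f.1 ⟨y, _⟩ * (F y)⁻¹ = 1
  rw [hy]
  exact mul_inv_cancel₀ (hW y y.2.1).1.2

instance analyticPresheaf_isLocalRing (x : TopCat.of (Fin N → 𝕜)) :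
    IsLocalRing ((analyticPresheaf 𝕜 N).stalk x) := by
  have : Nontrivial ((analyticPresheaf 𝕜 N).stalk x) := by
    refine ⟨⟨0, 1, fun h => ?_⟩⟩
    rw [← map_zero ((analyticPresheaf 𝕜 N).germ ⊤ x trivial).hom,
      ← map_one ((analyticPresheaf 𝕜 N).germ ⊤ x trivial).hom] at h
    obtain ⟨W, hxW, i, j, e⟩ := (analyticPresheaf 𝕜 N).germ_eq x (U := ⊤) (V := ⊤) trivial trivial _ _ h
    have e' := congrFun (congrArg Subtype.val e) ⟨x, hxW⟩
    exact zero_ne_one (α := 𝕜) e'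
  refine IsLocalRing.of_isUnit_or_isUnit_one_sub_self fun a => ?_
  obtain ⟨U, hxU, f, rfl⟩ := (analyticPresheaf 𝕜 N).exists_germ_eq a
  by_cases hf : f.1 ⟨x, hxU⟩ = 0
  · right
    rw [← map_one ((analyticPresheaf 𝕜 N).germ U x hxU).hom]
    have := analyticPresheaf_isUnit_germ 𝕜 N x hxU
      (HSub.hSub (α := analyticFunctions 𝕜 N U) (β := analyticFunctions 𝕜 N U) 1 f) (by
      change (1 : 𝕜) - f.1 ⟨x, hxU⟩ ≠ 0
      simp [hf])
    rw [← map_sub]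
    exact this
  · left
    exact analyticPresheaf_isUnit_germ 𝕜 N x hxU f hf

/-- The space `𝕜^N` with its sheaf of analytic functions. -/
def analyticAffineSpace : LocallyRingedSpace.{u} where
  carrier := TopCat.of (Fin N → 𝕜)
  presheaf := analyticPresheaf 𝕜 N
  IsSheaf := analyticPresheaf_isSheaf 𝕜 N
  isLocalRing x := analyticPresheaf_isLocalRing 𝕜 N x

/-- The constant functions on `𝕜^N`. -/
def analyticAffineSpace.constants :
    𝕜 →+* (analyticAffineSpace 𝕜 N).presheaf.obj (op ⊤) where
  toFun t := (⟨fun _ => t, fun _ => ⟨fun _ => t, analyticAt_const, by simp⟩⟩ :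
    analyticFunctions 𝕜 N ⊤)
  map_one' := rfl
  map_mul' _ _ := rfl
  map_zero' := rfl
  map_add' _ _ := rfl

end AnalyticModel

section LocalAlgebra

variable {k R : Type u} [CommRing k] [CommRing R]

/-- The module of derivations of the ring `R` which vanish on the constants, i.e. on the image of
`c : k →+* R`. -/
def constDerivations (c : k →+* R) : Submodule R (Derivation ℤ R R) where
  carrier := {D | ∀ t, D (c t) = 0}
  add_mem' h₁ h₂ t := by simp [h₁ t, h₂ t]
  zero_mem' t := rfl
  smul_mem' r D h t := by simp [h t]

/-- The module of `1`-forms of a local ring `R = 𝒪_{X,a}` of a smooth space: the `R`-dual of the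
module of derivations (vector fields).  If `x₁, …, xₙ` are local coordinates of the smooth
algebraic, complex-analytic or real-analytic space `X` at `a`, this is the free module on
`dx₁, …, dxₙ`, i.e. the stalk at `a` of the sheaf `Ω¹_X`.  (In the algebraic case it is the module
of Kähler differentials; in the analytic case it is the module of analytic `1`-forms, whereas the
module of Kähler differentials would be too big.) -/
abbrev OneForms (c : k →+* R) : Type u := Module.Dual R (constDerivations c)

/-- The differential `df` of a function `f`, as a `1`-form: `D ↦ D f`. -/
def differential (c : k →+* R) (f : R) : OneForms c where
  toFun D := D.1 f
  map_add' _ _ := rfl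
  map_smul' _ _ := rfl

end LocalAlgebra

section Spaces

/-- The ring homomorphism from the field of constants to the local ring at a point. -/
noncomputable def stalkConst {k : Type u} [Field k] {X : LocallyRingedSpace.{u}}
    (c : k →+* X.presheaf.obj (op ⊤)) (a : X) : k →+* X.presheaf.stalk a :=
  (X.presheaf.germ ⊤ a trivial).hom.comp c

/-- The constants of the source of a morphism to a space with field of constants `k`. -/
noncomputable def pullbackConst {k : Type u} [Field k] {X X₀ : LocallyRingedSpace.{u}}
    (c₀ : k →+* X₀.presheaf.obj (op ⊤)) (σ : X ⟶ X₀) : k →+* X.presheaf.obj (op ⊤) :=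
  (LocallyRingedSpace.Γ.map σ.op).hom.comp c₀

/-- The locus where a section over `U` vanishes (i.e. where its germ is in the maximal ideal). -/
def vanishingLocus {X : LocallyRingedSpace.{u}} {U : Opens X} (f : X.presheaf.obj (op U)) :
    Set X :=
  {x | ∃ hx : x ∈ U,
    X.presheaf.germ U x hx f ∈ IsLocalRing.maximalIdeal (X.presheaf.stalk x)}

/-- The singular locus: the points whose local ring is not regular. -/
def singularLocus (X : LocallyRingedSpace.{u}) : Set X :=
  {x | ¬ IsRegularLocalRing (X.presheaf.stalk x)}

/-- The space `X` is reduced: its structure sheaf has no nilpotents. -/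
def IsReducedSpace (X : LocallyRingedSpace.{u}) : Prop :=
  ∀ x : X, IsReduced (X.presheaf.stalk x)

/-- The morphism `σ : X ⟶ X₀` is an isomorphism over the subset `W` of `X₀`: it restricts to a
homeomorphism `σ⁻¹ W → W` and induces isomorphisms of the local rings. -/
def IsIsoOver {X X₀ : LocallyRingedSpace.{u}} (σ : X ⟶ X₀) (W : Set X₀) : Prop :=
  IsHomeomorph (W.restrictPreimage (σ.base : X → X₀)) ∧
    ∀ x : X, σ.base x ∈ W → Function.Bijective (σ.stalkMap x)

/-- Local coordinates `(u₁, …, u_s, v₁, …, v_r)` at a closed point `a` of a smooth space `X` of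
dimension `s + r`, with `a = 0`: functions on a neighbourhood `U` of `a` whose germs at `a` generate
the maximal ideal of the regular `(s + r)`-dimensional local ring `𝒪_{X,a}`. (In characteristic zero
this means exactly that they define a map from a neighbourhood of `a` to affine `(s + r)`-space,
taking `a` to `0`, which is étale if `X` is algebraic, and an isomorphism onto an open subset if
`X` is analytic.) -/
structure LocalCoordinates (X : LocallyRingedSpace.{u}) (a : X) (s r : ℕ) where
  /-- The coordinate neighbourhood. -/
  U : Opens X
  mem : a ∈ U
  /-- The coordinates `u₁, …, u_s`. -/
  u : Fin s → X.presheaf.obj (op U)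
  /-- The coordinates `v₁, …, v_r`. -/
  v : Fin r → X.presheaf.obj (op U)
  maximalIdeal_eq : IsLocalRing.maximalIdeal (X.presheaf.stalk a) =
    Ideal.span (Set.range (fun i => X.presheaf.germ U a mem (u i)) ∪
      Set.range (fun j => X.presheaf.germ U a mem (v j)))

namespace LocalCoordinates

variable {X : LocallyRingedSpace.{u}} {a : X} {s r : ℕ} (C : LocalCoordinates X a s r)

/-- The germ at `a` of the coordinate `u_i`. -/
noncomputable def uGerm (i : Fin s) : X.presheaf.stalk a := X.presheaf.germ C.U a C.mem (C.u i)

/-- The germ at `a` of the coordinate `v_j`. -/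
noncomputable def vGerm (j : Fin r) : X.presheaf.stalk a := X.presheaf.germ C.U a C.mem (C.v j)

/-- The monomial `u^α = u₁^{α₁} ⋯ u_s^{α_s}`, as a germ at `a`. -/
noncomputable def uMonomial (α : Fin s → ℕ) : X.presheaf.stalk a := ∏ i, C.uGerm i ^ α i

/-- The coordinates `(u, v)` are adapted to the divisor with components `E i`, `i : ι`: the
`(u_j = 0)`, `j = 1, …, s`, are the components of the divisor in the coordinate neighbourhood,
without repetition. -/
def IsAdapted {ι : Type v} (E : ι → Set X) : Prop :=
  ∃ e : Fin s → ι, Function.Injective e ∧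
    (∀ j, E (e j) ∩ C.U = vanishingLocus (C.u j)) ∧
    ∀ i, i ∉ Set.range e → E i ∩ C.U = ∅

/-- The matrix `L` is the logarithmic Jacobian matrix of the germs `g₁, …, g_m` at `a`, in the
coordinates `(u, v)`: its rows are the coefficients of `dg₁, …, dg_m` with respect to the
logarithmic basis `du_i / u_i`, `dv_j`. Thus `L = (u_i ∂g_q/∂u_i | ∂g_q/∂v_j)`. -/
def IsLogJacobian {k : Type u} [Field k] (c : k →+* X.presheaf.obj (op ⊤)) {m : ℕ}
    (g : Fin m → X.presheaf.stalk a) (L : Matrix (Fin m) (Fin s ⊕ Fin r) (X.presheaf.stalk a)) :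
    Prop :=
  ∃ (A : Matrix (Fin m) (Fin s) (X.presheaf.stalk a))
    (B : Matrix (Fin m) (Fin r) (X.presheaf.stalk a)),
    (∀ q, differential (stalkConst c a) (g q) =
      ∑ i, A q i • differential (stalkConst c a) (C.uGerm i) +
      ∑ j, B q j • differential (stalkConst c a) (C.vGerm j)) ∧
    L = Matrix.fromCols (Matrix.of fun q i => C.uGerm i * A q i) B

/-- The stalk at `a` of the ideal sheaf generated by the minors of order `m` of the logarithmic
Jacobian matrix of `σ : X ⟶ X₀`, in the coordinates `(u, v)` of `X` at `a`. The rows of the matrix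
are given by the pullbacks of all functions on `X₀` at `σ(a)`; since their differentials are
linear combinations of those of the components `σ₁, …, σ_N` of `σ` with respect to any local
embedding of `X₀` in a smooth space, it is the same to use only the rows of `σ₁, …, σ_N`. -/
noncomputable def logMinorsIdeal {k : Type u} [Field k] {X₀ : LocallyRingedSpace.{u}}
    (c₀ : k →+* X₀.presheaf.obj (op ⊤)) (σ : X ⟶ X₀) (m : ℕ) : Ideal (X.presheaf.stalk a) :=
  Ideal.span {δ | ∃ (f : Fin m → X₀.presheaf.stalk (σ.base a))
    (L : Matrix (Fin m) (Fin s ⊕ Fin r) (X.presheaf.stalk a)) (J : Fin m → Fin s ⊕ Fin r),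
    C.IsLogJacobian (pullbackConst c₀ σ) (fun q => σ.stalkMap a (f q)) L ∧
      δ = (L.submatrix id J).det}

end LocalCoordinates

variable {X X₀ : LocallyRingedSpace.{u}}

/-- The sets `E i`, `i : ι`, are the components of a (reduced) simple normal crossings divisor on
the smooth space `X` of dimension `n`: every closed point has local coordinates adapted to them.
In particular the `E i` are closed smooth hypersurfaces forming a locally finite family. -/
def IsSNCDivisor (n : ℕ) {ι : Type v} (E : ι → Set X) : Prop :=
  ∀ a : X, IsClosed {a} → ∃ (s r : ℕ) (C : LocalCoordinates X a s r), s + r = n ∧ C.IsAdapted E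

/-- The conditions which make a proper morphism `σ : X ⟶ X₀` from a smooth space of dimension `n` a
resolution of singularities `(X, E) ⟶ (X₀, Sing X₀)` with exceptional divisor `E = ∑ E i`. As the
preimage `⋃ E i` of `Sing X₀` is nowhere dense, `σ` is then birational or bimeromorphic. -/
structure IsDesingularization (σ : X ⟶ X₀) (n : ℕ) {ι : Type v} (E : ι → Set X) : Prop where
  isIsoOver : IsIsoOver σ (singularLocus X₀)ᶜ
  snc : IsSNCDivisor n E
  preimage_eq : (σ.base : X → X₀) ⁻¹' singularLocus X₀ = ⋃ i, E i

/-- The logarithmic Fitting ideals `F_k(σ)`, `k = 0, …, n - 1` (generated by the minors of order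
`n - k` of the logarithmic Jacobian matrix), are all principal monomial ideals: at every (closed)
point each is generated by a monomial in generators `u_i` of the components of `E`. -/
def HasPrincipalMonomialFittingIdeals {k : Type u} [Field k]
    (c₀ : k →+* X₀.presheaf.obj (op ⊤)) (σ : X ⟶ X₀) (n : ℕ) {ι : Type v} (E : ι → Set X) : Prop :=
  ∀ a : X, IsClosed {a} → ∃ (s r : ℕ) (C : LocalCoordinates X a s r), s + r = n ∧ C.IsAdapted E ∧
    ∀ l < n, ∃ γ : Fin s → ℕ, C.logMinorsIdeal c₀ σ (n - l) = Ideal.span {C.uMonomial γ}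

/-- The stalk at `a` of the pulled-back cotangent sheaf `σ^* Ω¹_{X₀}`, i.e. of the submodule of
`Ω¹_X` generated by the pullbacks `d(f ∘ σ)` of the differentials of functions `f` on `X₀`. -/
noncomputable def pulledBackCotangent {k : Type u} [Field k] (c₀ : k →+* X₀.presheaf.obj (op ⊤)) (σ : X ⟶ X₀)
    (a : X) : Submodule (X.presheaf.stalk a) (OneForms (stalkConst (pullbackConst c₀ σ) a)) :=
  Submodule.span _ (Set.range fun f : X₀.presheaf.stalk (σ.base a) =>
    differential (stalkConst (pullbackConst c₀ σ) a) (σ.stalkMap a f))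

/-- Hsiang–Pati coordinates at `a`: local coordinates `(u, v)` of the `n`-dimensional space `X`
such that the pulled-back cotangent sheaf is generated at `a` by the differential monomials
`d(u^{α_i})`, `i = 1, …, s`, and `d(u^{β_j} v_j)`, `j = 1, …, n - s`, where `D = (u₁ ⋯ u_s = 0)`
near `a`, the multiindices `α_i` are linearly independent over `ℚ`, and `{α_i, β_j}` is totally
ordered by the componentwise order. -/
def HasHsiangPatiCoordinates {k : Type u} [Field k] (c₀ : k →+* X₀.presheaf.obj (op ⊤))
    (σ : X ⟶ X₀) (n : ℕ) (D : Set X) (a : X) : Prop :=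
  ∃ (s r : ℕ) (C : LocalCoordinates X a s r) (α : Fin s → Fin s → ℕ) (β : Fin r → Fin s → ℕ),
    s + r = n ∧
    D ∩ C.U = ⋃ i, vanishingLocus (C.u i) ∧
    LinearIndependent ℚ (fun i j => (α i j : ℚ)) ∧
    IsChain (· ≤ ·) (Set.range α ∪ Set.range β) ∧
    pulledBackCotangent c₀ σ a = Submodule.span _
      (Set.range (fun i => differential (stalkConst (pullbackConst c₀ σ) a) (C.uMonomial (α i))) ∪
       Set.range (fun j =>
        differential (stalkConst (pullbackConst c₀ σ) a) (C.uMonomial (β j) * C.vGerm j)))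

end Spaces

section Algebraic

variable {k : Type u} [Field k] {X X₀ : Scheme.{u}}

/-- A (reduced) algebraic variety over `k`: a reduced separated scheme of finite type. -/
structure IsAlgebraicVariety (f : X₀ ⟶ Spec (.of k)) : Prop where
  isReduced : IsReduced X₀
  isSeparated : IsSeparated f
  locallyOfFiniteType : LocallyOfFiniteType f
  quasiCompact : QuasiCompact f

/-- The constant functions on a scheme over `k`. -/
noncomputable def schemeConst (f : X₀ ⟶ Spec (.of k)) :
    k →+* X₀.toLocallyRingedSpace.presheaf.obj (op ⊤) :=
  ((Scheme.ΓSpecIso (.of k)).inv ≫ f.appTop).hom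

/-- A resolution of singularities `σ : (X, E) ⟶ (X₀, Sing X₀)` of an algebraic variety, where `X`
is smooth of dimension `n` and `E i`, `i : ι`, are the components of the exceptional divisor. -/
structure IsAlgebraicResolution (f : X₀ ⟶ Spec (.of k)) (σ : X ⟶ X₀) (n : ℕ) {ι : Type v}
    (E : ι → Set X) : Prop where
  smooth : SmoothOfRelativeDimension n (σ ≫ f)
  isProper : IsProper σ
  isDesingularization : IsDesingularization σ.toLRSHom n E

/-- The morphism `σ` is a resolution of singularities of the cotangent sheaf of the algebraic
variety `X₀`: every closed point of `X` has étale Hsiang–Pati coordinates, i.e. Hsiang–Pati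
coordinates on an étale neighbourhood `p : U ⟶ X`. -/
def ResolvesCotangentSheafAlgebraic (f : X₀ ⟶ Spec (.of k)) (σ : X ⟶ X₀) (n : ℕ) {ι : Type v}
    (E : ι → Set X) : Prop :=
  ∀ a : X, IsClosed {a} → ∃ (U : Scheme.{u}) (p : U ⟶ X) (b : U), Etale p ∧ p b = a ∧
    HasHsiangPatiCoordinates (schemeConst f) (p ≫ σ).toLRSHom n (p ⁻¹' ⋃ i, E i) b

end Algebraic

section Analytic

variable {𝕜 : Type u} [RCLike 𝕜] {X X₀ : LocallyRingedSpace.{u}}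

/-- The morphism `j`, from an open subspace `V` of a space `X` with field of constants `𝕜` to `𝕜^N`,
is a morphism over `𝕜`. -/
def IsOverConst {N : ℕ} (c : 𝕜 →+* X.presheaf.obj (op ⊤)) {V : Opens X}
    (j : X.restrict V.isOpenEmbedding ⟶ analyticAffineSpace 𝕜 N) : Prop :=
  pullbackConst (analyticAffineSpace.constants 𝕜 N) j =
    pullbackConst c (X.ofRestrict V.isOpenEmbedding)

/-- A smooth analytic space (analytic manifold) of dimension `n` over `𝕜 = ℝ` or `ℂ`: a Hausdorff
space with a sheaf of local `𝕜`-algebras which is locally isomorphic to an open subset of `𝕜^n` with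
its sheaf of analytic functions. -/
structure IsAnalyticManifold (c : 𝕜 →+* X.presheaf.obj (op ⊤)) (n : ℕ) : Prop where
  t2 : T2Space X
  exists_chart : ∀ a : X, ∃ (V : Opens X)
    (j : X.restrict V.isOpenEmbedding ⟶ analyticAffineSpace 𝕜 n),
    a ∈ V ∧ IsOverConst c j ∧ LocallyRingedSpace.IsOpenImmersion j

/-- The morphism `j : Y ⟶ 𝕜^N` is an isomorphism of `Y` with the closed analytic subspace of an open
set `Ω ⊆ 𝕜^N` defined by finitely many analytic functions `g₁, …, g_m` on `Ω`, i.e. with the zero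
set of the `g_i`, with structure sheaf the restriction of `𝒪_Ω / (g₁, …, g_m)`. -/
def IsLocalModel {Y : LocallyRingedSpace.{u}} {N : ℕ} (j : Y ⟶ analyticAffineSpace 𝕜 N) : Prop :=
  ∃ (Ω : Opens (analyticAffineSpace 𝕜 N)) (m : ℕ)
    (g : Fin m → (analyticAffineSpace 𝕜 N).presheaf.obj (op Ω)),
    IsEmbedding (j.base : Y → analyticAffineSpace 𝕜 N) ∧
    Set.range (j.base : Y → analyticAffineSpace 𝕜 N) = ↑Ω ∩ ⋂ i, vanishingLocus (g i) ∧
    ∀ (y : Y) (hy : j.base y ∈ Ω), Function.Surjective (j.stalkMap y) ∧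
      RingHom.ker (j.stalkMap y).hom = Ideal.span (Set.range fun i =>
        (analyticAffineSpace 𝕜 N).presheaf.germ Ω (j.base y) hy (g i))

/-- A reduced complex- or real-analytic variety (analytic space over `𝕜 = ℂ` or `ℝ`): a Hausdorff
space with a reduced sheaf of local `𝕜`-algebras which is locally isomorphic to a closed analytic
subspace of an open subset of some `𝕜^N`. -/
structure IsAnalyticVariety (c₀ : 𝕜 →+* X₀.presheaf.obj (op ⊤)) : Prop where
  t2 : T2Space X₀
  isReduced : IsReducedSpace X₀
  exists_embedding : ∀ b : X₀, ∃ (V : Opens X₀) (N : ℕ)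
    (j : X₀.restrict V.isOpenEmbedding ⟶ analyticAffineSpace 𝕜 N),
    b ∈ V ∧ IsOverConst c₀ j ∧ IsLocalModel j

/-- A resolution of singularities `σ : (X, E) ⟶ (X₀, Sing X₀)` of an analytic variety, where `X`
is smooth of dimension `n` and `E i`, `i : ι`, are the components of the exceptional divisor. -/
structure IsAnalyticResolution (c₀ : 𝕜 →+* X₀.presheaf.obj (op ⊤)) (σ : X ⟶ X₀) (n : ℕ)
    {ι : Type v} (E : ι → Set X) : Prop where
  smooth : IsAnalyticManifold (pullbackConst c₀ σ) n
  isProper : IsProperMap (σ.base : X → X₀)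
  isDesingularization : IsDesingularization σ n E

/-- The morphism `σ` is a resolution of singularities of the cotangent sheaf of the analytic
variety `X₀`: every point of `X` has analytic Hsiang–Pati coordinates. -/
def ResolvesCotangentSheafAnalytic (c₀ : 𝕜 →+* X₀.presheaf.obj (op ⊤)) (σ : X ⟶ X₀) (n : ℕ)
    {ι : Type v} (E : ι → Set X) : Prop :=
  ∀ a : X, HasHsiangPatiCoordinates c₀ σ n (⋃ i, E i) a

end Analytic

/-!
The equivalence is a statement about the local ring `R` of `X` at a closed point, with coordinates
`(u, v)`, and about the module `M` generated by the differentials of the functions pulled back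
from `X₀`. Its elements are written in the logarithmic basis `du_i / u_i`, `dv_j`, so that the
stalks of the Fitting ideals are the ideals generated by the minors of the elements of `M`
(`minorsIdeal`).

The common language of the algebraic and the analytic case is that of a `Frame`: generators of the
maximal ideal together with dual derivations, which exist for any choice of coordinates of an
`IsSmoothLocalRing`. Smooth local rings are obtained from the module of Kähler differentials for
algebraic varieties (`isSmoothLocalRing_of_kaehlerDifferential`), and from charts by germs of
analytic functions for manifolds (`IsGermChart`).

**From differential monomials to Fitting ideals** (`HasHsiangPatiCoordinates.exists_minorsIdeal_eq`).
In the logarithmic basis the coefficients of `d(u^{α_i})` and `d(u^{β_j} v_j)` form the product of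
the diagonal matrix of the monomials `u^{α_i}`, `u^{β_j}` and an invertible matrix, since the `α_i`
are linearly independent. As the exponents form a chain, the minors of order `m` are generated by
the product of the `m` smallest monomials. Hsiang–Pati coordinates need not be those of the divisor,
but the coordinates `u` of two systems agree up to units, because their zero sets are the same
(`HasNullstellensatz`), and then the logarithmic forms and the ideals of minors are the same. In the
algebraic case, the ideals are compared on an étale neighbourhood, and the equality descends by
faithful flatness.

**From Fitting ideals to differential monomials** (`IsEtaleClass.exists_isPartialSystem`). The
differential monomials are found one after the other (`IsPartialSystem`). Suppose that those with
indices in `T` are known, with derivations dual to them, such that the derivations with index outside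
of `T` kill these monomials. The Fitting ideal of the next order being `(u^{Γ(|T|+1)})`, the
exponent `γ = Γ(|T|+1) - Γ(|T|)` is an upper bound of the exponents so far, all derivatives of
functions `f` from `X₀` along the remaining derivations are divisible by `u^γ`, and for some `f` and
some derivation the quotient is a unit (`IsPartialSystem.exists_next`). Write `f = t + u^γ g`, where
the expansion of `t` in `u` has no multiple of `u^γ` (`IsEtaleClass.exists_trunc`). The remaining
derivations kill `t`, whence `d(u^γ g) ∈ M` (`IsPartialSystem.mem_span_of_isTrunc`). If `g` is a unit
and `γ` is linearly independent of the exponents of the previous `u^{α_i}`, then `g` is absorbed by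
multiplying the `u_l` by powers of a root of `g`, chosen such that the previous monomials do not
change, and the next monomial is `u^γ` (`IsPartialSystem.exists_insert_inl`). Otherwise `g` minus its
value is a coordinate `v_j`, and the next monomial is `u^γ v_j`; if the value is not zero, then
`d(u^γ)` is in `M` already (`IsPartialSystem.exists_insert_inr`, `IsPartialSystem.vec_mono_mem`).

The three operations used here, splitting off the part of a function which does not depend on a given
coordinate, taking values, and taking roots, are collected in `IsEtaleClass`. In the analytic case
they exist in `R` itself, by Hadamard's lemma. In the algebraic case they exist after étale
extensions: coordinates are an étale map to affine space, and the first operation is the base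
change of this étale map along a coordinate projection
(`IsAlgebraicSmoothLocalRing.isEtaleClass`).
-/

/-! ### Ideals of minors of a set of vectors -/

section Minors

open scoped Matrix

variable {R : Type*} [CommRing R]

/-- A multilinear map which takes values in an ideal on tuples of elements of `G` also takes values
in this ideal on tuples of elements of the span of `G`. -/
theorem MultilinearMap.mem_of_mem_span {κ V : Type*} [Fintype κ] [DecidableEq κ] [AddCommGroup V]
    [Module R V] (f : MultilinearMap R (fun _ : κ => V) R) (I : Ideal R) (G : Set V)
    (h : ∀ g : κ → V, (∀ a, g a ∈ G) → f g ∈ I) (g : κ → V)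
    (hg : ∀ a, g a ∈ Submodule.span R G) : f g ∈ I := by
  suffices H : ∀ (S : Finset κ) (g : κ → V), (∀ a ∈ S, g a ∈ Submodule.span R G) →
      (∀ a ∉ S, g a ∈ G) → f g ∈ I from H Finset.univ g (fun a _ => hg a) (by simp)
  intro S
  induction S using Finset.induction_on with
  | empty => exact fun g _ h2 => h g fun a => h2 a (by simp)
  | insert a S ha ih =>
    intro g h1 h2
    have key : ∀ x ∈ Submodule.span R G, f (Function.update g a x) ∈ I := by
      intro x hx
      induction hx using Submodule.span_induction with
      | mem x hx =>
        refine ih _ (fun b hb => ?_) (fun b hb => ?_)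
        · have : b ≠ a := fun e => ha (e ▸ hb)
          simpa [Function.update_of_ne this] using h1 b (by simp [hb])
        · by_cases e : b = a
          · subst e; simpa using hx
          · simpa [Function.update_of_ne e] using h2 b (by simp [hb, e])
      | zero => simp
      | add x y _ _ hx hy => rw [f.map_update_add]; exact I.add_mem hx hy
      | smul r x _ hx => rw [f.map_update_smul]; exact I.mul_mem_left _ hx
    simpa using key (g a) (h1 a (by simp))

variable {ι ι' : Type*} [Fintype ι] [Fintype ι']

/-- The ideal generated by the minors of order `m` of the matrices whose rows are in `G`. -/
def minorsIdeal (G : Set (ι → R)) (m : ℕ) : Ideal R :=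
  Ideal.span {δ | ∃ (g : Fin m → ι → R) (J : Fin m → ι), (∀ a, g a ∈ G) ∧
    δ = (Matrix.of fun a b => g a (J b)).det}

omit [Fintype ι] in
theorem minorsIdeal_zero (G : Set (ι → R)) : minorsIdeal G 0 = ⊤ := by
  rw [Ideal.eq_top_iff_one]
  exact Ideal.subset_span ⟨Fin.elim0, Fin.elim0, fun a => a.elim0, by simp⟩

/-- Rows may be taken in the span of `G`, and columns may be replaced by linear combinations. -/
theorem det_mem_minorsIdeal {κ : Type*} [Fintype κ] [DecidableEq κ] (G : Set (ι → R)) {m : ℕ}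
    (hm : Fintype.card κ = m) (g : κ → ι → R) (hg : ∀ a, g a ∈ Submodule.span R G)
    (P : κ → ι → R) : (Matrix.of fun a b => P b ⬝ᵥ g a).det ∈ minorsIdeal G m := by
  classical
  let e : Fin m ≃ κ := (Fintype.equivFinOfCardEq hm).symm
  have main : ∀ (g : Fin m → ι → R) (P : Fin m → ι → R), (∀ a, g a ∈ Submodule.span R G) →
      (Matrix.of fun a b => P b ⬝ᵥ g a).det ∈ minorsIdeal G m := by
    intro g P hg
    let f1 : MultilinearMap R (fun _ : Fin m => ι → R) R :=
      (Matrix.detRowAlternating (R := R) (n := Fin m)).toMultilinearMap.compLinearMap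
        fun _ => (Matrix.mulVecLin (Matrix.of P))
    refine f1.mem_of_mem_span (minorsIdeal G m) G (fun g hg => ?_) g hg
    let f2 : MultilinearMap R (fun _ : Fin m => ι → R) R :=
      (Matrix.detRowAlternating (R := R) (n := Fin m)).toMultilinearMap.compLinearMap
        fun _ => (Matrix.mulVecLin (Matrix.of g))
    have e2 : f1 g = f2 P := by
      change (Matrix.of fun a => Matrix.of P *ᵥ g a).det =
        (Matrix.of fun b => Matrix.of g *ᵥ P b).det
      rw [← Matrix.det_transpose]
      congr 1
      ext a b
      exact dotProduct_comm _ _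
    rw [e2]
    refine f2.mem_of_mem_span (minorsIdeal G m) (Set.range fun i => Pi.single i 1)
      (fun Q hQ => ?_) P (fun b => ?_)
    · choose J hJ using hQ
      refine Ideal.subset_span ⟨g, J, hg, ?_⟩
      change (Matrix.of fun b => Matrix.of g *ᵥ Q b).det = _
      rw [← Matrix.det_transpose]
      congr 1
      ext a b
      simp [← hJ]
    · have : P b = ∑ i, P b i • (Pi.single i 1 : ι → R) := by
        ext j; simp [Finset.sum_apply, Pi.single_apply]
      rw [this]
      exact Submodule.sum_mem _ fun i _ => Submodule.smul_mem _ _ (Submodule.subset_span ⟨i, rfl⟩)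
  have := main (g ∘ e) (P ∘ e) (fun a => hg _)
  rw [← Matrix.det_submatrix_equiv_self e] 
  exact this

omit [Fintype ι] in
theorem minorsIdeal_le_of_comb (G : Set (ι → R)) (m : ℕ) (L : (ι → R) → ι' → R) (Q : ι → ι' → R)
    (h : ∀ g ∈ G, ∀ i, g i = Q i ⬝ᵥ L g) : minorsIdeal G m ≤ minorsIdeal (L '' G) m := by
  refine Ideal.span_le.2 ?_
  rintro _ ⟨g, J, hg, rfl⟩
  have : (Matrix.of fun a b => g a (J b)) = Matrix.of fun a b => Q (J b) ⬝ᵥ L (g a) := by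
    ext a b; exact h _ (hg a) _
  rw [this]
  exact det_mem_minorsIdeal _ (by simp) (fun a => L (g a))
    (fun a => Submodule.subset_span (Set.mem_image_of_mem L (hg a))) _

omit [Fintype ι] in
theorem minorsIdeal_map {S : Type*} [CommRing S] (ψ : R →+* S) (G : Set (ι → R)) (m : ℕ) :
    minorsIdeal ((fun g i => ψ (g i)) '' G) m = (minorsIdeal G m).map ψ := by
  unfold minorsIdeal
  rw [Ideal.map_span]
  congr 1
  ext δ
  constructor
  · rintro ⟨g, J, hg, rfl⟩
    choose g' hg' e using hg
    refine ⟨_, ⟨g', J, hg', rfl⟩, ?_⟩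
    rw [RingHom.map_det]
    congr 1
    ext a b
    simp [← e]
  · rintro ⟨_, ⟨g, J, hg, rfl⟩, rfl⟩
    refine ⟨fun a i => ψ (g a i), J, fun a => ⟨g a, hg a, rfl⟩, ?_⟩
    rw [RingHom.map_det]
    congr 1

omit [Fintype ι] in
/-- If column `i` of a square matrix is divisible by `δ i` for `i ∈ T` and by `δ'`, with quotient
in `I`, for the other columns, and if the `δ i` divide `δ'`, then a minor with more than `|T|`
columns is in `∏ δ i * δ' * I`. -/
theorem minorsIdeal_le_of_dvd [DecidableEq ι] (G : Set (ι → R)) (T : Finset ι) (δ : ι → R) (δ' : R)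
    (I : Ideal R) (h1 : ∀ g ∈ G, ∀ i ∈ T, δ i ∣ g i)
    (h2 : ∀ g ∈ G, ∀ i ∉ T, ∃ x ∈ I, g i = δ' * x) (h3 : ∀ i ∈ T, δ i ∣ δ') :
    minorsIdeal G (T.card + 1) ≤ Ideal.span {(∏ i ∈ T, δ i) * δ'} * I := by
  classical
  refine Ideal.span_le.2 ?_
  rintro _ ⟨g, J, hg, rfl⟩
  rw [SetLike.mem_coe]
  by_cases hJ : Function.Injective J
  swap
  · obtain ⟨a, b, hab, hne⟩ : ∃ a b, J a = J b ∧ a ≠ b := by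
      simpa [Function.Injective] using hJ
    rw [Matrix.det_zero_of_column_eq hne (by simp [hab])]
    exact zero_mem _
  let w : ι → R := fun i => if i ∈ T then δ i else δ'
  have hw : ∀ a i, ∃ x, g a i = w i * x ∧ (i ∉ T → x ∈ I) := by
    intro a i
    by_cases hi : i ∈ T
    · obtain ⟨x, hx⟩ := h1 _ (hg a) i hi
      exact ⟨x, by simp [w, hi, hx], fun h => absurd hi h⟩
    · obtain ⟨x, hx, e⟩ := h2 _ (hg a) i hi
      exact ⟨x, by simp [w, hi, e], fun _ => hx⟩
  choose X hX hXI using hw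
  have e : (Matrix.of fun a b => g a (J b)) = Matrix.of fun a b => w (J b) * X a (J b) := by
    ext a b; exact hX _ _
  rw [e, Matrix.det_mul_row (fun b => w (J b)) (fun a b => X a (J b))]
  change _ * (Matrix.of fun a b => X a (J b)).det ∈ _
  refine Ideal.mul_mem_mul ?_ ?_
  · rw [Ideal.mem_span_singleton]
    let S : Finset ι := Finset.univ.map ⟨J, hJ⟩
    have hS : S.card = T.card + 1 := by simp [S]
    have e1 : ∏ b, w (J b) = ∏ i ∈ S, w i := by simp [S]
    rw [e1]
    have hSw : ∏ i ∈ S, w i = (∏ i ∈ S ∩ T, δ i) * δ' ^ (S \ T).card := by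
      rw [← Finset.prod_inter_mul_prod_sdiff S T]
      congr 1
      · exact Finset.prod_congr rfl fun i hi => by simp [w, (Finset.mem_inter.1 hi).2]
      · rw [← Finset.prod_const]
        exact Finset.prod_congr rfl fun i hi => by simp [w, (Finset.mem_sdiff.1 hi).2]
    have hTw : ∏ i ∈ T, δ i = (∏ i ∈ S ∩ T, δ i) * ∏ i ∈ T \ S, δ i := by
      rw [Finset.inter_comm, Finset.prod_inter_mul_prod_sdiff]
    have hc : (S \ T).card = (T \ S).card + 1 := by
      have h1 := Finset.card_sdiff_add_card_inter S T
      have h2 := Finset.card_sdiff_add_card_inter T S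
      rw [Finset.inter_comm] at h2
      omega
    rw [hSw, hTw, hc, pow_succ, mul_assoc]
    refine mul_dvd_mul_left _ (mul_dvd_mul_right ?_ _)
    rw [← Finset.prod_const]
    exact Finset.prod_dvd_prod_of_dvd _ _ fun i hi => h3 i (Finset.mem_sdiff.1 hi).1
  · obtain ⟨b, hb⟩ : ∃ b, J b ∉ T := by
      by_contra! h
      have := Finset.card_le_card_of_injOn (s := Finset.univ) J (fun b _ => h b) hJ.injOn
      simp at this
    rw [Matrix.det_apply]
    refine Ideal.sum_mem _ fun τ _ => ?_
    refine Submodule.smul_of_tower_mem _ _ ?_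
    refine Ideal.mem_of_dvd _ (Finset.dvd_prod_of_mem _ (Finset.mem_univ b)) ?_
    exact hXI _ _ hb

end Minors

/-! ### Local rings with coordinates and dual derivations -/

section Frames

open scoped Matrix
open IsLocalRing

/-- A system of coordinates `x` of a local ring `R`, i.e. generators of the maximal ideal, together
with the partial derivatives `d`: derivations over the constants which are dual to the coordinates
and generate all derivations over the constants. -/
structure Frame {k R : Type u} [Field k] [CommRing R] [IsLocalRing R] (c : k →+* R) (ι : Type)
    [Fintype ι] [DecidableEq ι] where
  /-- The coordinates. -/
  x : ι → R
  /-- The partial derivatives. -/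
  d : ι → Derivation ℤ R R
  span_eq : maximalIdeal R = Ideal.span (Set.range x)
  d_const : ∀ i t, d i (c t) = 0
  d_x : ∀ i j, d i (x j) = if i = j then 1 else 0
  eq_sum : ∀ D : Derivation ℤ R R, (∀ t, D (c t) = 0) → ∀ f, D f = ∑ i, D (x i) * d i f

/-- The common properties of the local rings of smooth algebraic and analytic spaces of dimension
`n` at closed points: `R` is a domain, separated in its maximal-adic topology, in which any `n`
generators of the maximal ideal are primes and extend to a `Frame`. -/
structure IsSmoothLocalRing {k R : Type u} [Field k] [CommRing R] [IsLocalRing R] (c : k →+* R)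
    (n : ℕ) : Prop where
  isDomain : IsDomain R
  eq_zero : ∀ f : R, (∀ N : ℕ, f ∈ maximalIdeal R ^ N) → f = 0
  prime : ∀ (ι : Type) [Fintype ι] [DecidableEq ι] (x : ι → R), Fintype.card ι = n →
    maximalIdeal R = Ideal.span (Set.range x) → ∀ i, Prime (x i)
  exists_frame : ∀ (ι : Type) [Fintype ι] [DecidableEq ι] (x : ι → R), Fintype.card ι = n →
    maximalIdeal R = Ideal.span (Set.range x) → ∃ F : Frame c ι, F.x = x

/-- A rational number, as a constant function. -/
noncomputable def ratConst {k R : Type u} [Field k] [CharZero k] [CommRing R] (c : k →+* R) :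
    ℚ →+* R :=
  c.comp (algebraMap ℚ k)

namespace Frame

section Basic

variable {k R : Type u} [Field k] [CommRing R] [IsLocalRing R] {c : k →+* R}
  {ι : Type} [Fintype ι] [DecidableEq ι] (F : Frame c ι)

theorem x_mem (i : ι) : F.x i ∈ maximalIdeal R := by
  rw [F.span_eq]; exact Ideal.subset_span ⟨i, rfl⟩

theorem d_self (i : ι) : F.d i (F.x i) = 1 := by simp [F.d_x]

theorem d_of_ne {i j : ι} (h : i ≠ j) : F.d i (F.x j) = 0 := by simp [F.d_x, h]

/-- A constant derivation is determined by the derivatives of the coordinates. -/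
theorem ext_derivation {D D' : Derivation ℤ R R} (h : ∀ t, D (c t) = 0) (h' : ∀ t, D' (c t) = 0)
    (hx : ∀ i, D (F.x i) = D' (F.x i)) (f : R) : D f = D' f := by
  rw [F.eq_sum D h, F.eq_sum D' h']; simp [hx]

theorem d_comm (i j : ι) (f : R) : F.d i (F.d j f) = F.d j (F.d i f) := by
  have h := F.ext_derivation (D := ⁅F.d i, F.d j⁆) (D' := 0)
    (by simp [Derivation.commutator_apply, F.d_const]) (by simp) (fun l => by
      simp only [Derivation.commutator_apply, F.d_x]
      split_ifs <;> simp) f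
  rw [Derivation.commutator_apply] at h
  exact sub_eq_zero.1 h

theorem not_dvd {i j : ι} (h : i ≠ j) : ¬ F.x i ∣ F.x j := by
  rintro ⟨a, ha⟩
  have h1 := congrArg (F.d j) ha
  rw [F.d_self, Derivation.leibniz, F.d_of_ne h.symm, smul_zero, add_zero, smul_eq_mul] at h1
  have : (1 : R) ∈ maximalIdeal R := h1 ▸ Ideal.mul_mem_right _ _ (F.x_mem i)
  exact (Ideal.ne_top_iff_one _).1 (maximalIdeal.isMaximal R).ne_top this

omit [IsLocalRing R] in
theorem natCast_isUnit [CharZero k] (c : k →+* R) {n : ℕ} (hn : n ≠ 0) : IsUnit (n : R) := by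
  have : IsUnit (n : k) := IsUnit.mk0 _ (by exact_mod_cast hn)
  simpa using this.map c

/-- If `x_i ∂f/∂x_i = -N f` with `N > 0` then `f = 0`. -/
theorem eq_zero_of_euler [CharZero k] {n : ℕ} (hR : IsSmoothLocalRing c n) (i : ι) {f : R} {N : ℕ}
    (hN : N ≠ 0) (h : F.x i * F.d i f + N * f = 0) : f = 0 := by
  have := hR.isDomain
  have hx : F.x i ≠ 0 := fun e => by simpa [e] using F.d_self i
  suffices H : ∀ t : ℕ, F.x i ^ t ∣ f from
    hR.eq_zero f fun t => Ideal.mem_of_dvd _ (H t) (Ideal.pow_mem_pow (F.x_mem i) t)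
  intro t
  induction t with
  | zero => simp
  | succ t ih =>
    obtain ⟨g, rfl⟩ := ih
    have e : F.x i ^ t * (F.x i * F.d i g + ((t + N : ℕ) : R) * g) = 0 := by
      rw [← h, Derivation.leibniz, Derivation.leibniz_pow, F.d_self]
      cases t with
      | zero => simp
      | succ t => simp; ring
    have e2 := (mul_eq_zero.1 e).resolve_left (pow_ne_zero _ hx)
    obtain ⟨w, hw⟩ := natCast_isUnit c (n := t + N) (by omega)
    rw [pow_succ]
    refine mul_dvd_mul_left _ ?_
    rw [← hw] at e2
    refine (Units.dvd_mul_left (u := w)).1 ⟨-F.d i g, ?_⟩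
    linear_combination e2

/-- A function which does not depend on `x_i` is not a nonzero multiple of `x_i`. -/
theorem eq_zero_of_dvd [CharZero k] {n : ℕ} (hR : IsSmoothLocalRing c n) (i : ι) {f : R}
    (hf : F.d i f = 0) (h : F.x i ∣ f) : f = 0 := by
  obtain ⟨g, rfl⟩ := h
  rw [Derivation.leibniz, F.d_self] at hf
  rw [F.eq_zero_of_euler hR i (N := 1) one_ne_zero (f := g) (by simpa using hf), mul_zero]

end Basic

section Log

variable {k R : Type u} [Field k] [CommRing R] [IsLocalRing R] {c : k →+* R} {s r : ℕ}
  (F : Frame c (Fin s ⊕ Fin r))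

/-- The logarithmic derivations `u_i ∂/∂u_i`, `∂/∂v_j`, where `u` are the coordinates with index in
the left summand. -/
def theta : Fin s ⊕ Fin r → Derivation ℤ R R
  | .inl i => F.x (.inl i) • F.d (.inl i)
  | .inr j => F.d (.inr j)

/-- The coefficients of `df` with respect to the logarithmic basis `du_i / u_i`, `dv_j`. -/
def vec (f : R) : Fin s ⊕ Fin r → R := fun a => F.theta a f

/-- The monomial `u^α`. -/
def mono (α : Fin s → ℕ) : R := ∏ i, F.x (.inl i) ^ α i

@[simp]
theorem theta_inl (i : Fin s) (f : R) :
    F.theta (.inl i) f = F.x (.inl i) * F.d (.inl i) f := rfl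

@[simp]
theorem theta_inr (j : Fin r) (f : R) : F.theta (.inr j) f = F.d (.inr j) f := rfl

theorem theta_const (a : Fin s ⊕ Fin r) (t : k) : F.theta a (c t) = 0 := by
  cases a <;> simp [F.d_const]

theorem mono_zero : F.mono 0 = 1 := by simp [mono]

theorem mono_add (α β : Fin s → ℕ) : F.mono (α + β) = F.mono α * F.mono β := by
  simp [mono, pow_add, Finset.prod_mul_distrib]

theorem mono_sum {κ : Type*} (T : Finset κ) (e : κ → Fin s → ℕ) :
    F.mono (∑ l ∈ T, e l) = ∏ l ∈ T, F.mono (e l) := by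
  classical
  induction T using Finset.induction_on with
  | empty => simp [mono_zero]
  | insert a T ha ih => rw [Finset.sum_insert ha, Finset.prod_insert ha, mono_add, ih]

theorem mono_single (i : Fin s) : F.mono (Pi.single i 1) = F.x (.inl i) := by
  rw [mono, Finset.prod_eq_single i]
  · simp
  · intro j _ hj; simp [hj]
  · simp

theorem mono_dvd_of_le {α β : Fin s → ℕ} (h : α ≤ β) : F.mono α ∣ F.mono β :=
  Finset.prod_dvd_prod_of_dvd _ _ fun i _ => pow_dvd_pow _ (h i)

theorem mono_ne_zero {n : ℕ} (hR : IsSmoothLocalRing c n) (α : Fin s → ℕ) : F.mono α ≠ 0 := by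
  have := hR.isDomain
  refine Finset.prod_ne_zero_iff.2 fun i _ => pow_ne_zero _ fun e => ?_
  simpa [e] using F.d_self (.inl i)

theorem le_of_mono_dvd {n : ℕ} (hR : IsSmoothLocalRing c n) (hn : s + r = n) {α β : Fin s → ℕ}
    (h : F.mono α ∣ F.mono β) : α ≤ β := by
  have := hR.isDomain
  have hp : ∀ i, Prime (F.x i) := hR.prime _ F.x (by simpa using hn) F.span_eq
  intro i
  by_contra! hi
  have h1 : F.x (.inl i) ^ (β i + 1) ∣ F.mono β :=
    (pow_dvd_pow _ hi).trans ((Finset.dvd_prod_of_mem (fun i => F.x (.inl i) ^ α i)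
      (Finset.mem_univ i)).trans h)
  rw [mono, ← Finset.mul_prod_erase _ _ (Finset.mem_univ i), pow_succ] at h1
  have h2 := (mul_dvd_mul_iff_left (pow_ne_zero _ (hp _).ne_zero)).1 h1
  obtain ⟨j, hj, hd⟩ := (hp _).exists_mem_finset_dvd h2
  exact F.not_dvd (by simpa using (Finset.ne_of_mem_erase hj).symm) ((hp _).dvd_of_dvd_pow hd)

/-- The logarithmic derivative of a monomial along a derivation for which all `u_i` are
eigenvectors. -/
theorem derivation_mono (D : Derivation ℤ R R) (l : Fin s → R)
    (h : ∀ i, D (F.x (.inl i)) = l i * F.x (.inl i)) (α : Fin s → ℕ) :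
    D (F.mono α) = (∑ i, α i * l i) * F.mono α := by
  classical
  unfold mono
  suffices H : ∀ S : Finset (Fin s), D (∏ i ∈ S, F.x (.inl i) ^ α i) =
      (∑ i ∈ S, α i * l i) * ∏ i ∈ S, F.x (.inl i) ^ α i from H _
  intro S
  induction S using Finset.induction_on with
  | empty => simp
  | insert a S ha ih =>
    have e : D (F.x (.inl a) ^ α a) = α a * l a * F.x (.inl a) ^ α a := by
      rw [Derivation.leibniz_pow, h]
      cases α a with
      | zero => simp
      | succ t => simp; ring
    rw [Finset.prod_insert ha, Finset.sum_insert ha, Derivation.leibniz, ih, e]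
    simp only [smul_eq_mul]
    ring

theorem theta_mono (a : Fin s ⊕ Fin r) (α : Fin s → ℕ) :
    F.theta a (F.mono α) = (Sum.elim (fun i => (α i : R)) 0 a) * F.mono α := by
  cases a with
  | inl i =>
    rw [F.derivation_mono (F.theta (.inl i)) (fun j => if i = j then 1 else 0)]
    · simp
    · intro j; simp only [theta_inl, F.d_x]; split_ifs <;> simp_all
  | inr j =>
    rw [F.derivation_mono (F.theta (.inr j)) (fun j => 0)]
    · simp
    · intro j; simp [F.d_x]

theorem theta_v (a : Fin s ⊕ Fin r) (j : Fin r) :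
    F.theta a (F.x (.inr j)) = if a = .inr j then 1 else 0 := by
  cases a <;> simp [F.d_x]

theorem vec_add (f g : R) : F.vec (f + g) = F.vec f + F.vec g := by
  ext; simp [vec]

theorem vec_const_mul {e : R} (he : ∀ i, F.d i e = 0) (f : R) : F.vec (e * f) = e • F.vec f := by
  ext a; cases a <;> simp [vec, he]

/-- A derivation which preserves the ideals `(u_i)` is a combination of the logarithmic
derivations. -/
theorem exists_comb (D : Derivation ℤ R R) (hD : ∀ t, D (c t) = 0)
    (h : ∀ i, F.x (.inl i) ∣ D (F.x (.inl i))) :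
    ∃ q : Fin s ⊕ Fin r → R, ∀ f, D f = q ⬝ᵥ F.vec f := by
  choose q hq using h
  refine ⟨Sum.elim q fun j => D (F.x (.inr j)), fun f => ?_⟩
  rw [F.eq_sum D hD]
  simp only [Fintype.sum_sum_type, dotProduct, Sum.elim_inl, Sum.elim_inr, vec, theta_inl,
    theta_inr, hq]
  congr 1
  exact Finset.sum_congr rfl fun i _ => by ring

theorem dvd_theta (a : Fin s ⊕ Fin r) (i : Fin s) :
    F.x (.inl i) ∣ F.theta a (F.x (.inl i)) := by
  cases a with
  | inl l =>
    rw [theta_inl, F.d_x]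
    split_ifs with h
    · rw [h]; simp
    · simp
  | inr j => simp [F.d_x]

/-- The logarithmic derivations of two systems of coordinates with the same ideals `(u_i)`. -/
theorem exists_comb_theta {s' r' : ℕ} (F' : Frame c (Fin s' ⊕ Fin r'))
    (h : ∀ i, ∃ i', Associated (F'.x (.inl i')) (F.x (.inl i))) :
    ∃ Q : Fin s' ⊕ Fin r' → Fin s ⊕ Fin r → R, ∀ a f, F'.vec f a = Q a ⬝ᵥ F.vec f := by
  have : ∀ a, ∃ q : Fin s ⊕ Fin r → R, ∀ f, F'.theta a f = q ⬝ᵥ F.vec f := by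
    intro a
    refine F.exists_comb _ (F'.theta_const a) fun i => ?_
    obtain ⟨i', w, hw⟩ := h i
    rw [← hw, Derivation.leibniz]
    refine dvd_add ?_ ?_
    · exact Dvd.dvd.mul_right (Units.mul_right_dvd.2 dvd_rfl) _
    · refine Dvd.dvd.mul_left (Units.mul_right_dvd.2 ?_) _
      exact F'.dvd_theta a i'
  choose Q hQ using this
  exact ⟨Q, fun a f => hQ a f⟩

end Log

section Maps

variable {k R R' : Type u} [Field k] [CommRing R] [IsLocalRing R] [CommRing R'] [IsLocalRing R']
  {c : k →+* R} {c' : k →+* R'} {ι : Type} [Fintype ι] [DecidableEq ι]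

/-- The ring homomorphism `ψ` takes the coordinates and partial derivatives of `F` to those
of `F'`. -/
structure IsMap (ψ : R →+* R') (F : Frame c ι) (F' : Frame c' ι) : Prop where
  map_x : ∀ i, F'.x i = ψ (F.x i)
  map_d : ∀ i f, F'.d i (ψ f) = ψ (F.d i f)

theorem IsMap.map_theta {s r : ℕ} {ψ : R →+* R'} {F : Frame c (Fin s ⊕ Fin r)}
    {F' : Frame c' (Fin s ⊕ Fin r)} (h : F.IsMap ψ F') (a : Fin s ⊕ Fin r) (f : R) :
    F'.theta a (ψ f) = ψ (F.theta a f) := by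
  cases a <;> simp [h.map_x, h.map_d]

theorem IsMap.map_vec {s r : ℕ} {ψ : R →+* R'} {F : Frame c (Fin s ⊕ Fin r)}
    {F' : Frame c' (Fin s ⊕ Fin r)} (h : F.IsMap ψ F') (f : R) :
    F'.vec (ψ f) = fun a => ψ (F.vec f a) := funext fun a => h.map_theta a f

theorem IsMap.map_mono {s r : ℕ} {ψ : R →+* R'} {F : Frame c (Fin s ⊕ Fin r)}
    {F' : Frame c' (Fin s ⊕ Fin r)} (h : F.IsMap ψ F') (α : Fin s → ℕ) :
    F'.mono α = ψ (F.mono α) := by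
  simp [mono, h.map_x]

end Maps

end Frame

end Frames

/-! ### Truncated functions -/

section Stages

open scoped Matrix
open IsLocalRing

variable {k R : Type u} [Field k] [CharZero k] [CommRing R] [IsLocalRing R] {c : k →+* R}
  {s r n : ℕ}

namespace Frame

/-- The functions whose Taylor expansions in `u` contain no multiple of `u^γ`; such a function is
obtained from `0` by successively multiplying by some `u_i` and adding a function which does
not depend on `u_i`. -/
inductive IsTrunc (F : Frame c (Fin s ⊕ Fin r)) : (Fin s → ℕ) → R → Prop
  | zero : IsTrunc F 0 0
  | step {γ : Fin s → ℕ} {h : R} (i : Fin s) (f : R) (hf : F.d (.inl i) f = 0)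
      (hh : IsTrunc F γ h) : IsTrunc F (γ + Pi.single i 1) (f + F.x (.inl i) * h)

variable {F : Frame c (Fin s ⊕ Fin r)}

theorem IsTrunc.eq_zero (hR : IsSmoothLocalRing c n) {γ : Fin s → ℕ} {h : R}
    (hh : F.IsTrunc γ h) (hd : F.mono γ ∣ h) : h = 0 := by
  have := hR.isDomain
  induction hh with
  | zero => rfl
  | step i f hf hh ih =>
    rw [mono_add, mono_single] at hd
    have h1 : F.x (.inl i) ∣ f :=
      (dvd_add_left (dvd_mul_right _ _)).1 ((dvd_mul_left _ _).trans hd)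
    have h2 := F.eq_zero_of_dvd hR _ hf h1
    rw [h2, zero_add, mul_comm] at hd
    have hx : F.x (.inl i) ≠ 0 := fun e => by simpa [e] using F.d_self (.inl i)
    rw [h2, ih ((mul_dvd_mul_iff_left hx).1 ?_), mul_zero, add_zero]
    exact hd

omit [CharZero k] in
theorem IsTrunc.derivation {D : Derivation ℤ R R} {l : Fin s → R}
    (hl : ∀ i j, F.d (.inl i) (l j) = 0) (hD : ∀ i, D (F.x (.inl i)) = l i * F.x (.inl i))
    (hc : ∀ i f, F.d (.inl i) f = 0 → F.d (.inl i) (D f) = 0) {γ : Fin s → ℕ} {h : R}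
    (hh : F.IsTrunc γ h) : ∀ μ : R, (∀ i, F.d (.inl i) μ = 0) → F.IsTrunc γ (D h + μ * h) := by
  induction hh with
  | zero => intro μ _; simpa using IsTrunc.zero
  | @step γ h i f hf hh ih =>
    intro μ hμ
    have := IsTrunc.step (F := F) i (D f + μ * f) (by simp [hc i f hf, hf, hμ])
      (ih (l i + μ) fun j => by simp [hl, hμ])
    convert this using 1
    simp only [map_add, Derivation.leibniz, hD, smul_eq_mul]
    ring

/-- The functions `u^{e_l}`, for `l = inl i`, and `u^{e_l} v_j`, for `l = inr j`. -/
def monoV (F : Frame c (Fin s ⊕ Fin r)) (e : Fin s ⊕ Fin r → Fin s → ℕ) (l : Fin s ⊕ Fin r) : R :=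
  F.mono (e l) * Sum.elim (fun _ => 1) (fun j => F.x (.inr j)) l

end Frame

/-! ### Partial systems of differential monomials -/

/-- Numerical data of a partial system of differential monomials `d(u^{e_l})`, `d(u^{e_l} v_j)`
with indices `l` in a subset `T` of `Fin s ⊕ Fin r`: the exponents `e`, an invertible rational matrix
`A` (with inverse `B`) whose rows with index in `T` are the exponents of the `u^{e_l}`, and an upper
bound `γ` of the exponents. -/
structure MonomialData (s r : ℕ) where
  /-- The exponents. -/
  e : Fin s ⊕ Fin r → Fin s → ℕ
  /-- A matrix completing the exponents without factor `v_j` to a basis of `ℚ^s`. -/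
  A : Matrix (Fin s) (Fin s) ℚ
  /-- The inverse of `A`. -/
  B : Matrix (Fin s) (Fin s) ℚ
  /-- The upper bound of the exponents. -/
  γ : Fin s → ℕ

/-- The differential monomials with indices in `T` are part of a system of generators of the module
of differential forms generated by `df`, `f ∈ G`, and generate it modulo `u^γ`. The ideals of minors
of this module are generated by the monomials `u^{Γ m}`. -/
structure IsPartialSystem (F : Frame c (Fin s ⊕ Fin r)) (G : Set R) (Γ : ℕ → Fin s → ℕ)
    (T : Finset (Fin s ⊕ Fin r)) (S : MonomialData s r) : Prop where
  mul_eq : S.A * S.B = 1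
  A_eq : ∀ i, .inl i ∈ T → ∀ l, S.A i l = S.e (.inl i) l
  le : ∀ l ∈ T, S.e l ≤ S.γ
  chain : ∀ l ∈ T, ∀ l' ∈ T, S.e l ≤ S.e l' ∨ S.e l' ≤ S.e l
  sum : ∑ l ∈ T, S.e l = Γ T.card
  mem : ∀ l ∈ T, F.vec (F.monoV S.e l) ∈ Submodule.span R (F.vec '' G)
  inv : ∀ f ∈ G, ∃ q : Fin s ⊕ Fin r → R, ∀ a,
    F.mono S.γ ∣ F.vec f a - ∑ l ∈ T, q l * F.vec (F.monoV S.e l) a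
  minors : ∀ m ≤ s + r, minorsIdeal (F.vec '' G) m = Ideal.span {F.mono (Γ m)}

theorem Derivation.sum_apply' {R : Type*} [CommRing R] {κ : Type*} (T : Finset κ)
    (D : κ → Derivation ℤ R R) (f : R) : (∑ i ∈ T, D i) f = ∑ i ∈ T, D i f := by
  classical
  induction T using Finset.induction_on with
  | empty => simp
  | insert a T ha ih => simp [Finset.sum_insert ha, ih]

namespace MonomialData

variable (S : MonomialData s r) (T : Finset (Fin s ⊕ Fin r))

/-- The weight of `v_j` for the `i`-th torus derivation: it is chosen such that the monomials
`u^{e_l} v_j`, `l ∈ T`, have weight `0`. -/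
def weight (i : Fin s) (j : Fin r) : ℚ :=
  if .inr j ∈ T then -∑ l, (S.e (.inr j) l : ℚ) * S.B l i else 0

/-- The logarithmic derivations dual to the differential monomials with indices in `T`. -/
noncomputable def dual (F : Frame c (Fin s ⊕ Fin r)) : Fin s ⊕ Fin r → Derivation ℤ R R
  | .inl i => ∑ l, ratConst c (S.B l i) • F.theta (.inl l) +
      ∑ j, ratConst c (S.weight T i j) • F.x (.inr j) • F.d (.inr j)
  | .inr j => F.d (.inr j)

variable {S T} (F : Frame c (Fin s ⊕ Fin r))

theorem d_ratConst (a : Fin s ⊕ Fin r) (q : ℚ) : F.d a (ratConst c q) = 0 := F.d_const _ _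

theorem dual_inl_apply (i : Fin s) (f : R) : S.dual T F (.inl i) f =
    ∑ l, ratConst c (S.B l i) * F.theta (.inl l) f +
      ∑ j, ratConst c (S.weight T i j) * F.x (.inr j) * F.theta (.inr j) f := by
  simp [dual, Derivation.sum_apply', mul_assoc]

theorem dual_inr_apply (j : Fin r) (f : R) : S.dual T F (.inr j) f = F.theta (.inr j) f := rfl

/-- The eigenvalue of `u_l` for the dual derivation with index `a`. -/
noncomputable def eigen (S : MonomialData s r) (c : k →+* R) (a : Fin s ⊕ Fin r) (l : Fin s) : R :=
  Sum.elim (fun i => ratConst c (S.B l i)) (fun _ => 0) a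

theorem dual_u (a : Fin s ⊕ Fin r) (l : Fin s) :
    S.dual T F a (F.x (.inl l)) = S.eigen c a l * F.x (.inl l) := by
  cases a with
  | inl i =>
    rw [dual_inl_apply]
    simp [F.d_x, eigen]
  | inr j => simp [dual, F.d_x, eigen]

theorem dual_mono_inl (i : Fin s) (α : Fin s → ℕ) : S.dual T F (.inl i) (F.mono α) =
    ratConst c (∑ l, (α l : ℚ) * S.B l i) * F.mono α := by
  rw [F.derivation_mono _ _ (dual_u F _)]
  simp [eigen]

theorem dual_mono_inr (j : Fin r) (α : Fin s → ℕ) : S.dual T F (.inr j) (F.mono α) = 0 := by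
  rw [F.derivation_mono _ _ (dual_u F _)]
  simp [eigen]

theorem mono_dvd_dual (a : Fin s ⊕ Fin r) (α : Fin s → ℕ) (g : R) :
    F.mono α ∣ S.dual T F a (F.mono α * g) := by
  rw [Derivation.leibniz, smul_eq_mul, smul_eq_mul]
  refine dvd_add (dvd_mul_right _ _) ?_
  cases a with
  | inl i => rw [dual_mono_inl]; exact Dvd.dvd.mul_left (dvd_mul_left _ _) _
  | inr j => rw [dual_mono_inr]; simp

theorem dual_v_inl (i : Fin s) (j : Fin r) : S.dual T F (.inl i) (F.x (.inr j)) =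
    ratConst c (S.weight T i j) * F.x (.inr j) := by
  rw [dual_inl_apply]
  simp [F.d_x]

theorem dual_v_inr (j j' : Fin r) : S.dual T F (.inr j) (F.x (.inr j')) =
    if j = j' then 1 else 0 := by
  simp [dual, F.d_x]

/-- The coefficients of the dual derivations in terms of the logarithmic derivations. -/
noncomputable def dualCoeff (S : MonomialData s r) (T : Finset (Fin s ⊕ Fin r))
    (F : Frame c (Fin s ⊕ Fin r)) : Fin s ⊕ Fin r → Fin s ⊕ Fin r → R
  | .inl i => Sum.elim (fun l => ratConst c (S.B l i))
      fun j => ratConst c (S.weight T i j) * F.x (.inr j)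
  | .inr j => Pi.single (.inr j) 1

theorem dual_eq (a : Fin s ⊕ Fin r) (f : R) : S.dual T F a f = S.dualCoeff T F a ⬝ᵥ F.vec f := by
  cases a with
  | inl i => rw [dual_inl_apply]; simp [dualCoeff, dotProduct, Frame.vec]
  | inr j => simp [dualCoeff, Frame.vec, dual]

theorem d_dual (a : Fin s ⊕ Fin r) (i : Fin s) {f : R} (hf : F.d (.inl i) f = 0) :
    F.d (.inl i) (S.dual T F a f) = 0 := by
  cases a with
  | inl l =>
    rw [dual_inl_apply]
    simp [d_ratConst, F.d_x, F.d_comm (.inl i), hf]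
  | inr j => rw [dual_inr_apply, Frame.theta_inr, F.d_comm, hf, map_zero]

theorem d_eigen (a : Fin s ⊕ Fin r) (i : Fin s ⊕ Fin r) (l : Fin s) :
    F.d i (S.eigen c a l) = 0 := by
  cases a <;> simp [eigen, d_ratConst]

/-- The coefficients of the logarithmic derivations in terms of the dual derivations. -/
theorem exists_eq_dual (h : S.A * S.B = 1) : ∃ Q : Fin s ⊕ Fin r → Fin s ⊕ Fin r → R,
    ∀ f b, F.vec f b = Q b ⬝ᵥ fun a => S.dual T F a f := by
  have h' : S.B * S.A = 1 := mul_eq_one_comm.1 h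
  have h2 : ∀ l' l, ∑ i, ratConst c (S.A i l) * ratConst c (S.B l' i) = if l' = l then 1 else 0 := by
    intro l' l
    have := congrArg (ratConst c) (congrFun (congrFun h' l') l)
    rw [Matrix.mul_apply, map_sum, Matrix.one_apply] at this
    rw [← map_one (ratConst c), ← map_zero (ratConst c), ← apply_ite (ratConst c), ← this]
    exact Finset.sum_congr rfl fun i _ => by rw [map_mul, mul_comm]
  refine ⟨Sum.rec (fun l => Sum.elim (fun i => ratConst c (S.A i l))
    fun j => -∑ i, ratConst c (S.A i l) * (ratConst c (S.weight T i j) * F.x (.inr j)))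
    fun j => Pi.single (.inr j) 1, fun f b => ?_⟩
  cases b with
  | inr j => simp [Frame.vec, dual]
  | inl l =>
    simp only [dotProduct, Fintype.sum_sum_type, Sum.elim_inl, Sum.elim_inr, dual_inl_apply,
      dual_inr_apply, mul_add, Finset.sum_add_distrib, Finset.mul_sum, neg_mul, Finset.sum_mul,
      Finset.sum_neg_distrib]
    rw [Finset.sum_comm, Finset.sum_comm (s := Finset.univ (α := Fin r))]
    have e1 : ∑ y, ∑ x, ratConst c (S.A x l) * (ratConst c (S.B y x) * F.theta (.inl y) f) =
        F.theta (.inl l) f := by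
      have : ∀ y, ∑ x, ratConst c (S.A x l) * (ratConst c (S.B y x) * F.theta (.inl y) f) =
          (if y = l then 1 else 0) * F.theta (.inl y) f := by
        intro y
        rw [← h2, Finset.sum_mul]
        exact Finset.sum_congr rfl fun x _ => by ring
      rw [Finset.sum_congr rfl fun y _ => this y]
      simp
    rw [e1]
    simp only [Frame.vec, mul_assoc]
    ring

end MonomialData

namespace IsPartialSystem

variable {F : Frame c (Fin s ⊕ Fin r)} {G : Set R} {Γ : ℕ → Fin s → ℕ}
  {T : Finset (Fin s ⊕ Fin r)} {S : MonomialData s r}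

theorem dual_monoV (h : IsPartialSystem F G Γ T S) (a : Fin s ⊕ Fin r) {l : Fin s ⊕ Fin r}
    (hl : l ∈ T) : S.dual T F a (F.monoV S.e l) = if a = l then F.mono (S.e l) else 0 := by
  cases l with
  | inl i =>
    simp only [Frame.monoV, Sum.elim_inl, mul_one]
    cases a with
    | inl i' =>
      rw [MonomialData.dual_mono_inl]
      have : ∑ l, (S.e (.inl i) l : ℚ) * S.B l i' = if i = i' then 1 else 0 := by
        rw [← Matrix.one_apply, ← h.mul_eq, Matrix.mul_apply]
        exact Finset.sum_congr rfl fun l _ => by rw [h.A_eq i hl]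
      rw [this]
      by_cases e : i = i'
      · simp [e]
      · simp [e, Ne.symm e]
    | inr j => rw [MonomialData.dual_mono_inr]; simp
  | inr j =>
    simp only [Frame.monoV, Sum.elim_inr, Derivation.leibniz, smul_eq_mul]
    cases a with
    | inl i =>
      rw [MonomialData.dual_mono_inl, MonomialData.dual_v_inl, MonomialData.weight, if_pos hl]
      simp only [map_neg, reduceCtorEq, if_false]
      ring
    | inr j' =>
      rw [MonomialData.dual_mono_inr, MonomialData.dual_v_inr]
      simp

theorem mono_dvd_dual_of_mem (h : IsPartialSystem F G Γ T S) {f : R} (hf : f ∈ G)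
    {l : Fin s ⊕ Fin r} (hl : l ∈ T) : F.mono (S.e l) ∣ S.dual T F l f := by
  obtain ⟨q, hq⟩ := h.inv f hf
  have h1 : F.mono S.γ ∣ S.dual T F l f - ∑ b ∈ T, q b * S.dual T F l (F.monoV S.e b) := by
    choose w hw using hq
    refine ⟨S.dualCoeff T F l ⬝ᵥ w, ?_⟩
    simp only [MonomialData.dual_eq, dotProduct, Finset.mul_sum]
    rw [Finset.sum_comm, ← Finset.sum_sub_distrib]
    refine Finset.sum_congr rfl fun x _ => ?_
    have := hw x
    rw [show ∑ b ∈ T, q b * (S.dualCoeff T F l x * F.vec (F.monoV S.e b) x) =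
      S.dualCoeff T F l x * ∑ b ∈ T, q b * F.vec (F.monoV S.e b) x by
        rw [Finset.mul_sum]; exact Finset.sum_congr rfl fun b _ => by ring]
    linear_combination (S.dualCoeff T F l x) * this
  rw [Finset.sum_congr rfl fun b hb => by rw [h.dual_monoV l hb]] at h1
  have h2 : ∑ b ∈ T, q b * (if l = b then F.mono (S.e b) else 0) = q l * F.mono (S.e l) := by
    simp [hl]
  rw [h2] at h1
  exact (dvd_sub_left (dvd_mul_left _ _)).1 ((F.mono_dvd_of_le (h.le l hl)).trans h1)

theorem mono_dvd_dual_of_notMem (h : IsPartialSystem F G Γ T S) {f : R} (hf : f ∈ G)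
    {a : Fin s ⊕ Fin r} (ha : a ∉ T) : F.mono S.γ ∣ S.dual T F a f := by
  obtain ⟨q, hq⟩ := h.inv f hf
  have h1 : F.mono S.γ ∣ S.dual T F a f - ∑ b ∈ T, q b * S.dual T F a (F.monoV S.e b) := by
    choose w hw using hq
    refine ⟨S.dualCoeff T F a ⬝ᵥ w, ?_⟩
    simp only [MonomialData.dual_eq, dotProduct, Finset.mul_sum]
    rw [Finset.sum_comm, ← Finset.sum_sub_distrib]
    refine Finset.sum_congr rfl fun x _ => ?_
    have := hw x
    rw [show ∑ b ∈ T, q b * (S.dualCoeff T F a x * F.vec (F.monoV S.e b) x) =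
      S.dualCoeff T F a x * ∑ b ∈ T, q b * F.vec (F.monoV S.e b) x by
        rw [Finset.mul_sum]; exact Finset.sum_congr rfl fun b _ => by ring]
    linear_combination (S.dualCoeff T F a x) * this
  rw [Finset.sum_congr rfl fun b hb => by rw [h.dual_monoV a hb]] at h1
  have h2 : ∑ b ∈ T, q b * (if a = b then F.mono (S.e b) else 0) = 0 :=
    Finset.sum_eq_zero fun b hb => by
      rw [if_neg (fun e : a = b => ha (e ▸ hb)), mul_zero]
  rwa [h2, sub_zero] at h1

/-- A function whose derivatives along the dual derivations with index outside of `T` vanish and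
whose other derivatives have the expected divisibility has its differential in the module spanned
by the differential monomials. -/
theorem vec_eq_sum (h : IsPartialSystem F G Γ T S) {f : R} (q : Fin s ⊕ Fin r → R)
    (h1 : ∀ l ∈ T, S.dual T F l f = F.mono (S.e l) * q l) (b : Fin s ⊕ Fin r) (δ : R)
    (h2 : ∀ a ∉ T, δ ∣ S.dual T F a f) :
    δ ∣ F.vec f b - ∑ l ∈ T, q l * F.vec (F.monoV S.e l) b := by
  obtain ⟨Q, hQ⟩ := MonomialData.exists_eq_dual (T := T) F h.mul_eq
  simp only [hQ]
  have e : Q b ⬝ᵥ (fun a => S.dual T F a f) -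
      ∑ l ∈ T, q l * Q b ⬝ᵥ (fun a => S.dual T F a (F.monoV S.e l)) =
      ∑ a, Q b a * (S.dual T F a f - ∑ l ∈ T, q l * S.dual T F a (F.monoV S.e l)) := by
    simp only [dotProduct, mul_sub, Finset.sum_sub_distrib, Finset.mul_sum]
    congr 1
    rw [Finset.sum_comm]
    refine Finset.sum_congr rfl fun x _ => Finset.sum_congr rfl fun y _ => by ring
  rw [e]
  refine Finset.dvd_sum fun a _ => Dvd.dvd.mul_left ?_ _
  rw [Finset.sum_congr rfl fun l hl => by rw [h.dual_monoV a hl]]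
  by_cases ha : a ∈ T
  · have : ∑ l ∈ T, q l * (if a = l then F.mono (S.e l) else 0) = q a * F.mono (S.e a) := by
      simp [ha]
    rw [this, h1 a ha, mul_comm, sub_self]
    exact dvd_zero _
  · have : ∑ l ∈ T, q l * (if a = l then F.mono (S.e l) else 0) = 0 :=
      Finset.sum_eq_zero fun b hb => by rw [if_neg (fun e : a = b => ha (e ▸ hb)), mul_zero]
    rw [this, sub_zero]
    exact h2 a ha

end IsPartialSystem

end Stages

/-! ### Enlarging a partial system of differential monomials -/

section Steps

open scoped Matrix
open IsLocalRing

variable {k R : Type u} [Field k] [CharZero k] [CommRing R] [IsLocalRing R] {c : k →+* R}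
  {s r n : ℕ}

theorem map_mem_span {ι : Type*} {R R' : Type*} [CommRing R] [CommRing R'] (ψ : R →+* R')
    {V : Set (ι → R)} {g : ι → R} (hg : g ∈ Submodule.span R V) :
    (fun i => ψ (g i)) ∈ Submodule.span R' ((fun g i => ψ (g i)) '' V) := by
  induction hg using Submodule.span_induction with
  | mem x hx => exact Submodule.subset_span ⟨x, hx, rfl⟩
  | zero => simp only [Pi.zero_apply, map_zero]; exact Submodule.zero_mem _
  | add x y _ _ hx hy => simp only [Pi.add_apply, map_add]; exact Submodule.add_mem _ hx hy
  | smul a x _ hx =>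
    simp only [Pi.smul_apply, smul_eq_mul, map_mul]; exact Submodule.smul_mem _ (ψ a) hx

namespace IsPartialSystem

variable {F : Frame c (Fin s ⊕ Fin r)} {G : Set R} {Γ : ℕ → Fin s → ℕ}
  {T : Finset (Fin s ⊕ Fin r)} {S : MonomialData s r}

/-- The exponent `Γ (|T| + 1) - Γ |T|` of the next differential monomial: it is an upper bound of
the previous exponents, the module of differential forms is generated by the differential monomials
modulo this power of `u`, and this is the best possible. -/
theorem exists_next (h : IsPartialSystem F G Γ T S) (hR : IsSmoothLocalRing c n) (hn : s + r = n)
    (hT : T ≠ Finset.univ) : ∃ γ : Fin s → ℕ, IsPartialSystem F G Γ T { S with γ := γ } ∧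
      ∑ l ∈ T, S.e l + γ = Γ (T.card + 1) ∧
      ∃ f ∈ G, ∃ a ∉ T, ∃ w, IsUnit w ∧ S.dual T F a f = F.mono γ * w := by
  classical
  have := hR.isDomain
  have hcard : T.card + 1 ≤ s + r := by
    have := (Finset.card_lt_iff_ne_univ T).2 hT
    simpa using this
  obtain ⟨Q, hQ⟩ := MonomialData.exists_eq_dual (T := T) F h.mul_eq
  let L : (Fin s ⊕ Fin r → R) → Fin s ⊕ Fin r → R := fun g a => S.dualCoeff T F a ⬝ᵥ g
  have hL : ∀ f, L (F.vec f) = fun a => S.dual T F a f := fun f =>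
    funext fun a => (MonomialData.dual_eq F a f).symm
  have hmin : Ideal.span {F.mono (Γ (T.card + 1))} ≤
      minorsIdeal (L '' (F.vec '' G)) (T.card + 1) := by
    rw [← h.minors _ hcard]
    refine minorsIdeal_le_of_comb _ _ L Q ?_
    rintro _ ⟨f, hf, rfl⟩ i
    rw [hL]; exact hQ f i
  have hdvd : ∀ g ∈ L '' (F.vec '' G), ∀ i ∈ T, F.mono (S.e i) ∣ g i := by
    rintro _ ⟨_, ⟨f, hf, rfl⟩, rfl⟩ i hi
    rw [hL]; exact h.mono_dvd_dual_of_mem hf hi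
  have h1 : F.mono (∑ l ∈ T, S.e l + S.γ) ∣ F.mono (Γ (T.card + 1)) := by
    have := hmin.trans (minorsIdeal_le_of_dvd (L '' (F.vec '' G)) T (fun l => F.mono (S.e l))
      (F.mono S.γ) ⊤ hdvd (by
        rintro _ ⟨_, ⟨f, hf, rfl⟩, rfl⟩ i hi
        obtain ⟨x, hx⟩ := h.mono_dvd_dual_of_notMem hf hi
        exact ⟨x, trivial, (congrFun (hL f) i).trans hx⟩) fun i hi => F.mono_dvd_of_le (h.le i hi))
    rw [← Frame.mono_sum, ← Frame.mono_add, Ideal.mul_top] at this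
    exact Ideal.mem_span_singleton.1 (this (Ideal.mem_span_singleton_self _))
  have h2 := F.le_of_mono_dvd hR hn h1
  obtain ⟨γ, hγ⟩ : ∃ γ, ∑ l ∈ T, S.e l + γ = Γ (T.card + 1) :=
    ⟨Γ (T.card + 1) - ∑ l ∈ T, S.e l, add_tsub_cancel_of_le (le_self_add.trans h2)⟩
  have hle : S.γ ≤ γ := by rw [← hγ] at h2; exact le_of_add_le_add_left h2
  -- a minor with the rows of the differential monomials and of `f`
  have hd : ∀ f ∈ G, ∀ a ∉ T, F.mono γ ∣ S.dual T F a f := by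
    intro f hf a ha
    have h3 := det_mem_minorsIdeal (κ := T ⊕ Unit) (F.vec '' G) (m := T.card + 1) (by simp)
      (Sum.elim (fun l => F.vec (F.monoV S.e l)) fun _ => F.vec f)
      (by
        rintro (l | _)
        · exact h.mem l l.2
        · exact Submodule.subset_span ⟨f, hf, rfl⟩)
      (Sum.elim (fun l => S.dualCoeff T F l) fun _ => S.dualCoeff T F a)
    have e : (Matrix.of fun x y => (Sum.elim (fun l : T => S.dualCoeff T F l)
        (fun _ : Unit => S.dualCoeff T F a) y) ⬝ᵥ
        (Sum.elim (fun l : T => F.vec (F.monoV S.e l)) (fun _ : Unit => F.vec f) x)) =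
        Matrix.fromBlocks (Matrix.diagonal fun l : T => F.mono (S.e l)) 0
          (Matrix.of fun _ l => S.dual T F l f) (Matrix.of fun _ _ => S.dual T F a f) := by
      ext (x | x) (y | y)
      · simp only [Matrix.of_apply, Sum.elim_inl, ← MonomialData.dual_eq, h.dual_monoV _ x.2,
          Matrix.fromBlocks_apply₁₁, Matrix.diagonal_apply, Subtype.ext_iff, eq_comm]
      · simp only [Matrix.of_apply, Sum.elim_inl, Sum.elim_inr, ← MonomialData.dual_eq,
          h.dual_monoV _ x.2, Matrix.fromBlocks_apply₁₂, Matrix.zero_apply]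
        exact if_neg fun e : a = x => ha (e ▸ x.2)
      · simp [MonomialData.dual_eq]
      · simp [MonomialData.dual_eq]
    rw [e, Matrix.det_fromBlocks_zero₁₂, Matrix.det_diagonal, Matrix.det_unique, Matrix.of_apply,
      h.minors _ hcard, Ideal.mem_span_singleton, ← hγ, F.mono_add, F.mono_sum,
      Finset.prod_coe_sort T fun l => F.mono (S.e l)] at h3
    refine (mul_dvd_mul_iff_left ?_).1 h3
    exact Finset.prod_ne_zero_iff.2 fun l _ => F.mono_ne_zero hR _
  refine ⟨γ, ⟨h.mul_eq, h.A_eq, fun l hl => (h.le l hl).trans hle, h.chain, h.sum, h.mem,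
    fun f hf => ?_, h.minors⟩, hγ, ?_⟩
  · choose! q hq using fun l hl => h.mono_dvd_dual_of_mem hf (l := l) hl
    exact ⟨q, fun b => h.vec_eq_sum q hq b _ (hd f hf)⟩
  · by_contra! hcon
    have h4 := hmin.trans (minorsIdeal_le_of_dvd (L '' (F.vec '' G)) T (fun l => F.mono (S.e l))
      (F.mono γ) (maximalIdeal R) hdvd (by
        rintro _ ⟨_, ⟨f, hf, rfl⟩, rfl⟩ i hi
        obtain ⟨x, hx⟩ := hd f hf i hi
        refine ⟨x, ?_, (congrFun (hL f) i).trans hx⟩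
        by_contra hu
        exact hcon f hf i hi x (by simpa using hu) hx)
      fun i hi => F.mono_dvd_of_le ((h.le i hi).trans hle))
    rw [← Frame.mono_sum, ← Frame.mono_add, hγ] at h4
    have h5 := h4 (Ideal.mem_span_singleton_self _)
    rw [Ideal.mem_span_singleton_mul] at h5
    obtain ⟨z, hz, e⟩ := h5
    have : z = 1 := mul_left_cancel₀ (F.mono_ne_zero hR (Γ (T.card + 1))) (by rw [e, mul_one])
    exact (Ideal.ne_top_iff_one _).1 (maximalIdeal.isMaximal R).ne_top (this ▸ hz)

/-- The part of `f` divisible by `u^γ` has its differential in the module of differential forms. -/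
theorem mem_span_of_isTrunc (h : IsPartialSystem F G Γ T S) (hR : IsSmoothLocalRing c n)
    {f t g : R} (hf : f ∈ G) (e : f = t + F.mono S.γ * g) (ht : F.IsTrunc S.γ t) :
    F.vec (F.mono S.γ * g) ∈ Submodule.span R (F.vec '' G) ∧
      ∀ a ∉ T, S.dual T F a (F.mono S.γ * g) = S.dual T F a f := by
  have h1 : ∀ a ∉ T, S.dual T F a t = 0 := by
    intro a ha
    have h2 : F.mono S.γ ∣ S.dual T F a t := by
      have : S.dual T F a t = S.dual T F a f - S.dual T F a (F.mono S.γ * g) := by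
        rw [e, map_add]; ring
      rw [this]
      exact dvd_sub (h.mono_dvd_dual_of_notMem hf ha) (MonomialData.mono_dvd_dual F a _ _)
    have h3 := ht.derivation (D := S.dual T F a) (fun i j => MonomialData.d_eigen F a _ j)
      (MonomialData.dual_u F a) (fun i f hf => MonomialData.d_dual F a i hf) 0 (by simp)
    rw [zero_mul, add_zero] at h3
    exact h3.eq_zero hR h2
  have h2 : ∀ l ∈ T, F.mono (S.e l) ∣ S.dual T F l t := by
    intro l hl
    have : S.dual T F l t = S.dual T F l f - S.dual T F l (F.mono S.γ * g) := by
      rw [e, map_add]; ring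
    rw [this]
    exact dvd_sub (h.mono_dvd_dual_of_mem hf hl)
      ((F.mono_dvd_of_le (h.le l hl)).trans (MonomialData.mono_dvd_dual F l _ _))
  choose! q hq using h2
  have h3 : F.vec t = ∑ l ∈ T, q l • F.vec (F.monoV S.e l) := by
    ext b
    have := h.vec_eq_sum q hq b 0 (fun a ha => by rw [h1 a ha])
    simpa [Finset.sum_apply] using sub_eq_zero.1 (zero_dvd_iff.1 this)
  constructor
  · have e' : F.vec (F.mono S.γ * g) = F.vec f - F.vec t := by
      rw [e, F.vec_add]; abel
    rw [e', h3]
    exact sub_mem (Submodule.subset_span ⟨f, hf, rfl⟩)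
      (Submodule.sum_mem _ fun l hl => Submodule.smul_mem _ _ (h.mem l hl))
  · intro a ha
    rw [e, map_add, h1 a ha, zero_add]

omit [CharZero k] in
theorem mem_span_vec_of_comb {s' r' : ℕ} {F : Frame c (Fin s ⊕ Fin r)}
    {F' : Frame c (Fin s' ⊕ Fin r')} {Q : Fin s' ⊕ Fin r' → Fin s ⊕ Fin r → R}
    (hQ : ∀ a f, F'.vec f a = Q a ⬝ᵥ F.vec f) {f : R}
    (hf : F.vec f ∈ Submodule.span R (F.vec '' G)) :
    F'.vec f ∈ Submodule.span R (F'.vec '' G) := by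
  have e : ∀ f, F'.vec f = (Matrix.of Q).mulVecLin (F.vec f) := fun f => funext fun a => hQ a f
  have h2 := Submodule.mem_map_of_mem (f := (Matrix.of Q).mulVecLin) hf
  rw [Submodule.map_span, ← e, ← Set.image_comp] at h2
  rwa [← show F'.vec = (Matrix.of Q).mulVecLin ∘ F.vec from funext e] at h2

omit [CharZero k] in
theorem associated_mono {F F' : Frame c (Fin s ⊕ Fin r)}
    (hF : ∀ i, Associated (F'.x (.inl i)) (F.x (.inl i))) (α : Fin s → ℕ) :
    Associated (F'.mono α) (F.mono α) := by
  unfold Frame.mono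
  exact Associated.prod _ _ _ fun i _ => (hF i).pow_pow

omit [CharZero k] in
/-- Invariance under changes of coordinates which preserve the differential monomials. -/
theorem change_frame (h : IsPartialSystem F G Γ T S) {F' : Frame c (Fin s ⊕ Fin r)}
    (hF : ∀ i, Associated (F'.x (.inl i)) (F.x (.inl i)))
    (hT : ∀ l ∈ T, F'.monoV S.e l = F.monoV S.e l) : IsPartialSystem F' G Γ T S := by
  obtain ⟨Q, hQ⟩ := F.exists_comb_theta F' fun i => ⟨i, hF i⟩
  obtain ⟨Q', hQ'⟩ := F'.exists_comb_theta F fun i => ⟨i, (hF i).symm⟩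
  refine ⟨h.mul_eq, h.A_eq, h.le, h.chain, h.sum, fun l hl => ?_, fun f hf => ?_, fun m hm => ?_⟩
  · rw [hT l hl]; exact mem_span_vec_of_comb hQ (h.mem l hl)
  · obtain ⟨q, hq⟩ := h.inv f hf
    refine ⟨q, fun a => ?_⟩
    rw [Finset.sum_congr rfl fun l hl => by rw [hT l hl]]
    refine (associated_mono hF _).dvd.trans ?_
    choose w hw using hq
    refine ⟨Q a ⬝ᵥ w, ?_⟩
    simp only [hQ, dotProduct, Finset.mul_sum]
    rw [Finset.sum_comm, ← Finset.sum_sub_distrib]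
    refine Finset.sum_congr rfl fun x _ => ?_
    rw [show ∑ b ∈ T, q b * (Q a x * F.vec (F.monoV S.e b) x) =
      Q a x * ∑ b ∈ T, q b * F.vec (F.monoV S.e b) x by
        rw [Finset.mul_sum]; exact Finset.sum_congr rfl fun b _ => by ring]
    linear_combination (Q a x) * hw x
  · have e : ∀ (F₁ F₂ : Frame c (Fin s ⊕ Fin r)) (Q : Fin s ⊕ Fin r → Fin s ⊕ Fin r → R)
        (Q' : Fin s ⊕ Fin r → Fin s ⊕ Fin r → R) (_ : ∀ a f, F₂.vec f a = Q a ⬝ᵥ F₁.vec f)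
        (_ : ∀ a f, F₁.vec f a = Q' a ⬝ᵥ F₂.vec f),
        minorsIdeal (F₁.vec '' G) m ≤ minorsIdeal (F₂.vec '' G) m := by
      intro F₁ F₂ Q Q' hQ hQ'
      have h1 := minorsIdeal_le_of_comb (F₁.vec '' G) m (fun g a => Q a ⬝ᵥ g) Q' (by
        rintro _ ⟨f, hf, rfl⟩ i
        rw [hQ']
        congr 1
        exact funext fun a => hQ a f)
      rwa [← Set.image_comp, show ((fun g a => Q a ⬝ᵥ g) ∘ F₁.vec) = F₂.vec from
        funext fun f => funext fun a => (hQ a f).symm] at h1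
    rw [le_antisymm (e F' F Q' Q hQ' hQ) (e F F' Q Q' hQ hQ'), h.minors m hm]
    exact le_antisymm (Ideal.span_singleton_le_span_singleton.2 (associated_mono hF _).dvd)
      (Ideal.span_singleton_le_span_singleton.2 (associated_mono hF _).dvd')

omit [CharZero k] in
/-- Adjoining a differential monomial. -/
theorem adjoin (h : IsPartialSystem F G Γ T S) {b : Fin s ⊕ Fin r} (hb : b ∉ T)
    {A B : Matrix (Fin s) (Fin s) ℚ} (hAB : A * B = 1)
    (hA : ∀ i, .inl i ≠ b → ∀ l, A i l = S.A i l) (hA' : ∀ i, .inl i = b → ∀ l, A i l = S.γ l)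
    (hsum : ∑ l ∈ T, S.e l + S.γ = Γ (T.card + 1))
    (hmem : F.vec (F.monoV (fun _ => S.γ) b) ∈ Submodule.span R (F.vec '' G)) :
    IsPartialSystem F G Γ (insert b T) ⟨Function.update S.e b S.γ, A, B, S.γ⟩ := by
  have ne : ∀ l ∈ T, l ≠ b := fun l hl e => hb (e ▸ hl)
  have he : ∀ l ∈ T, Function.update S.e b S.γ l = S.e l := fun l hl =>
    Function.update_of_ne (ne l hl) _ _
  have hm : ∀ l ∈ T, F.monoV (Function.update S.e b S.γ) l = F.monoV S.e l := fun l hl => by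
    simp only [Frame.monoV, he l hl]
  have hmb : F.monoV (Function.update S.e b S.γ) b = F.monoV (fun _ => S.γ) b := by
    simp [Frame.monoV]
  have hle : ∀ l ∈ insert b T, Function.update S.e b S.γ l ≤ S.γ := by
    intro l hl
    rcases Finset.mem_insert.1 hl with rfl | hl
    · simp
    · rw [he l hl]; exact h.le l hl
  refine ⟨hAB, fun i hi l => ?_, hle, fun l hl l' hl' => ?_, ?_, fun l hl => ?_, fun f hf => ?_,
    h.minors⟩
  · change A i l = (Function.update S.e b S.γ (.inl i) l : ℚ)
    rcases Finset.mem_insert.1 hi with e | hi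
    · rw [hA' i e, e]; simp
    · rw [hA i (ne _ hi), h.A_eq i hi]; simp [he _ hi]
  · rcases Finset.mem_insert.1 hl with rfl | hl1
    · right; simpa using hle l' hl'
    · rcases Finset.mem_insert.1 hl' with rfl | hl1'
      · left; simpa using hle l hl
      · simp only [he l hl1, he l' hl1']; exact h.chain l hl1 l' hl1'
  · rw [Finset.sum_insert hb, Finset.card_insert_of_notMem hb, ← hsum, add_comm]
    simp only [Function.update_self]
    rw [Finset.sum_congr rfl he]
  · rcases Finset.mem_insert.1 hl with rfl | hl
    · rw [hmb]; exact hmem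
    · rw [hm l hl]; exact h.mem l hl
  · obtain ⟨q, hq⟩ := h.inv f hf
    refine ⟨Function.update q b 0, fun a => ?_⟩
    rw [Finset.sum_insert hb]
    simp only [Function.update_self, zero_mul, zero_add]
    rw [Finset.sum_congr rfl fun l hl => by rw [hm l hl, Function.update_of_ne (ne l hl)]]
    exact hq a

omit [CharZero k] in
theorem map {R' : Type u} [CommRing R'] [IsLocalRing R'] {c' : k →+* R'} {ψ : R →+* R'}
    {F' : Frame c' (Fin s ⊕ Fin r)} (hF : F.IsMap ψ F') (h : IsPartialSystem F G Γ T S) :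
    IsPartialSystem F' (ψ '' G) Γ T S := by
  have hv : ∀ l, F'.monoV S.e l = ψ (F.monoV S.e l) := by
    intro l
    cases l <;> simp [Frame.monoV, hF.map_mono, hF.map_x]
  have hi : F'.vec '' (ψ '' G) = (fun g i => ψ (g i)) '' (F.vec '' G) := by
    rw [← Set.image_comp, ← Set.image_comp]
    exact Set.image_congr fun f _ => hF.map_vec f
  refine ⟨h.mul_eq, h.A_eq, h.le, h.chain, h.sum, fun l hl => ?_, ?_, fun m hm => ?_⟩
  · rw [hv, hF.map_vec, hi]
    exact map_mem_span ψ (h.mem l hl)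
  · rintro _ ⟨f, hf, rfl⟩
    obtain ⟨q, hq⟩ := h.inv f hf
    refine ⟨fun l => ψ (q l), fun a => ?_⟩
    have := map_dvd ψ (hq a)
    simpa [hv, hF.map_vec, hF.map_mono] using this
  · rw [hi, minorsIdeal_map, h.minors m hm, Ideal.map_span, hF.map_mono]
    simp

end IsPartialSystem

end Steps

/-! ### Construction of the differential monomials -/

section Forward

open scoped Matrix
open IsLocalRing

/-- A local ring over `R₀`. -/
structure LocalExt (R₀ : Type u) [CommRing R₀] where
  /-- The underlying type of the local ring. -/
  carrier : Type u
  [commRing : CommRing carrier]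
  [isLocalRing : IsLocalRing carrier]
  /-- The structure homomorphism. -/
  φ : R₀ →+* carrier

attribute [instance] LocalExt.commRing LocalExt.isLocalRing

variable {k R₀ : Type u} [Field k] [CharZero k] [CommRing R₀]

/-- A homomorphism of local rings over `R₀` along which coordinates and partial derivatives
extend. -/
structure LocalExt.Extends (c₀ : k →+* R₀) (n : ℕ) (A B : LocalExt R₀)
    (ψ : A.carrier →+* B.carrier) : Prop where
  comp_eq : ψ.comp A.φ = B.φ
  exists_frame : ∀ (ι : Type) [Fintype ι] [DecidableEq ι] (F : Frame (A.φ.comp c₀) ι),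
    Fintype.card ι = n → ∃ F' : Frame (B.φ.comp c₀) ι, F.IsMap ψ F'

/-- A class of smooth local rings over `R₀` with enough étale extensions: it allows to subtract from
a function its value, to extract roots of functions with value `1`, and to split a function as a sum
of a multiple of a given coordinate and a function which does not depend on this coordinate. -/
structure IsEtaleClass (c₀ : k →+* R₀) (n : ℕ) (𝒜 : LocalExt R₀ → Prop) : Prop where
  smooth : ∀ A, 𝒜 A → IsSmoothLocalRing (A.φ.comp c₀) n
  exists_const : ∀ A, 𝒜 A → ∀ f : A.carrier, ∃ B, 𝒜 B ∧ ∃ ψ, A.Extends c₀ n B ψ ∧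
    ∃ e, ψ f - e ∈ maximalIdeal B.carrier ∧
      ∀ D : Derivation ℤ B.carrier B.carrier, (∀ t, D (B.φ (c₀ t)) = 0) → D e = 0
  exists_root : ∀ A, 𝒜 A → ∀ f : A.carrier, f - 1 ∈ maximalIdeal A.carrier → ∀ d : ℕ, d ≠ 0 →
    ∃ B, 𝒜 B ∧ ∃ ψ, A.Extends c₀ n B ψ ∧ ∃ w, w ^ d = ψ f
  exists_retract : ∀ A, 𝒜 A → ∀ (ι : Type) [Fintype ι] [DecidableEq ι]
    (F : Frame (A.φ.comp c₀) ι), Fintype.card ι = n → ∀ (i : ι) (f : A.carrier),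
    ∃ B, 𝒜 B ∧ ∃ ψ, A.Extends c₀ n B ψ ∧ ∃ f₀, ∀ F' : Frame (B.φ.comp c₀) ι, F.IsMap ψ F' →
      F'.d i f₀ = 0 ∧ F'.x i ∣ ψ f - f₀

omit [CharZero k] in
theorem Frame.IsMap.comp {R R' R'' : Type u} [CommRing R] [IsLocalRing R] [CommRing R']
    [IsLocalRing R'] [CommRing R''] [IsLocalRing R''] {c : k →+* R} {c' : k →+* R'}
    {c'' : k →+* R''} {ι : Type} [Fintype ι] [DecidableEq ι] {ψ : R →+* R'} {ψ' : R' →+* R''}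
    {F : Frame c ι} {F' : Frame c' ι} {F'' : Frame c'' ι} (h : F.IsMap ψ F')
    (h' : F'.IsMap ψ' F'') : F.IsMap (ψ'.comp ψ) F'' :=
  ⟨fun i => by rw [h'.map_x, h.map_x]; rfl, fun i f => by
    rw [RingHom.comp_apply, h'.map_d, h.map_d]; rfl⟩

namespace LocalExt.Extends

variable {c₀ : k →+* R₀} {n : ℕ}

omit [CharZero k] in
theorem refl (A : LocalExt R₀) : A.Extends c₀ n A (RingHom.id _) :=
  ⟨rfl, fun _ _ _ F _ => ⟨F, fun _ => rfl, fun _ _ => rfl⟩⟩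

omit [CharZero k] in
theorem trans {A B C : LocalExt R₀} {ψ : A.carrier →+* B.carrier} {ψ' : B.carrier →+* C.carrier}
    (h : A.Extends c₀ n B ψ) (h' : B.Extends c₀ n C ψ') : A.Extends c₀ n C (ψ'.comp ψ) :=
  ⟨by rw [RingHom.comp_assoc, h.comp_eq, h'.comp_eq], fun ι _ _ F hc => by
    obtain ⟨F', hF'⟩ := h.exists_frame ι F hc
    obtain ⟨F'', hF''⟩ := h'.exists_frame ι F' hc
    exact ⟨F'', hF'.comp hF''⟩⟩

omit [CharZero k] in
theorem image_eq {A B : LocalExt R₀} {ψ : A.carrier →+* B.carrier} (h : A.Extends c₀ n B ψ)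
    (G : Set R₀) : ψ '' (A.φ '' G) = B.φ '' G := by
  rw [← Set.image_comp, ← h.comp_eq]; rfl

end LocalExt.Extends

theorem Frame.map_sub_mem {R : Type u} [CommRing R] [IsLocalRing R] {c : k →+* R} {s r : ℕ}
    (F : Frame c (Fin s ⊕ Fin r)) (S : MonomialData s r) (T : Finset (Fin s ⊕ Fin r)) (i : Fin s)
    (f : R) : S.dual T F (.inl i) f ∈ maximalIdeal R := by
  rw [MonomialData.dual_inl_apply]
  refine add_mem (sum_mem fun l _ => ?_) (sum_mem fun j _ => ?_)
  · exact Ideal.mul_mem_left _ _ (Ideal.mul_mem_right _ _ (F.x_mem _))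
  · exact Ideal.mul_mem_right _ _ (Ideal.mul_mem_left _ _ (F.x_mem _))

theorem MonomialData.map_dual {R R' : Type u} [CommRing R] [IsLocalRing R] [CommRing R']
    [IsLocalRing R'] {c : k →+* R} {c' : k →+* R'} {s r : ℕ} {ψ : R →+* R'}
    {F : Frame c (Fin s ⊕ Fin r)} {F' : Frame c' (Fin s ⊕ Fin r)} (hF : F.IsMap ψ F')
    (hψ : ψ.comp c = c') (S : MonomialData s r) (T : Finset (Fin s ⊕ Fin r)) (a : Fin s ⊕ Fin r)
    (f : R) : S.dual T F' a (ψ f) = ψ (S.dual T F a f) := by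
  have hq : ∀ q, ψ (ratConst c q) = ratConst c' q := fun q => by rw [← hψ]; rfl
  cases a with
  | inl i => simp [MonomialData.dual_inl_apply, hF.map_d, hF.map_x, hq]
  | inr j => exact hF.map_theta (.inr j) f

namespace IsPartialSystem

variable {R : Type u} [CommRing R] [IsLocalRing R] {c : k →+* R} {s r n : ℕ}
  {F : Frame c (Fin s ⊕ Fin r)} {G : Set R} {Γ : ℕ → Fin s → ℕ}
  {T : Finset (Fin s ⊕ Fin r)} {S : MonomialData s r}

omit [CharZero k] in
/-- Adjoining a differential monomial `d(u^γ v_j)`. -/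
theorem exists_insert_inr (h : IsPartialSystem F G Γ T S) (hR : IsSmoothLocalRing c n)
    (hn : s + r = n) (hsum : ∑ l ∈ T, S.e l + S.γ = Γ (T.card + 1)) {j : Fin r} (hj : .inr j ∉ T)
    {g : R} (hg : g ∈ maximalIdeal R) (hd : IsUnit (F.d (.inr j) g))
    (hmem : F.vec (F.mono S.γ * g) ∈ Submodule.span R (F.vec '' G)) :
    ∃ F' : Frame c (Fin s ⊕ Fin r), (∀ i, Associated (F'.x (.inl i)) (F.x (.inl i))) ∧
      ∃ S', IsPartialSystem F' G Γ (insert (.inr j) T) S' := by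
  classical
  let x' := Function.update F.x (.inr j) g
  have hx' : ∀ l, l ≠ .inr j → x' l = F.x l := fun l hl => Function.update_of_ne hl _ _
  have hxj : x' (.inr j) = g := Function.update_self _ _ _
  have hspan : maximalIdeal R = Ideal.span (Set.range x') := by
    apply le_antisymm
    · obtain ⟨q, hq⟩ := (Submodule.mem_span_range_iff_exists_fun R).1 (F.span_eq ▸ hg :
        g ∈ Ideal.span (Set.range F.x))
      rw [F.span_eq, Ideal.span_le]
      have hu : IsUnit (q (.inr j)) := by
        by_contra hcon
        have h1 := congrArg (F.d (.inr j)) hq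
        have h2 : F.d (.inr j) (∑ i, q i • F.x i) ∈ maximalIdeal R := by
          rw [map_sum]
          refine sum_mem fun i _ => ?_
          rw [smul_eq_mul, Derivation.leibniz, smul_eq_mul, smul_eq_mul]
          refine add_mem ?_ (Ideal.mul_mem_right _ _ (F.x_mem _))
          by_cases hi : i = .inr j
          · subst hi; exact Ideal.mul_mem_right _ _ (by simpa using hcon)
          · rw [F.d_of_ne (Ne.symm hi), mul_zero]; exact zero_mem _
        rw [h1] at h2
        exact ((mem_maximalIdeal _).1 h2) hd
      have hxi : ∀ l, l ≠ .inr j → F.x l ∈ Ideal.span (Set.range x') := fun l hl =>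
        Ideal.subset_span ⟨l, hx' l hl⟩
      rintro _ ⟨l, rfl⟩
      by_cases hl : l = .inr j
      · subst hl
        have h3 : q (.inr j) * F.x (.inr j) ∈ Ideal.span (Set.range x') := by
          have : q (.inr j) * F.x (.inr j) =
              g - ∑ i ∈ Finset.univ.erase (.inr j), q i • F.x i := by
            rw [← hq, ← Finset.add_sum_erase _ _ (Finset.mem_univ (.inr j))]; simp
          rw [this]
          refine sub_mem (Ideal.subset_span ⟨.inr j, hxj⟩) (sum_mem fun i hi => ?_)
          exact Ideal.mul_mem_left _ _ (hxi i (Finset.ne_of_mem_erase hi))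
        exact (Ideal.unit_mul_mem_iff_mem _ hu).1 h3
      · exact hxi l hl
    · rw [Ideal.span_le]
      rintro _ ⟨l, rfl⟩
      by_cases hl : l = .inr j
      · subst hl; rwa [hxj]
      · rw [hx' l hl]; exact F.x_mem l
  obtain ⟨F', hF'⟩ := hR.exists_frame _ x' (by simpa using hn) hspan
  have hu : ∀ i, F'.x (.inl i) = F.x (.inl i) := fun i => by rw [hF', hx' _ (by simp)]
  have hm : ∀ α, F'.mono α = F.mono α := fun α => by simp [Frame.mono, hu]
  have hass : ∀ i, Associated (F'.x (.inl i)) (F.x (.inl i)) := fun i => by rw [hu i]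
  have h' := h.change_frame (F' := F') hass (by
    intro l hl
    cases l with
    | inl i => simp [Frame.monoV, hm]
    | inr j' =>
      have : Sum.inr j' ≠ (Sum.inr j : Fin s ⊕ Fin r) := fun e => hj (e ▸ hl)
      simp only [Frame.monoV, hm, Sum.elim_inr, hF', hx' _ this])
  obtain ⟨Q, hQ⟩ := F.exists_comb_theta F' fun i => ⟨i, hass i⟩
  refine ⟨F', hass, _, h'.adjoin hj (A := S.A) (B := S.B) h.mul_eq (by simp) (by simp) hsum ?_⟩
  have : F'.monoV (fun _ => S.γ) (.inr j) = F.mono S.γ * g := by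
    simp [Frame.monoV, hm, hF', hxj]
  rw [this]
  exact mem_span_vec_of_comb hQ hmem

omit [CharZero k] in
/-- Adjoining a differential monomial `d(u^γ)`: if `u^γ w^d`, for a unit `w`, has its
differential in the module, then `w` can be absorbed in the coordinates. -/
theorem exists_insert_inl (h : IsPartialSystem F G Γ T S) (hR : IsSmoothLocalRing c n)
    (hn : s + r = n) (hsum : ∑ l ∈ T, S.e l + S.γ = Γ (T.card + 1)) {i : Fin s} (hi : .inl i ∉ T)
    (hμ : ∑ l, (S.γ l : ℚ) * S.B l i ≠ 0) {d : ℕ} {N : Fin s → ℤ}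
    (hN : ∀ l, (N l : ℚ) = d * (S.B l i / ∑ l, (S.γ l : ℚ) * S.B l i)) (w : Rˣ)
    (hmem : F.vec (F.mono S.γ * (w ^ d : Rˣ)) ∈ Submodule.span R (F.vec '' G)) :
    ∃ F' : Frame c (Fin s ⊕ Fin r), (∀ i, Associated (F'.x (.inl i)) (F.x (.inl i))) ∧
      ∃ S', IsPartialSystem F' G Γ (insert (.inl i) T) S' := by
  classical
  set μ := ∑ l, (S.γ l : ℚ) * S.B l i with hμdef
  let p : Fin s ⊕ Fin r → ℤ := Sum.elim N fun j =>
    if .inr j ∈ T then -∑ l, (S.e (.inr j) l : ℤ) * N l else 0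
  let x' : Fin s ⊕ Fin r → R := fun l => F.x l * (w ^ p l : Rˣ)
  have hspan : maximalIdeal R = Ideal.span (Set.range x') := by
    rw [F.span_eq]
    apply le_antisymm <;> rw [Ideal.span_le] <;> rintro _ ⟨l, rfl⟩
    · exact ((Ideal.mul_unit_mem_iff_mem _ (w ^ p l).isUnit).1 (Ideal.subset_span ⟨l, rfl⟩))
    · exact Ideal.mul_mem_right _ _ (Ideal.subset_span ⟨l, rfl⟩)
  obtain ⟨F', hF'⟩ := hR.exists_frame _ x' (by simpa using hn) hspan
  have hass : ∀ i, Associated (F'.x (.inl i)) (F.x (.inl i)) := fun i =>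
    Associated.symm ⟨w ^ p (.inl i), by rw [hF']⟩
  have hm : ∀ α, F'.mono α = F.mono α * (w ^ (∑ l, (α l : ℤ) * N l) : Rˣ) := by
    intro α
    have e : ∀ U : Finset (Fin s), ∏ l ∈ U, F'.x (.inl l) ^ α l =
        (∏ l ∈ U, F.x (.inl l) ^ α l) * (w ^ (∑ l ∈ U, (α l : ℤ) * N l) : Rˣ) := by
      intro U
      induction U using Finset.induction_on with
      | empty => simp
      | insert a U ha ih =>
        have e1 : F'.x (.inl a) ^ α a = F.x (.inl a) ^ α a * (w ^ ((α a : ℤ) * N a) : Rˣ) := by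
          rw [hF', mul_pow, ← Units.val_pow_eq_pow_val, ← zpow_natCast, ← zpow_mul,
            mul_comm (p _)]
          rfl
        rw [Finset.prod_insert ha, Finset.prod_insert ha, Finset.sum_insert ha, ih, zpow_add,
          Units.val_mul, e1]
        ring
    exact e _
  have hsumN : ∀ α : Fin s → ℕ, ((∑ l, (α l : ℤ) * N l : ℤ) : ℚ) =
      d / μ * ∑ l, (α l : ℚ) * S.B l i := by
    intro α
    push_cast
    rw [Finset.mul_sum]
    refine Finset.sum_congr rfl fun l _ => ?_
    rw [hN]; ring
  have h' := h.change_frame (F' := F') hass (by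
    intro l hl
    cases l with
    | inl i' =>
      have : ∑ l, (S.e (.inl i') l : ℤ) * N l = 0 := by
        have h1 := hsumN (S.e (.inl i'))
        have h2 : ∑ l, (S.e (.inl i') l : ℚ) * S.B l i = 0 := by
          have := congrFun (congrFun h.mul_eq i') i
          rw [Matrix.mul_apply, Matrix.one_apply_ne (fun e : i' = i => hi (e ▸ hl))] at this
          rw [← this]
          exact Finset.sum_congr rfl fun l _ => by rw [h.A_eq i' hl]
        rw [h2, mul_zero] at h1
        exact_mod_cast h1
      simp only [Frame.monoV, hm, this, zpow_zero, Units.val_one, mul_one, Sum.elim_inl]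
    | inr j =>
      have : x' (.inr j) = F.x (.inr j) * (w ^ (-∑ l, (S.e (.inr j) l : ℤ) * N l) : Rˣ) := by
        simp [x', p, hl]
      simp only [Frame.monoV, hm, Sum.elim_inr, hF', this]
      rw [zpow_neg]
      have := Units.mul_inv (w ^ (∑ l, (S.e (.inr j) l : ℤ) * N l))
      linear_combination (F.mono (S.e (.inr j)) * F.x (.inr j)) * this)
  obtain ⟨Q, hQ⟩ := F.exists_comb_theta F' fun i => ⟨i, hass i⟩
  let A' := S.A.updateRow i fun l => (S.γ l : ℚ)
  have hdet : A'.det ≠ 0 := by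
    intro h0
    have e : A' * S.B = (1 : Matrix (Fin s) (Fin s) ℚ).updateRow i
        fun i' => ∑ l, (S.γ l : ℚ) * S.B l i' := by
      ext a b
      rw [Matrix.mul_apply]
      by_cases hab : a = i
      · subst hab; simp [A']
      · rw [Matrix.updateRow_ne hab, ← h.mul_eq, Matrix.mul_apply]
        simp [A', Matrix.updateRow_ne hab]
    have e2 := congrArg Matrix.det e
    rw [Matrix.det_mul, h0, zero_mul, ← Matrix.cramer_transpose_apply, Matrix.transpose_one,
      Matrix.cramer_one] at e2
    exact hμ e2.symm
  refine ⟨F', hass, _, h'.adjoin hi (A := A') (B := A'⁻¹)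
    (Matrix.mul_nonsing_inv _ (isUnit_iff_ne_zero.2 hdet)) ?_ ?_ hsum ?_⟩
  · intro i' hi' l
    simp only [A']
    rw [Matrix.updateRow_ne (fun e => hi' (by rw [e]))]
  · intro i' hi' l
    obtain rfl : i' = i := by simpa using hi'
    simp [A']
  · have : F'.monoV (fun _ => S.γ) (.inl i) = F.mono S.γ * (w ^ d : Rˣ) := by
      have h1 := hsumN S.γ
      rw [← hμdef, div_mul_cancel₀ _ hμ] at h1
      have h2 : ∑ l, (S.γ l : ℤ) * N l = d := by exact_mod_cast h1
      simp only [Frame.monoV, hm, h2, zpow_natCast, Sum.elim_inl, mul_one]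
    rw [this]
    exact mem_span_vec_of_comb hQ hmem

/-- If `γ` is a combination of the exponents of the `u^{e_l}`, then `d(u^γ)` is in the span of the
differential monomials. -/
theorem vec_mono_mem (h : IsPartialSystem F G Γ T S)
    (hγ : ∀ i, .inl i ∉ T → ∑ l, (S.γ l : ℚ) * S.B l i = 0) :
    F.vec (F.mono S.γ) ∈ Submodule.span R (F.vec '' G) := by
  have h2 : ∀ l ∈ T, F.mono (S.e l) ∣ S.dual T F l (F.mono S.γ) := by
    intro l hl
    have := MonomialData.mono_dvd_dual (S := S) (T := T) F l S.γ 1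
    rw [mul_one] at this
    exact (F.mono_dvd_of_le (h.le l hl)).trans this
  choose! q hq using h2
  have h3 : F.vec (F.mono S.γ) = ∑ l ∈ T, q l • F.vec (F.monoV S.e l) := by
    ext b
    have := h.vec_eq_sum q hq b 0 (fun a ha => by
      cases a with
      | inl i => rw [MonomialData.dual_mono_inl, hγ i ha]; simp
      | inr j => rw [MonomialData.dual_mono_inr])
    simpa [Finset.sum_apply] using sub_eq_zero.1 (zero_dvd_iff.1 this)
  rw [h3]
  exact Submodule.sum_mem _ fun l hl => Submodule.smul_mem _ _ (h.mem l hl)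

end IsPartialSystem

namespace IsEtaleClass

variable {c₀ : k →+* R₀} {n : ℕ} {𝒜 : LocalExt R₀ → Prop} {s r : ℕ}

omit [CharZero k] in
/-- After an étale extension, every function is the sum of a truncated function and a multiple
of `u^γ`. -/
theorem exists_trunc (h𝒜 : IsEtaleClass c₀ n 𝒜) (hn : s + r = n) (γ : Fin s → ℕ) :
    ∀ A, 𝒜 A → ∀ (F : Frame (A.φ.comp c₀) (Fin s ⊕ Fin r)) (f : A.carrier), ∃ B, 𝒜 B ∧
      ∃ ψ, A.Extends c₀ n B ψ ∧ ∃ F' : Frame (B.φ.comp c₀) (Fin s ⊕ Fin r), F.IsMap ψ F' ∧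
        ∃ t g, ψ f = t + F'.mono γ * g ∧ F'.IsTrunc γ t := by
  obtain ⟨N, hN⟩ : ∃ N, N = ∑ i, γ i := ⟨_, rfl⟩
  induction N generalizing γ with
  | zero =>
    obtain rfl : γ = 0 := by
      ext i
      exact (Finset.sum_eq_zero_iff.1 hN.symm) i (Finset.mem_univ i)
    intro A hA F f
    exact ⟨A, hA, _, .refl A, F, ⟨fun _ => rfl, fun _ _ => rfl⟩, 0, f, by simp [Frame.mono_zero],
      .zero⟩
  | succ N ih =>
    obtain ⟨i, hi⟩ : ∃ i, γ i ≠ 0 := by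
      by_contra! hcon
      simp [hcon] at hN
    obtain ⟨γ', rfl⟩ : ∃ γ', γ = γ' + Pi.single i 1 := ⟨γ - Pi.single i 1, by
      refine (tsub_add_cancel_of_le ?_).symm
      intro j
      by_cases e : j = i
      · subst e; simpa using Nat.one_le_iff_ne_zero.2 hi
      · simp [e]⟩
    have hN' : N = ∑ i, γ' i := by
      simp only [Pi.add_apply, Finset.sum_add_distrib, Finset.sum_pi_single', Finset.mem_univ,
        if_true] at hN
      omega
    intro A hA F f
    obtain ⟨B, hB, ψ, hψ, f₀, hf₀⟩ := h𝒜.exists_retract A hA _ F (by simpa using hn) (.inl i) f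
    obtain ⟨F', hF'⟩ := hψ.exists_frame _ F (by simpa using hn)
    obtain ⟨h1, g, hg⟩ := hf₀ F' hF'
    obtain ⟨C, hC, ψ', hψ', F'', hF'', t, g', he, ht⟩ := ih γ' hN' B hB F' g
    refine ⟨C, hC, _, hψ.trans hψ', F'', hF'.comp hF'', ψ' f₀ + F''.x (.inl i) * t, g', ?_, ?_⟩
    · rw [RingHom.comp_apply, sub_eq_iff_eq_add.1 hg, map_add, map_mul, he, Frame.mono_add,
        Frame.mono_single, hF''.map_x]
      ring
    · exact .step i _ (by rw [hF''.map_d, h1, map_zero]) ht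

/-- One more differential monomial can be found after an étale extension. -/
theorem exists_insert (h𝒜 : IsEtaleClass c₀ n 𝒜) (hn : s + r = n) {Γ : ℕ → Fin s → ℕ} {G : Set R₀}
    {T : Finset (Fin s ⊕ Fin r)} (hT : T ≠ Finset.univ) {A : LocalExt R₀} (hA : 𝒜 A)
    {F : Frame (A.φ.comp c₀) (Fin s ⊕ Fin r)} {S : MonomialData s r}
    (h : IsPartialSystem F (A.φ '' G) Γ T S) : ∃ b ∉ T, ∃ B, 𝒜 B ∧ ∃ ψ, A.Extends c₀ n B ψ ∧
      ∃ F' : Frame (B.φ.comp c₀) (Fin s ⊕ Fin r),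
        (∀ i, Associated (F'.x (.inl i)) (ψ (F.x (.inl i)))) ∧
        ∃ S', IsPartialSystem F' (B.φ '' G) Γ (insert b T) S' := by
  obtain ⟨γ, h, hsum, f, hf, a, ha, w, hw, hfa⟩ := h.exists_next (h𝒜.smooth A hA) hn hT
  obtain ⟨S, hS⟩ : ∃ S' : MonomialData s r, S' = { S with γ := γ } := ⟨_, rfl⟩
  have hfa : S.dual T F a f = F.mono S.γ * w := by rw [hS]; exact hfa
  have hsum : ∑ l ∈ T, S.e l + S.γ = Γ (T.card + 1) := by rw [hS]; exact hsum
  rw [← hS] at h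
  clear hS
  -- split off the truncated part of `f`, and the value of the remaining factor `g`
  obtain ⟨B, hB, ψ, hψ, F₁, hF₁, t, g, he, ht⟩ := h𝒜.exists_trunc hn S.γ A hA F f
  have h₁ := h.map hF₁
  rw [hψ.image_eq] at h₁
  obtain ⟨hmem, hdual⟩ := h₁.mem_span_of_isTrunc (h𝒜.smooth B hB)
    (by rw [← hψ.image_eq]; exact ⟨f, hf, rfl⟩) he ht
  have hcomp : ψ.comp (A.φ.comp c₀) = B.φ.comp c₀ := by
    rw [← RingHom.comp_assoc, hψ.comp_eq]
  have hga := hdual a ha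
  rw [MonomialData.map_dual hF₁ hcomp, hfa, map_mul ψ, ← hF₁.map_mono] at hga
  obtain ⟨C, hC, ψ', hψ', e₀, he₀, hconst⟩ := h𝒜.exists_const B hB g
  obtain ⟨F₂, hF₂⟩ := hψ'.exists_frame _ F₁ (by simpa using hn)
  have h₂ := h₁.map hF₂
  have hmem₂ := map_mem_span ψ' hmem
  have hcomp' : ψ'.comp (B.φ.comp c₀) = C.φ.comp c₀ := by
    rw [← RingHom.comp_assoc, hψ'.comp_eq]
  have himage : (fun g i => ψ' (g i)) '' (F₁.vec '' (B.φ '' G)) = F₂.vec '' (C.φ '' G) := by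
    rw [← hψ'.image_eq, ← Set.image_comp, ← Set.image_comp F₂.vec]
    exact Set.image_congr fun f _ => (hF₂.map_vec f).symm
  rw [himage, ← hF₂.map_vec, map_mul, ← hF₂.map_mono] at hmem₂
  have hga₂ := congrArg ψ' hga
  rw [← MonomialData.map_dual hF₂ hcomp', map_mul ψ', map_mul ψ', ← hF₂.map_mono] at hga₂
  rw [hψ'.image_eq] at h₂
  have hwu : IsUnit (ψ' (ψ w)) := (hw.map ψ).map ψ'
  have hsm := h𝒜.smooth C hC
  have := hsm.isDomain
  have hass₂ : ∀ i, F₂.x (.inl i) = ψ' (ψ (F.x (.inl i))) := fun i => by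
    rw [hF₂.map_x, hF₁.map_x]
  have hde₀ : ∀ i, F₂.d i e₀ = 0 := fun i => hconst _ (F₂.d_const i)
  have hmono0 := F₂.mono_ne_zero hsm S.γ
  -- the case of a monomial `u^γ v_j`
  have caseB : ∀ (j : Fin r) (g' : C.carrier), .inr j ∉ T → g' ∈ maximalIdeal C.carrier →
      IsUnit (F₂.d (.inr j) g') →
      F₂.vec (F₂.mono S.γ * g') ∈ Submodule.span C.carrier (F₂.vec '' (C.φ '' G)) →
      ∃ b ∉ T, ∃ B, 𝒜 B ∧ ∃ ψ, A.Extends c₀ n B ψ ∧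
      ∃ F' : Frame (B.φ.comp c₀) (Fin s ⊕ Fin r),
        (∀ i, Associated (F'.x (.inl i)) (ψ (F.x (.inl i)))) ∧
        ∃ S', IsPartialSystem F' (B.φ '' G) Γ (insert b T) S' := by
    intro j g' hj h1 h2 h3
    obtain ⟨F', hF', S', hS'⟩ := h₂.exists_insert_inr hsm hn hsum hj h1 h2 h3
    exact ⟨_, hj, C, hC, _, hψ.trans hψ', F', fun i => by
      rw [RingHom.comp_apply, ← hass₂]; exact hF' i, S', hS'⟩
  -- a derivation `∂/∂v_j` with index outside of `T` which detects `g`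
  have hinr : ∀ j, a = .inr j → IsUnit (F₂.d (.inr j) (ψ' g)) := by
    rintro j rfl
    rw [Derivation.leibniz, MonomialData.dual_mono_inr, smul_zero, add_zero, smul_eq_mul] at hga₂
    rw [← mul_left_cancel₀ hmono0 hga₂] at hwu
    exact hwu
  by_cases hg : IsUnit (ψ' g)
  swap
  · cases a with
    | inr j => exact caseB j _ ha (by simpa using hg) (hinr j rfl) hmem₂
    | inl i =>
      exfalso
      rw [Derivation.leibniz, MonomialData.dual_mono_inl, smul_eq_mul, smul_eq_mul] at hga₂
      have e : F₂.mono S.γ * (S.dual T F₂ (.inl i) (ψ' g) + ψ' g *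
          ratConst (C.φ.comp c₀) (∑ l, (S.γ l : ℚ) * S.B l i)) = F₂.mono S.γ * ψ' (ψ w) := by
        rw [← hga₂]; ring
      have := mul_left_cancel₀ hmono0 e
      rw [← this] at hwu
      refine (mem_maximalIdeal _).1 (add_mem ?_ ?_) hwu
      · exact F₂.map_sub_mem S T i _
      · exact Ideal.mul_mem_right _ _ (by simpa using hg)
  by_cases hex : ∃ i, .inl i ∉ T ∧ ∑ l, (S.γ l : ℚ) * S.B l i ≠ 0
  · obtain ⟨i, hi, hμ⟩ := hex
    -- the case of a monomial `u^γ`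
    have he₀u : IsUnit e₀ := by
      by_contra hcon
      have : ψ' g ∈ maximalIdeal C.carrier := by
        have := add_mem he₀ (show e₀ ∈ maximalIdeal C.carrier by simpa using hcon)
        simpa using this
      exact (mem_maximalIdeal _).1 this hg
    obtain ⟨e, rfl⟩ := he₀u
    have hdinv : ∀ i, F₂.d i ((e⁻¹ : C.carrierˣ) : C.carrier) = 0 := by
      intro i
      have h1 := congrArg (F₂.d i) (Units.mul_inv e)
      rw [Derivation.leibniz, hde₀, smul_zero, add_zero, Derivation.map_one_eq_zero,
        smul_eq_mul] at h1
      exact (Units.mul_right_eq_zero e).1 h1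
    have hmem₃ : F₂.vec (F₂.mono S.γ * ((e⁻¹ : C.carrierˣ) * ψ' g)) ∈
        Submodule.span C.carrier (F₂.vec '' (C.φ '' G)) := by
      rw [mul_left_comm, F₂.vec_const_mul hdinv]
      exact Submodule.smul_mem _ _ hmem₂
    -- a common denominator of the exponents of `g` in the change of the coordinates `u_l`
    obtain ⟨d, hd, N, hN⟩ : ∃ d : ℕ, d ≠ 0 ∧ ∃ N : Fin s → ℤ, ∀ l, (N l : ℚ) =
        d * (S.B l i / ∑ l, (S.γ l : ℚ) * S.B l i) := by
      let ε : Fin s → ℚ := fun l => S.B l i / ∑ l, (S.γ l : ℚ) * S.B l i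
      refine ⟨∏ l, (ε l).den, Finset.prod_ne_zero_iff.2 fun l _ => (ε l).den_nz,
        fun l => (ε l).num * ∏ l' ∈ Finset.univ.erase l, ((ε l').den : ℤ), fun l => ?_⟩
      change _ = _ * ε l
      rw [← Finset.mul_prod_erase _ _ (Finset.mem_univ l)]
      push_cast
      have := Rat.mul_den_eq_num (ε l)
      linear_combination -(∏ x ∈ Finset.univ.erase l, ((ε x).den : ℚ)) * this
    obtain ⟨C', hC', ψ₃, hψ₃, w', hw'⟩ := h𝒜.exists_root C hC ((e⁻¹ : C.carrierˣ) * ψ' g) (by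
      have := Ideal.mul_mem_left _ ((e⁻¹ : C.carrierˣ) : C.carrier) he₀
      rwa [mul_sub, Units.inv_mul] at this) d hd
    obtain ⟨F₃, hF₃⟩ := hψ₃.exists_frame _ F₂ (by simpa using hn)
    have h₃ := h₂.map hF₃
    rw [hψ₃.image_eq] at h₃
    have hmem₄ := map_mem_span ψ₃ hmem₃
    have himage₃ : (fun g i => ψ₃ (g i)) '' (F₂.vec '' (C.φ '' G)) = F₃.vec '' (C'.φ '' G) := by
      rw [← hψ₃.image_eq, ← Set.image_comp, ← Set.image_comp F₃.vec]
      exact Set.image_congr fun f _ => (hF₃.map_vec f).symm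
    rw [himage₃, ← hF₃.map_vec, map_mul, ← hF₃.map_mono, ← hw'] at hmem₄
    have hw'u : IsUnit w' := by
      have : IsUnit (w' ^ d) := by
        rw [hw']; exact ((e⁻¹).isUnit.mul hg).map ψ₃
      exact (isUnit_pow_iff hd).1 this
    obtain ⟨w', rfl⟩ := hw'u
    obtain ⟨F', hF', S', hS'⟩ := h₃.exists_insert_inl (h𝒜.smooth C' hC') hn hsum hi hμ hN w'
      (by simpa using hmem₄)
    exact ⟨_, hi, C', hC', _, (hψ.trans hψ').trans hψ₃, F', fun i => by
      rw [RingHom.comp_apply, RingHom.comp_apply, ← hass₂, ← hF₃.map_x]; exact hF' i, S', hS'⟩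
  -- otherwise `d(u^γ)` is in the module already, and the value of `g` can be subtracted
  · push Not at hex
    have hm := h₂.vec_mono_mem hex
    cases a with
    | inl i =>
      exfalso
      rw [Derivation.leibniz, MonomialData.dual_mono_inl, hex i ha, map_zero, zero_mul, smul_zero,
        add_zero, smul_eq_mul] at hga₂
      rw [← mul_left_cancel₀ hmono0 hga₂] at hwu
      exact (mem_maximalIdeal _).1 (F₂.map_sub_mem S T i _) hwu
    | inr j =>
      refine caseB j (ψ' g - e₀) ha he₀ ?_ ?_
      · rw [map_sub, hde₀, sub_zero]; exact hinr j rfl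
      · have e : F₂.vec (F₂.mono S.γ * (ψ' g - e₀)) =
            F₂.vec (F₂.mono S.γ * ψ' g) - e₀ • F₂.vec (F₂.mono S.γ) := by
          rw [← F₂.vec_const_mul hde₀]
          ext b
          simp only [Frame.vec, Pi.sub_apply, ← map_sub]
          congr 1
          ring
        rw [e]
        exact sub_mem hmem₂ (Submodule.smul_mem _ _ hm)

/-- If the ideals of minors are generated by monomials, then after an étale extension there is a
complete system of differential monomials. -/
theorem exists_isPartialSystem (h𝒜 : IsEtaleClass c₀ n 𝒜) (hn : s + r = n) [IsLocalRing R₀]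
    (hid : 𝒜 ⟨R₀, RingHom.id R₀⟩) (F : Frame c₀ (Fin s ⊕ Fin r)) {Γ : ℕ → Fin s → ℕ} (hΓ : Γ 0 = 0)
    {G : Set R₀} (hG : ∀ m ≤ n, minorsIdeal (F.vec '' G) m = Ideal.span {F.mono (Γ m)}) :
    ∃ B, 𝒜 B ∧ ∃ F' : Frame (B.φ.comp c₀) (Fin s ⊕ Fin r),
        (∀ i, Associated (F'.x (.inl i)) (B.φ (F.x (.inl i)))) ∧
        ∃ S, IsPartialSystem F' (B.φ '' G) Γ Finset.univ S := by
  suffices H : ∀ N ≤ s + r, ∃ T : Finset (Fin s ⊕ Fin r), T.card = N ∧ ∃ B, 𝒜 B ∧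
      ∃ F' : Frame (B.φ.comp c₀) (Fin s ⊕ Fin r),
        (∀ i, Associated (F'.x (.inl i)) (B.φ (F.x (.inl i)))) ∧
        ∃ S, IsPartialSystem F' (B.φ '' G) Γ T S by
    obtain ⟨T, hT, h⟩ := H _ le_rfl
    rwa [(Finset.card_eq_iff_eq_univ T).1 (by simpa using hT)] at h
  intro N
  induction N with
  | zero =>
    intro _
    refine ⟨∅, rfl, _, hid, F, fun i => Associated.refl _, ⟨0, 1, 1, 0⟩, ?_⟩
    refine ⟨by simp, by simp, by simp, by simp, by simp [hΓ], by simp, fun f _ => ⟨0, fun a => ?_⟩,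
      ?_⟩
    · rw [Frame.mono_zero]; exact one_dvd _
    · intro m hm
      have : (RingHom.id R₀) '' G = G := by simp
      rw [this]
      exact hG m (hn ▸ hm)
  | succ N ih =>
    intro hN
    obtain ⟨T, hT, A, hA, F₁, hF₁, S, hS⟩ := ih (by omega)
    have hTu : T ≠ Finset.univ := by
      rintro rfl
      simp at hT
      omega
    obtain ⟨b, hb, B, hB, ψ, hψ, F', hF', S', hS'⟩ := h𝒜.exists_insert hn hTu hA hS
    refine ⟨_, by rw [Finset.card_insert_of_notMem hb, hT], B, hB, F', fun i => ?_, S', hS'⟩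
    refine (hF' i).trans ?_
    rw [← hψ.comp_eq]
    exact (hF₁ i).map ψ

end IsEtaleClass

end Forward

/-! ### Minors of systems of differential monomials -/

section Backward

open scoped Matrix
open IsLocalRing

theorem minorsIdeal_le_of_subset_span {R ι : Type*} [CommRing R] [Fintype ι] [DecidableEq ι]
    {G G' : Set (ι → R)} (h : G ⊆ Submodule.span R G') (m : ℕ) :
    minorsIdeal G m ≤ minorsIdeal G' m := by
  refine Ideal.span_le.2 ?_
  rintro _ ⟨g, J, hg, rfl⟩
  have := det_mem_minorsIdeal (m := m) G' (by simp) g (fun a => h (hg a)) fun b => Pi.single (J b) 1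
  simpa using this

theorem minorsIdeal_congr {R ι : Type*} [CommRing R] [Fintype ι] [DecidableEq ι]
    {G G' : Set (ι → R)} (h : Submodule.span R G = Submodule.span R G') (m : ℕ) :
    minorsIdeal G m = minorsIdeal G' m :=
  le_antisymm (minorsIdeal_le_of_subset_span (h ▸ Submodule.subset_span) m)
    (minorsIdeal_le_of_subset_span (h ▸ Submodule.subset_span) m)

/-- The minors of a diagonal matrix. -/
theorem minorsIdeal_range_single {R ι : Type*} [CommRing R] [Fintype ι] [DecidableEq ι]
    (δ : ι → R) (T : Finset ι) (h : ∀ T' : Finset ι, T'.card = T.card → ∏ l ∈ T, δ l ∣ ∏ l ∈ T', δ l) :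
    minorsIdeal (Set.range fun l => (Pi.single l (δ l) : ι → R)) T.card =
      Ideal.span {∏ l ∈ T, δ l} := by
  apply le_antisymm
  · refine Ideal.span_le.2 ?_
    rintro _ ⟨g, J, hg, rfl⟩
    rw [SetLike.mem_coe, Ideal.mem_span_singleton]
    by_cases hJ : Function.Injective J
    swap
    · obtain ⟨a, b, hab, hne⟩ : ∃ a b, J a = J b ∧ a ≠ b := by
        simpa [Function.Injective] using hJ
      rw [Matrix.det_zero_of_column_eq hne (by simp [hab])]
      exact dvd_zero _
    have hd : ∀ a i, ∃ x, g a i = δ i * x := by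
      intro a i
      obtain ⟨l, hl⟩ := hg a
      rw [← hl]
      by_cases e : i = l
      · subst e; exact ⟨1, by simp⟩
      · exact ⟨0, by simp [e]⟩
    choose X hX using hd
    have e : (Matrix.of fun a b => g a (J b)) = Matrix.of fun a b => δ (J b) * X a (J b) := by
      ext a b; exact hX _ _
    rw [e, Matrix.det_mul_row (fun b => δ (J b)) (fun a b => X a (J b))]
    refine Dvd.dvd.mul_right ?_ _
    have := h (Finset.univ.map ⟨J, hJ⟩) (by simp)
    simpa using this
  · rw [Ideal.span_singleton_le_iff_mem]
    have := det_mem_minorsIdeal (κ := T) (Set.range fun l => (Pi.single l (δ l) : ι → R))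
      (m := T.card) (by simp) (fun l => Pi.single l (δ l))
      (fun l => Submodule.subset_span ⟨l, rfl⟩) (fun l => Pi.single l 1)
    have e : (Matrix.of fun a b : T => (Pi.single (b : ι) 1 : ι → R) ⬝ᵥ Pi.single (a : ι) (δ a)) =
        Matrix.diagonal fun l : T => δ l := by
      ext a b
      by_cases hab : a = b
      · subst hab; simp
      · have : (b : ι) ≠ a := fun e => hab (Subtype.ext e.symm)
        simp [hab, Pi.single_apply]
    rwa [e, Matrix.det_diagonal, Finset.prod_coe_sort T δ] at this

/-- In a finite chain there are, for every `m`, `m` elements with the smallest sum. -/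
theorem exists_finset_sum_le {ι : Type*} [Fintype ι] [DecidableEq ι] {s : ℕ} (e : ι → Fin s → ℕ)
    (he : ∀ l l', e l ≤ e l' ∨ e l' ≤ e l) (m : ℕ) (hm : m ≤ Fintype.card ι) :
    ∃ T : Finset ι, T.card = m ∧
      ∀ T' : Finset ι, T'.card = m → ∑ l ∈ T, e l ≤ ∑ l ∈ T', e l := by
  obtain ⟨T, hT, hlow⟩ : ∃ T : Finset ι, T.card = m ∧ ∀ l ∈ T, ∀ l' ∉ T, e l ≤ e l' := by
    induction m with
    | zero => exact ⟨∅, rfl, by simp⟩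
    | succ m ih =>
      obtain ⟨T, hT, hlow⟩ := ih (by omega)
      have hne : (Finset.univ \ T).Nonempty := by
        rw [← Finset.card_pos, Finset.card_univ_sdiff]; omega
      obtain ⟨b, hb, hmin⟩ := Finset.exists_min_image _ (fun l => ∑ i, e l i) hne
      have hbT : b ∉ T := by simpa using hb
      have hble : ∀ l' ∉ T, e b ≤ e l' := by
        intro l' hl'
        rcases he b l' with h | h
        · exact h
        · have h1 := hmin l' (by simpa using hl')
          have h2 : ∀ i, e l' i = e b i := by
            by_contra! hcon
            obtain ⟨i, hi⟩ := hcon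
            have := Finset.sum_lt_sum (s := Finset.univ) (fun i _ => h i)
              ⟨i, Finset.mem_univ i, lt_of_le_of_ne (h i) hi⟩
            omega
          exact fun i => (h2 i).ge
      refine ⟨insert b T, by rw [Finset.card_insert_of_notMem hbT, hT], fun l hl l' hl' => ?_⟩
      rw [Finset.mem_insert, not_or] at hl'
      rcases Finset.mem_insert.1 hl with rfl | hl
      · exact hble l' hl'.2
      · exact hlow l hl l' hl'.2
  refine ⟨T, hT, fun T' hT' p => ?_⟩
  rw [Finset.sum_apply, Finset.sum_apply, ← Finset.sum_inter_add_sum_sdiff T T',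
    ← Finset.sum_inter_add_sum_sdiff T' T, Finset.inter_comm]
  refine Nat.add_le_add_left ?_ _
  have hc : (T \ T').card = (T' \ T).card := by
    have h1 := Finset.card_sdiff_add_card_inter T T'
    have h2 := Finset.card_sdiff_add_card_inter T' T
    rw [Finset.inter_comm] at h2
    omega
  rcases (T \ T').eq_empty_or_nonempty with h0 | h0
  · rw [h0]; simp
  · obtain ⟨b, hb, hmax⟩ := Finset.exists_max_image _ (fun l => e l p) h0
    calc ∑ l ∈ T \ T', e l p ≤ (T \ T').card • e b p := Finset.sum_le_card_nsmul _ _ _ hmax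
      _ = (T' \ T).card • e b p := by rw [hc]
      _ ≤ ∑ l ∈ T' \ T, e l p := Finset.card_nsmul_le_sum _ _ _ fun l hl =>
          hlow b (Finset.mem_sdiff.1 hb).1 l (Finset.mem_sdiff.1 hl).2 p

variable {k R : Type u} [Field k] [CharZero k] [CommRing R] [IsLocalRing R] {c : k →+* R}

namespace Frame

omit [CharZero k] in
/-- Ideals of minors do not depend on the coordinates, given the ideals `(u_i)`. -/
theorem minorsIdeal_vec_eq {s r s' r' : ℕ} (F : Frame c (Fin s ⊕ Fin r))
    (F' : Frame c (Fin s' ⊕ Fin r')) (h : ∀ i, ∃ i', Associated (F'.x (.inl i')) (F.x (.inl i)))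
    (h' : ∀ i', ∃ i, Associated (F.x (.inl i)) (F'.x (.inl i'))) (G : Set R) (m : ℕ) :
    minorsIdeal (F.vec '' G) m = minorsIdeal (F'.vec '' G) m := by
  obtain ⟨Q, hQ⟩ := F.exists_comb_theta F' h
  obtain ⟨Q', hQ'⟩ := F'.exists_comb_theta F h'
  have e : ∀ {s r s' r' : ℕ} (F₁ : Frame c (Fin s ⊕ Fin r)) (F₂ : Frame c (Fin s' ⊕ Fin r'))
      (Q : Fin s' ⊕ Fin r' → Fin s ⊕ Fin r → R)
      (Q' : Fin s ⊕ Fin r → Fin s' ⊕ Fin r' → R) (_ : ∀ a f, F₂.vec f a = Q a ⬝ᵥ F₁.vec f)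
      (_ : ∀ a f, F₁.vec f a = Q' a ⬝ᵥ F₂.vec f),
      minorsIdeal (F₁.vec '' G) m ≤ minorsIdeal (F₂.vec '' G) m := by
    intro s r s' r' F₁ F₂ Q Q' hQ hQ'
    have h1 := minorsIdeal_le_of_comb (F₁.vec '' G) m (fun g a => Q a ⬝ᵥ g) Q' (by
      rintro _ ⟨f, hf, rfl⟩ i
      rw [hQ']
      congr 1
      exact funext fun a => hQ a f)
    rwa [← Set.image_comp, show ((fun g a => Q a ⬝ᵥ g) ∘ F₁.vec) = F₂.vec from
      funext fun f => funext fun a => (hQ a f).symm] at h1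
  exact le_antisymm (e F F' Q Q' hQ hQ') (e F' F Q' Q hQ' hQ)

/-- The logarithmic coefficients of differential monomials form the product of a diagonal matrix of
monomials and an invertible matrix. -/
theorem exists_mul_eq_one {s r : ℕ} (F : Frame c (Fin s ⊕ Fin r))
    (e : Fin s ⊕ Fin r → Fin s → ℕ)
    (he : LinearIndependent ℚ (fun i j => (e (.inl i) j : ℚ))) :
    ∃ Ω Ψ : Matrix (Fin s ⊕ Fin r) (Fin s ⊕ Fin r) R, Ω * Ψ = 1 ∧
      ∀ l, F.vec (F.monoV e l) = F.mono (e l) • Ω l := by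
  let A : Matrix (Fin s) (Fin s) ℚ := fun i j => (e (.inl i) j : ℚ)
  have hA : IsUnit A := Matrix.linearIndependent_rows_iff_isUnit.1 he
  let Ω : Matrix (Fin s ⊕ Fin r) (Fin s ⊕ Fin r) R := Matrix.fromBlocks (A.map (ratConst c)) 0
    (Matrix.of fun j l => (e (.inr j) l : R) * F.x (.inr j)) 1
  have hΩ : IsUnit Ω.det := by
    rw [Matrix.det_fromBlocks_zero₁₂, Matrix.det_one, mul_one]
    change IsUnit ((ratConst c).mapMatrix A).det
    rw [← RingHom.map_det]
    exact ((Matrix.isUnit_iff_isUnit_det _).1 hA).map _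
  refine ⟨Ω, Ω⁻¹, Matrix.mul_nonsing_inv _ hΩ, fun l => ?_⟩
  ext a
  simp only [vec, Pi.smul_apply, smul_eq_mul, monoV]
  rw [Derivation.leibniz, theta_mono]
  cases l with
  | inl i =>
    cases a with
    | inl j =>
      have : Ω (.inl i) (.inl j) = ratConst c (e (.inl i) j) := rfl
      simp [this, mul_comm]
    | inr j => simp [Ω]
  | inr j =>
    rw [Sum.elim_inr, theta_v]
    cases a with
    | inl l => simp [Ω]; ring
    | inr l => simp [Ω, Matrix.one_apply, eq_comm]

/-- The ideals of minors of a module generated by differential monomials are generated by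
monomials. -/
theorem exists_minorsIdeal_eq {s r : ℕ} (F : Frame c (Fin s ⊕ Fin r)) (G : Set R)
    (e : Fin s ⊕ Fin r → Fin s → ℕ)
    (he : LinearIndependent ℚ (fun i j => (e (.inl i) j : ℚ)))
    (hc : ∀ l l', e l ≤ e l' ∨ e l' ≤ e l)
    (hG : Submodule.span R (F.vec '' G) =
      Submodule.span R (Set.range fun l => F.vec (F.monoV e l))) (m : ℕ) (hm : m ≤ s + r) :
    ∃ γ, minorsIdeal (F.vec '' G) m = Ideal.span {F.mono γ} := by
  obtain ⟨T, rfl, hT⟩ := exists_finset_sum_le e hc m (by simpa using hm)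
  obtain ⟨Ω, Ψ, hΩ, hw⟩ := F.exists_mul_eq_one e he
  have hΨ : Ψ * Ω = 1 := mul_eq_one_comm.1 hΩ
  refine ⟨∑ l ∈ T, e l, ?_⟩
  rw [minorsIdeal_congr hG, F.mono_sum, ← minorsIdeal_range_single _ T fun T' hT' => by
    rw [← F.mono_sum, ← F.mono_sum]; exact F.mono_dvd_of_le (hT T' hT')]
  have e1 : (fun g => g ᵥ* Ψ) '' (Set.range fun l => F.vec (F.monoV e l)) =
      Set.range fun l => (Pi.single l (F.mono (e l)) : Fin s ⊕ Fin r → R) := by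
    rw [← Set.range_comp]
    congr 1
    ext1 l
    have : Ω l ᵥ* Ψ = Pi.single l 1 := by
      have : Ω l ᵥ* Ψ = (Ω * Ψ) l := rfl
      rw [this, hΩ]
      ext a; simp [Matrix.one_apply, Pi.single_apply, eq_comm]
    simp only [Function.comp, hw, Matrix.smul_vecMul, this]
    ext a; simp [Pi.single_apply]
  have e2 : (fun g => g ᵥ* Ω) '' (Set.range fun l =>
      (Pi.single l (F.mono (e l)) : Fin s ⊕ Fin r → R)) =
      (Set.range fun l => F.vec (F.monoV e l)) := by
    rw [← Set.range_comp]
    congr 1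
    ext1 l
    rw [hw]
    ext a; simp [Matrix.row]
  apply le_antisymm
  · have := minorsIdeal_le_of_comb (Set.range fun l => F.vec (F.monoV e l)) T.card
      (fun g => g ᵥ* Ψ) (fun a b => Ω b a) (by
        intro g _ i
        have : g = (g ᵥ* Ψ) ᵥ* Ω := by rw [Matrix.vecMul_vecMul, hΨ, Matrix.vecMul_one]
        conv_lhs => rw [this]
        exact dotProduct_comm _ _)
    rwa [e1] at this
  · have := minorsIdeal_le_of_comb (Set.range fun l =>
      (Pi.single l (F.mono (e l)) : Fin s ⊕ Fin r → R)) T.card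
      (fun g => g ᵥ* Ω) (fun a b => Ψ b a) (by
        intro g _ i
        have : g = (g ᵥ* Ω) ᵥ* Ψ := by rw [Matrix.vecMul_vecMul, hΩ, Matrix.vecMul_one]
        conv_lhs => rw [this]
        exact dotProduct_comm _ _)
    rwa [e2] at this

omit [CharZero k] in
theorem exists_associated_mono {s r s' r' : ℕ} (F : Frame c (Fin s ⊕ Fin r))
    (F' : Frame c (Fin s' ⊕ Fin r')) (h : ∀ i, ∃ i', Associated (F'.x (.inl i')) (F.x (.inl i)))
    (γ : Fin s → ℕ) : ∃ γ', Associated (F'.mono γ') (F.mono γ) := by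
  choose p hp using h
  refine ⟨∑ i, γ i • Pi.single (p i) 1, ?_⟩
  rw [F'.mono_sum, mono]
  refine Associated.prod _ _ _ fun i _ => ?_
  have : ∀ t : ℕ, F'.mono (t • Pi.single (p i) 1) = F'.x (.inl (p i)) ^ t := by
    intro t
    induction t with
    | zero => simp [mono_zero]
    | succ t ih => rw [succ_nsmul, mono_add, ih, mono_single, pow_succ]
  rw [this]
  exact (hp i).pow_pow

/-- The evaluation of `1`-forms on the logarithmic derivations. -/
def evalTheta {s r : ℕ} (F : Frame c (Fin s ⊕ Fin r)) : OneForms c →ₗ[R] (Fin s ⊕ Fin r → R) :=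
  LinearMap.pi fun a => LinearMap.applyₗ
    (⟨F.theta a, F.theta_const a⟩ : constDerivations c)

omit [CharZero k] in
theorem evalTheta_injective {s r n : ℕ} (F : Frame c (Fin s ⊕ Fin r))
    (hR : IsSmoothLocalRing c n) : Function.Injective F.evalTheta := by
  have := hR.isDomain
  rw [injective_iff_map_eq_zero]
  intro ω hω
  let δ : Fin s ⊕ Fin r → constDerivations c := fun a => ⟨F.d a, F.d_const a⟩
  have h1 : ∀ a, ω (δ a) = 0 := by
    intro a
    have h2 := congrFun hω a
    change ω ⟨F.theta a, F.theta_const a⟩ = 0 at h2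
    cases a with
    | inl i =>
      have e : (⟨F.theta (.inl i), F.theta_const _⟩ : constDerivations c) =
        F.x (.inl i) • δ (.inl i) := rfl
      rw [e, map_smul, smul_eq_mul] at h2
      exact (mul_eq_zero.1 h2).resolve_left fun e => by simpa [e] using F.d_self (.inl i)
    | inr j => exact h2
  ext D
  have e : D = ∑ a, D.1 (F.x a) • δ a := by
    apply Subtype.ext
    ext f
    rw [AddSubmonoidClass.coe_finsetSum, Derivation.sum_apply']
    exact F.eq_sum D.1 D.2 f
  rw [e, map_sum]
  simp [h1]

omit [CharZero k] in
theorem span_differential_eq_iff {s r n : ℕ} (F : Frame c (Fin s ⊕ Fin r))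
    (hR : IsSmoothLocalRing c n) (G G' : Set R) :
    Submodule.span R (differential c '' G) = Submodule.span R (differential c '' G') ↔
      Submodule.span R (F.vec '' G) = Submodule.span R (F.vec '' G') := by
  have e : ∀ G : Set R, (Submodule.span R (differential c '' G)).map F.evalTheta =
      Submodule.span R (F.vec '' G) := fun G => by
    rw [Submodule.map_span, ← Set.image_comp]; rfl
  rw [← e, ← e]
  exact (Submodule.map_injective_of_injective (F.evalTheta_injective hR)).eq_iff.symm

end Frame

namespace IsPartialSystem

/-- A complete system of differential monomials generates the module of differential forms. -/
theorem span_eq {s r : ℕ} {F : Frame c (Fin s ⊕ Fin r)} {G : Set R} {Γ : ℕ → Fin s → ℕ}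
    {S : MonomialData s r} (h : IsPartialSystem F G Γ Finset.univ S) :
    Submodule.span R (F.vec '' G) =
      Submodule.span R (Set.range fun l => F.vec (F.monoV S.e l)) := by
  apply le_antisymm <;> rw [Submodule.span_le]
  · rintro _ ⟨f, hf, rfl⟩
    choose q hq using fun l => h.mono_dvd_dual_of_mem hf (Finset.mem_univ l)
    have h3 : F.vec f = ∑ l, q l • F.vec (F.monoV S.e l) := by
      ext b
      have := h.vec_eq_sum q (fun l _ => hq l) b 0 (fun a ha => absurd (Finset.mem_univ a) ha)
      simpa [Finset.sum_apply] using sub_eq_zero.1 (zero_dvd_iff.1 this)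
    rw [h3]
    exact Submodule.sum_mem _ fun l _ => Submodule.smul_mem _ _ (Submodule.subset_span ⟨l, rfl⟩)
  · rintro _ ⟨l, rfl⟩
    exact h.mem l (Finset.mem_univ l)

omit [CharZero k] in
theorem linearIndependent {s r : ℕ} {F : Frame c (Fin s ⊕ Fin r)} {G : Set R} {Γ : ℕ → Fin s → ℕ}
    {S : MonomialData s r} (h : IsPartialSystem F G Γ Finset.univ S) :
    LinearIndependent ℚ (fun i j => (S.e (.inl i) j : ℚ)) := by
  have e : (fun i j => (S.e (.inl i) j : ℚ)) = S.A := by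
    ext i j; exact (h.A_eq i (Finset.mem_univ _) j).symm
  rw [e]
  exact Matrix.linearIndependent_rows_iff_isUnit.2
    ((Matrix.isUnit_iff_isUnit_det _).2 (Matrix.isUnit_det_of_right_inverse h.mul_eq))

end IsPartialSystem

end Backward

/-! ### Smooth local rings of algebraic spaces -/

section NoetherianLocal

open IsLocalRing

variable {k R : Type u} [Field k] [CharZero k] [CommRing R] [IsLocalRing R] [IsNoetherianRing R]
  {c : k →+* R} {ι : Type} [Fintype ι] [DecidableEq ι]

/-- Krull's intersection theorem, modulo an ideal. -/
theorem Ideal.mem_of_forall_mem_sup_pow {I : Ideal R} {f : R}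
    (h : ∀ t : ℕ, f ∈ I ⊔ maximalIdeal R ^ t) : f ∈ I := by
  have key := Ideal.iInf_pow_smul_eq_bot_of_isLocalRing (M := R ⧸ I) (maximalIdeal R)
    (maximalIdeal.isMaximal R).ne_top
  rw [← Ideal.Quotient.eq_zero_iff_mem, ← Submodule.mem_bot R, ← key, Submodule.mem_iInf]
  intro t
  obtain ⟨a, ha, b, hb, e⟩ := Submodule.mem_sup.1 (h t)
  have : Ideal.Quotient.mk I f = b • (1 : R ⧸ I) := by
    rw [← e, map_add, Ideal.Quotient.eq_zero_iff_mem.2 ha, zero_add, Algebra.smul_def, mul_one]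
    rfl
  rw [this]
  exact Submodule.smul_mem_smul hb trivial

namespace Frame

/-- In a Noetherian local ring with coordinates and partial derivatives, any set of coordinates
generates a prime ideal. -/
theorem isPrime_span (F : Frame c ι) (S : Finset ι) : (Ideal.span (F.x '' S)).IsPrime := by
  suffices H : ∀ N : ℕ, ∀ S : Finset ι, Fintype.card ι - S.card = N →
      (Ideal.span (F.x '' S)).IsPrime from H _ S rfl
  intro N
  induction N with
  | zero =>
    intro S hS
    have : S = Finset.univ := (Finset.card_eq_iff_eq_univ S).1
      (le_antisymm (Finset.card_le_univ S) (Nat.sub_eq_zero_iff_le.1 hS))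
    rw [this, Finset.coe_univ, Set.image_univ, ← F.span_eq]
    exact (maximalIdeal.isMaximal R).isPrime
  | succ N ih =>
    intro S hS
    obtain ⟨i, hi⟩ : ∃ i, i ∉ S := by
      by_contra! hcon
      rw [(Finset.eq_univ_iff_forall).2 hcon, Finset.card_univ] at hS
      omega
    have hJ := ih (insert i S) (by rw [Finset.card_insert_of_notMem hi]; omega)
    set I := Ideal.span (F.x '' S) with hI
    have hIJ : Ideal.span (F.x '' (insert i S : Finset ι)) = I ⊔ Ideal.span {F.x i} := by
      rw [Finset.coe_insert, Set.image_insert_eq, Ideal.span_insert, sup_comm]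
    rw [hIJ] at hJ
    have hd : ∀ f ∈ I, F.d i f ∈ I := by
      intro f hf
      induction hf using Submodule.span_induction with
      | mem x hx =>
        obtain ⟨j, hj, rfl⟩ := hx
        rw [F.d_of_ne (fun e : i = j => hi (e ▸ hj))]
        exact zero_mem _
      | zero => rw [map_zero]; exact zero_mem _
      | add x y _ _ hx hy => rw [map_add]; exact add_mem hx hy
      | smul a x hx hx' =>
        rw [smul_eq_mul, Derivation.leibniz, smul_eq_mul, smul_eq_mul]
        exact add_mem (Ideal.mul_mem_left _ _ hx') (Ideal.mul_mem_right _ _ hx)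
    have hclosed : ∀ f, (∀ t, f ∈ I ⊔ Ideal.span {F.x i ^ t}) → f ∈ I := fun f hf =>
      Ideal.mem_of_forall_mem_sup_pow fun t => by
        refine (sup_le_sup_left ?_ I) (hf t)
        rw [Ideal.span_singleton_le_iff_mem]
        exact Ideal.pow_mem_pow (F.x_mem i) t
    have hsplit : ∀ t f, f ∈ I ⊔ Ideal.span {F.x i ^ t} ↔ ∃ g, f - F.x i ^ t * g ∈ I := by
      intro t f
      constructor
      · intro h
        obtain ⟨a, ha, b, hb, rfl⟩ := Submodule.mem_sup.1 h
        obtain ⟨g, rfl⟩ := Ideal.mem_span_singleton.1 hb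
        exact ⟨g, by simpa using ha⟩
      · rintro ⟨g, hg⟩
        exact Submodule.mem_sup.2 ⟨_, hg, _,
          Ideal.mem_span_singleton.2 (dvd_mul_right _ g), sub_add_cancel _ _⟩
    have hreg : ∀ f, F.x i * f ∈ I → f ∈ I := by
      intro f hf
      refine hclosed f fun t => ?_
      induction t with
      | zero => simp
      | succ t iht =>
        rw [hsplit] at iht ⊢
        obtain ⟨g, hg⟩ := iht
        have h1 : F.x i ^ (t + 1) * g ∈ I := by
          have := sub_mem hf (Ideal.mul_mem_left _ (F.x i) hg)
          convert this using 1
          ring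
        have h2 := hd _ h1
        rw [Derivation.leibniz, Derivation.leibniz_pow, F.d_self] at h2
        obtain ⟨w, hw⟩ := natCast_isUnit c (n := t + 1) (by omega)
        refine ⟨-((w⁻¹ : Rˣ) : R) * F.d i g, ?_⟩
        have h3 := add_mem hg (Ideal.mul_mem_left _ ((w⁻¹ : Rˣ) : R) h2)
        convert h3 using 1
        simp only [smul_eq_mul, nsmul_eq_mul, add_tsub_cancel_right, mul_one, ← hw]
        linear_combination -(F.x i ^ t * g) * Units.inv_mul w
    have hreg' : ∀ t f, F.x i ^ t * f ∈ I → f ∈ I := by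
      intro t
      induction t with
      | zero => simp
      | succ t iht => exact fun f hf => iht f (hreg _ (by rwa [← mul_assoc, ← pow_succ']))
    have hfactor : ∀ f ∉ I, ∃ t g, f - F.x i ^ t * g ∈ I ∧ g ∉ I ⊔ Ideal.span {F.x i} := by
      intro f hf
      classical
      have hex : ∃ t, f ∉ I ⊔ Ideal.span {F.x i ^ t} := by
        by_contra! hcon
        exact hf (hclosed f hcon)
      obtain ⟨t, ht⟩ : ∃ t, Nat.find hex = t + 1 := by
        refine Nat.exists_eq_succ_of_ne_zero fun h0 => ?_
        have := Nat.find_spec hex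
        rw [h0] at this
        simp at this
      have h1 : f ∈ I ⊔ Ideal.span {F.x i ^ t} := by
        by_contra hcon
        have := Nat.find_min' hex hcon
        omega
      have h2 := Nat.find_spec hex
      rw [ht] at h2
      obtain ⟨g, hg⟩ := (hsplit _ _).1 h1
      refine ⟨t, g, hg, fun hgJ => h2 ?_⟩
      have := (hsplit 1 g).1 (by simpa using hgJ)
      obtain ⟨g', hg'⟩ := this
      refine (hsplit _ _).2 ⟨g', ?_⟩
      have := add_mem hg (Ideal.mul_mem_left _ (F.x i ^ t) hg')
      convert this using 1
      ring
    refine ⟨fun htop => ?_, fun {a b} hab => ?_⟩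
    · refine hJ.ne_top ?_
      rw [htop]; simp
    · by_contra! hcon
      obtain ⟨t, a', ha, ha'⟩ := hfactor a hcon.1
      obtain ⟨t', b', hb, hb'⟩ := hfactor b hcon.2
      have h1 : F.x i ^ (t + t') * (a' * b') ∈ I := by
        have h2 := sub_mem hab (add_mem (Ideal.mul_mem_right b _ ha)
          (Ideal.mul_mem_left _ (F.x i ^ t * a') hb))
        convert h2 using 1
        ring
      exact (hJ.mem_or_mem (Ideal.mem_sup_left (hreg' _ _ h1))).elim ha' hb'

theorem isDomain_of_isNoetherianRing (F : Frame c ι) : IsDomain R := by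
  have h := F.isPrime_span ∅
  rw [Finset.coe_empty, Set.image_empty, Ideal.span_empty] at h
  exact IsDomain.of_bot_isPrime R

theorem prime_of_isNoetherianRing (F : Frame c ι) (i : ι) : Prime (F.x i) := by
  have h := F.isPrime_span {i}
  rw [Finset.coe_singleton, Set.image_singleton] at h
  exact (Ideal.span_singleton_prime fun e => by simpa [e] using F.d_self i).1 h

end Frame

end NoetherianLocal

section Kaehler

open IsLocalRing

variable {k R : Type u} [Field k] [CharZero k] [CommRing R] [IsLocalRing R] [Algebra k R]
  [Algebra.IsAlgebraic k (ResidueField R)] [Module.Finite R (Ω[R⁄k])]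

/-- If the residue field is algebraic over the constants, the differentials of generators of the
maximal ideal generate the module of Kähler differentials. -/
theorem KaehlerDifferential.span_D_eq_top {ι : Type} [Fintype ι] (x : ι → R)
    (hx : maximalIdeal R = Ideal.span (Set.range x)) :
    Submodule.span R (Set.range fun i => KaehlerDifferential.D k R (x i)) = ⊤ := by
  set N := Submodule.span R (Set.range fun i => KaehlerDifferential.D k R (x i)) with hN
  rw [eq_top_iff]
  refine Submodule.le_of_le_smul_of_le_jacobson_bot (I := maximalIdeal R) Module.Finite.fg_top
    (maximalIdeal_le_jacobson _) ?_
  have hm : ∀ f ∈ maximalIdeal R, KaehlerDifferential.D k R f ∈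
      N ⊔ maximalIdeal R • (⊤ : Submodule R (Ω[R⁄k])) := by
    intro f hf
    obtain ⟨q, rfl⟩ := (Submodule.mem_span_range_iff_exists_fun R).1
      (show f ∈ Ideal.span (Set.range x) from hx ▸ hf)
    rw [map_sum]
    refine sum_mem fun i _ => ?_
    rw [smul_eq_mul, Derivation.leibniz]
    refine add_mem (Submodule.mem_sup_left (Submodule.smul_mem _ _ (Submodule.subset_span ⟨i, rfl⟩)))
      (Submodule.mem_sup_right (Submodule.smul_mem_smul ?_ trivial))
    rw [hx]
    exact Ideal.subset_span ⟨i, rfl⟩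
  conv_lhs => rw [← KaehlerDifferential.span_range_derivation]
  rw [Submodule.span_le]
  rintro _ ⟨f, rfl⟩
  let P := minpoly k (residue R f)
  have hint : IsIntegral k (residue R f) := (Algebra.IsAlgebraic.isAlgebraic _).isIntegral
  have hP : Polynomial.aeval f P ∈ maximalIdeal R := by
    rw [← residue_eq_zero_iff]
    change algebraMap R (ResidueField R) _ = 0
    rw [← Polynomial.aeval_algebraMap_apply]
    exact minpoly.aeval _ _
  have hP' : IsUnit (Polynomial.aeval f (Polynomial.derivative P)) := by
    by_contra hcon
    have h1 : residue R (Polynomial.aeval f (Polynomial.derivative P)) = 0 := by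
      rw [residue_eq_zero_iff]; simpa using hcon
    change algebraMap R (ResidueField R) _ = 0 at h1
    rw [← Polynomial.aeval_algebraMap_apply] at h1
    exact ((minpoly.irreducible hint).separable.aeval_derivative_ne_zero (minpoly.aeval _ _)) h1
  have h2 := hm _ hP
  rw [Derivation.map_aeval] at h2
  exact (Submodule.smul_mem_iff_of_isUnit _ hP').1 h2

theorem exists_frame_of_kaehlerDifferential [Module.Free R (Ω[R⁄k])] {ι : Type} [Fintype ι]
    [DecidableEq ι] (hn : Module.finrank R (Ω[R⁄k]) = Fintype.card ι) (x : ι → R)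
    (hx : maximalIdeal R = Ideal.span (Set.range x)) :
    ∃ F : Frame (algebraMap k R) ι, F.x = x := by
  let e₀ : (ι → R) →ₗ[R] Ω[R⁄k] := Fintype.linearCombination R
    fun i => KaehlerDifferential.D k R (x i)
  have hsurj : Function.Surjective e₀ := by
    rw [← LinearMap.range_eq_top, Fintype.range_linearCombination]
    exact KaehlerDifferential.span_D_eq_top x hx
  have hinj : Function.Injective e₀ := by
    let l : Ω[R⁄k] ≃ₗ[R] (ι → R) := LinearEquiv.ofFinrankEq _ _ (by simp [hn])
    have h1 := OrzechProperty.injective_of_surjective_endomorphism (l.toLinearMap ∘ₗ e₀)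
      (l.surjective.comp hsurj)
    exact Function.Injective.of_comp h1
  let e := LinearEquiv.ofBijective e₀ ⟨hinj, hsurj⟩
  have he : ∀ i, e.symm (KaehlerDifferential.D k R (x i)) = Pi.single i 1 := by
    intro i
    rw [LinearEquiv.symm_apply_eq]
    change _ = e₀ (Pi.single i 1)
    simp [e₀, Fintype.linearCombination_apply_single]
  have hsum : ∀ ω, ω = ∑ i, e.symm ω i • KaehlerDifferential.D k R (x i) := by
    intro ω
    conv_lhs => rw [← e.apply_symm_apply ω]
    rfl
  let d : ι → Derivation k R R := fun i =>
    ((LinearMap.proj i).comp e.symm.toLinearMap).compDer (KaehlerDifferential.D k R)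
  refine ⟨⟨x, fun i => (d i).restrictScalars ℤ, hx, fun i t => (d i).map_algebraMap t, fun i j => ?_,
    fun D hD f => ?_⟩, rfl⟩
  · change e.symm (KaehlerDifferential.D k R (x j)) i = _
    rw [he]
    simp [Pi.single_apply]
  · let D' : Derivation k R R := Derivation.mk'
      { toFun := D
        map_add' := map_add D
        map_smul' := fun t f => by
          simp [Algebra.smul_def, hD] } (fun a b => D.leibniz a b)
    have h1 : ∀ f, D f = D'.liftKaehlerDifferential (KaehlerDifferential.D k R f) := fun f =>
      (D'.liftKaehlerDifferential_comp_D f).symm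
    rw [h1, hsum (KaehlerDifferential.D k R f), map_sum]
    refine Finset.sum_congr rfl fun i _ => ?_
    rw [map_smul, ← h1, smul_eq_mul, mul_comm]
    rfl

/-- A Noetherian local ring with free module of differentials of rank `n`. -/
theorem isSmoothLocalRing_of_kaehlerDifferential [IsNoetherianRing R] [Module.Free R (Ω[R⁄k])]
    {n : ℕ} (hn : Module.finrank R (Ω[R⁄k]) = n) {ι₀ : Type} [Fintype ι₀]
    (hι₀ : Fintype.card ι₀ = n) (x₀ : ι₀ → R)
    (hx₀ : maximalIdeal R = Ideal.span (Set.range x₀)) :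
    IsSmoothLocalRing (algebraMap k R) n := by
  classical
  refine ⟨?_, fun f hf => ?_, fun ι _ _ x hι hx i => ?_, fun ι _ _ x hι hx => ?_⟩
  · obtain ⟨F, -⟩ := exists_frame_of_kaehlerDifferential (hn.trans hι₀.symm) x₀ hx₀
    exact F.isDomain_of_isNoetherianRing
  · have := Ideal.mem_of_forall_mem_sup_pow (I := ⊥) (f := f) (fun t => by simpa using hf t)
    simpa using this
  · obtain ⟨F, rfl⟩ := exists_frame_of_kaehlerDifferential (hn.trans hι.symm) x hx
    exact F.prime_of_isNoetherianRing i
  · exact exists_frame_of_kaehlerDifferential (hn.trans hι.symm) x hx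

end Kaehler

/-! ### Étale extensions of smooth local rings -/

section EssentiallyEtale

open IsLocalRing TensorProduct

/-- The local ring of a smooth algebraic variety of dimension `n` over `k` at a closed point:
essentially of finite type, with free module of differentials of rank `n`, a finite extension
of `k` as residue field, and `n` generators of the maximal ideal. -/
structure IsAlgebraicSmoothLocalRing (k R : Type u) [Field k] [CommRing R] [IsLocalRing R]
    [Algebra k R] (n : ℕ) : Prop where
  isNoetherianRing : IsNoetherianRing R
  isAlgebraic : Algebra.IsAlgebraic k (ResidueField R)
  finite : Module.Finite R (Ω[R⁄k])
  free : Module.Free R (Ω[R⁄k])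
  finrank_eq : Module.finrank R (Ω[R⁄k]) = n
  smooth : Algebra.FormallySmooth k R
  exists_span : ∃ x : Fin n → R, maximalIdeal R = Ideal.span (Set.range x)

variable {k R R' : Type u} [Field k] [CommRing R] [IsLocalRing R] [Algebra k R] [CommRing R']
  [IsLocalRing R'] [Algebra k R'] [Algebra R R'] [IsScalarTower k R R'] {n : ℕ}

namespace IsAlgebraicSmoothLocalRing

theorem isSmoothLocalRing [CharZero k] (h : IsAlgebraicSmoothLocalRing k R n) :
    IsSmoothLocalRing (algebraMap k R) n := by
  have := h.isNoetherianRing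
  have := h.isAlgebraic
  have := h.finite
  have := h.free
  obtain ⟨x, hx⟩ := h.exists_span
  exact isSmoothLocalRing_of_kaehlerDifferential h.finrank_eq (by simp) x hx

variable [Algebra.FormallyEtale R R'] [Algebra.EssFiniteType R R'] [IsLocalHom (algebraMap R R')]

theorem of_formallyEtale (h : IsAlgebraicSmoothLocalRing k R n) :
    IsAlgebraicSmoothLocalRing k R' n := by
  have := h.isNoetherianRing
  have := h.isAlgebraic
  have := h.finite
  have := h.free
  have := h.smooth
  let e := KaehlerDifferential.tensorKaehlerEquivOfFormallyEtale k R R'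
  refine ⟨Algebra.EssFiniteType.isNoetherianRing R R', ?_, Module.Finite.equiv e,
    Module.Free.of_equiv e, ?_, Algebra.FormallySmooth.comp k R R', ?_⟩
  · exact Algebra.IsAlgebraic.trans k (ResidueField R) (ResidueField R')
  · rw [← e.finrank_eq, Module.finrank_baseChange, h.finrank_eq]
  · obtain ⟨x, hx⟩ := h.exists_span
    refine ⟨fun i => algebraMap R R' (x i), ?_⟩
    rw [← Algebra.FormallyUnramified.map_maximalIdeal (R := R), hx, Ideal.map_span, ← Set.range_comp]
    rfl

/-- Coordinates and partial derivatives extend to formally étale extensions. -/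
theorem exists_isMap [CharZero k] (h : IsAlgebraicSmoothLocalRing k R n) {ι : Type} [Fintype ι]
    [DecidableEq ι] (hι : Fintype.card ι = n) (F : Frame (algebraMap k R) ι) :
    ∃ F' : Frame (algebraMap k R') ι, F.IsMap (algebraMap R R') F' := by
  have h' : IsAlgebraicSmoothLocalRing k R' n := h.of_formallyEtale
  have := h.isAlgebraic
  have := h.finite
  obtain ⟨F', hF'⟩ := h'.isSmoothLocalRing.exists_frame ι (fun i => algebraMap R R' (F.x i)) hι (by
    rw [← Algebra.FormallyUnramified.map_maximalIdeal (R := R), F.span_eq, Ideal.map_span,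
      ← Set.range_comp]
    rfl)
  refine ⟨F', fun i => by rw [hF'], fun i f => ?_⟩
  -- two derivations from `R` to `R'` which agree on the coordinates
  let D₁ : Derivation k R R' := Derivation.mk'
    { toFun := fun f => F'.d i (algebraMap R R' f)
      map_add' := by simp
      map_smul' := fun t f => by
        rw [Algebra.smul_def, map_mul, Derivation.leibniz, ← IsScalarTower.algebraMap_apply,
          F'.d_const, smul_zero, add_zero, RingHom.id_apply, smul_eq_mul, Algebra.smul_def] }
    (fun a b => by simp [Algebra.smul_def])
  let D₂ : Derivation k R R' := Derivation.mk'
    { toFun := fun f => algebraMap R R' (F.d i f)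
      map_add' := by simp
      map_smul' := fun t f => by
        rw [Algebra.smul_def, Derivation.leibniz, F.d_const, smul_zero, add_zero, smul_eq_mul,
          map_mul, ← IsScalarTower.algebraMap_apply, RingHom.id_apply, Algebra.smul_def] }
    (fun a b => by simp [Algebra.smul_def])
  have hD : ∀ j, D₁ (F.x j) = D₂ (F.x j) := by
    intro j
    change F'.d i (algebraMap R R' (F.x j)) = algebraMap R R' (F.d i (F.x j))
    rw [← congrFun hF' j, F'.d_x, F.d_x]
    split_ifs <;> simp
  have hL : D₁.liftKaehlerDifferential = D₂.liftKaehlerDifferential := by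
    refine LinearMap.ext_on_range (KaehlerDifferential.span_D_eq_top F.x F.span_eq) fun j => ?_
    rw [Derivation.liftKaehlerDifferential_comp_D, Derivation.liftKaehlerDifferential_comp_D, hD]
  have := LinearMap.congr_fun hL (KaehlerDifferential.D k R f)
  rwa [Derivation.liftKaehlerDifferential_comp_D, Derivation.liftKaehlerDifferential_comp_D] at this

end IsAlgebraicSmoothLocalRing

/-- Coordinates define a formally étale map to affine space. -/
theorem Frame.formallyEtale_mvPolynomial [CharZero k] (h : IsAlgebraicSmoothLocalRing k R n)
    {ι : Type} [Fintype ι] [DecidableEq ι] (F : Frame (algebraMap k R) ι) [Algebra (MvPolynomial ι k) R]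
    [IsScalarTower k (MvPolynomial ι k) R]
    (hx : ∀ i, algebraMap (MvPolynomial ι k) R (MvPolynomial.X i) = F.x i) :
    Algebra.FormallyEtale (MvPolynomial ι k) R := by
  have := h.isAlgebraic
  have := h.finite
  have := h.smooth
  have hspan := KaehlerDifferential.span_D_eq_top (k := k) F.x F.span_eq
  let m := KaehlerDifferential.mapBaseChange k (MvPolynomial ι k) R
  have hm : ∀ i, m (1 ⊗ₜ KaehlerDifferential.D k _ (MvPolynomial.X i)) =
      KaehlerDifferential.D k R (F.x i) := by
    intro i
    simp [m, hx]
  constructor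
  · refine subsingleton_of_forall_eq 0 fun ω => ?_
    obtain ⟨ω, rfl⟩ := KaehlerDifferential.map_surjective k (MvPolynomial ι k) R ω
    have hz : ∀ ω, KaehlerDifferential.map k (MvPolynomial ι k) R R ω = 0 := by
      intro ω
      have : ω ∈ LinearMap.range m := by
        have h1 : ω ∈ Submodule.span R (Set.range fun i => KaehlerDifferential.D k R (F.x i)) := by
          rw [hspan]; trivial
        refine (Submodule.span_le.2 ?_) h1
        rintro _ ⟨i, rfl⟩
        exact ⟨_, hm i⟩
      exact (KaehlerDifferential.exact_mapBaseChange_map k (MvPolynomial ι k) R ω).2 this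
    exact hz ω
  · refine subsingleton_of_forall_eq 0 fun y => ?_
    have hinj : Function.Injective m := by
      rw [injective_iff_map_eq_zero]
      intro z hz
      let b := Algebra.TensorProduct.basis R (KaehlerDifferential.mvPolynomialBasis k ι)
      have hb : ∀ i, b i = 1 ⊗ₜ KaehlerDifferential.D k _ (MvPolynomial.X i) := fun i => by
        simp [b]
      have e := b.sum_repr z
      rw [← e, map_sum] at hz
      have hz' : ∑ i, b.repr z i • KaehlerDifferential.D k R (F.x i) = 0 := by
        rw [← hz]
        refine Finset.sum_congr rfl fun i _ => ?_
        rw [map_smul, hb, hm]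
      have h0 : ∀ i, b.repr z i = 0 := by
        intro i
        let D : Derivation k R R := Derivation.mk'
          { toFun := F.d i
            map_add' := by simp
            map_smul' := fun t f => by
              simp [Algebra.smul_def, F.d_const] } (fun a b => (F.d i).leibniz a b)
        have h1 := congrArg D.liftKaehlerDifferential hz'
        have h2 : ∀ j, D (F.x j) = if i = j then 1 else 0 := F.d_x i
        simpa [h2] using h1
      rw [← e]
      simp [h0]
    have h1 : Algebra.H1Cotangent.δ k (MvPolynomial ι k) R y = 0 :=
      hinj (by rw [(Algebra.H1Cotangent.exact_δ_mapBaseChange k (MvPolynomial ι k) R).apply_apply_eq_zero,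
        map_zero])
    obtain ⟨z, rfl⟩ := (Algebra.H1Cotangent.exact_map_δ k (MvPolynomial ι k) R y).1 h1
    rw [Subsingleton.elim z 0, map_zero]

end EssentiallyEtale

/-! ### Étale neighbourhoods of smooth algebraic varieties -/

section Charts

open IsLocalRing TensorProduct

theorem IsLocalization.atPrime_comap_maximalIdeal {B A : Type*} [CommRing B] [CommRing A]
    [IsLocalRing A] [Algebra B A] (S : Submonoid B) [IsLocalization S A] :
    IsLocalization.AtPrime A ((maximalIdeal A).comap (algebraMap B A)) := by
  refine IsLocalization.of_le S _ (fun x hx => ?_) fun x hx => ?_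
  · change x ∉ (maximalIdeal A).comap (algebraMap B A)
    rw [Ideal.mem_comap, mem_maximalIdeal, mem_nonunits_iff, not_not]
    exact IsLocalization.map_units A ⟨x, hx⟩
  · have : x ∉ (maximalIdeal A).comap (algebraMap B A) := hx
    rwa [Ideal.mem_comap, mem_maximalIdeal, mem_nonunits_iff, not_not] at this

variable {k B₀ R₀ : Type u} [Field k] [CharZero k] [CommRing B₀] [CommRing R₀] [IsLocalRing R₀]
  [Algebra k B₀] [Algebra k R₀] [Algebra B₀ R₀] [IsScalarTower k B₀ R₀]
  [Algebra.FormallyUnramified B₀ R₀] {n : ℕ}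

/-- The local ring `A` over `R₀` is a local ring of the étale `B₀`-algebra `B`, at a prime
ideal lying over the prime ideal of `B₀` given by `R₀`. -/
structure IsEtaleChart (A : LocalExt R₀) (B₀ B : Type u) [CommRing B₀] [Algebra B₀ R₀] [CommRing B]
    [Algebra B₀ B] [Algebra B A.carrier] : Prop where
  isLocalHom : IsLocalHom A.φ
  etale : Algebra.Etale B₀ B
  comp_eq : (algebraMap B A.carrier).comp (algebraMap B₀ B) = A.φ.comp (algebraMap B₀ R₀)
  isLocalization : IsLocalization.AtPrime A.carrier
    ((maximalIdeal A.carrier).comap (algebraMap B A.carrier))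

/-- The local ring `A` over `R₀` is a local ring of some étale `B₀`-algebra, at a prime
ideal lying over the prime ideal of `B₀` given by `R₀`. -/
def IsEtaleLocal (B₀ : Type u) [CommRing B₀] [Algebra B₀ R₀] (A : LocalExt R₀) : Prop :=
  ∃ (B : Type u) (_ : CommRing B) (_ : Algebra B₀ B) (_ : Algebra B A.carrier),
    IsEtaleChart A B₀ B

namespace IsEtaleChart

variable {A : LocalExt R₀} {B : Type u} [CommRing B] [Algebra B₀ B] [Algebra B A.carrier]

omit [IsLocalRing R₀] in
theorem formallyEtale (h : IsEtaleChart A B₀ B) :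
    letI := A.φ.toAlgebra
    Algebra.FormallyEtale R₀ A.carrier ∧ Algebra.EssFiniteType R₀ A.carrier := by
  let := A.φ.toAlgebra
  let := (A.φ.comp (algebraMap B₀ R₀)).toAlgebra
  have : IsScalarTower B₀ R₀ A.carrier := .of_algebraMap_eq fun _ => rfl
  have : IsScalarTower B₀ B A.carrier := .of_algebraMap_eq' h.comp_eq.symm
  have := h.etale
  have := h.isLocalization
  have : Algebra.FormallyEtale B A.carrier := .of_isLocalization
    ((maximalIdeal A.carrier).comap (algebraMap B A.carrier)).primeCompl
  have : Algebra.FormallyEtale B₀ A.carrier := .comp B₀ B A.carrier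
  have : Algebra.EssFiniteType B A.carrier := .of_isLocalization _
    ((maximalIdeal A.carrier).comap (algebraMap B A.carrier)).primeCompl
  have : Algebra.EssFiniteType B₀ A.carrier := .comp B₀ B A.carrier
  exact ⟨.of_restrictScalars (R := B₀), .of_comp B₀ R₀ A.carrier⟩

omit [CharZero k] [Algebra k B₀] [IsScalarTower k B₀ R₀] in
theorem isAlgebraicSmoothLocalRing (h : IsEtaleChart A B₀ B)
    (hR₀ : IsAlgebraicSmoothLocalRing k R₀ n) :
    letI := (A.φ.comp (algebraMap k R₀)).toAlgebra
    IsAlgebraicSmoothLocalRing k A.carrier n := by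
  let := (A.φ.comp (algebraMap k R₀)).toAlgebra
  let := A.φ.toAlgebra
  have : IsScalarTower k R₀ A.carrier := .of_algebraMap_eq fun _ => rfl
  have := h.formallyEtale.1
  have := h.formallyEtale.2
  have : IsLocalHom (algebraMap R₀ A.carrier) := h.isLocalHom
  exact hR₀.of_formallyEtale

omit [IsLocalRing R₀] [Algebra.FormallyUnramified B₀ R₀] in
/-- An étale chart can be restricted to the complement of the zero set of a function. -/
theorem away (h : IsEtaleChart A B₀ B) {b : B} (hb : IsUnit (algebraMap B A.carrier b)) :
    letI := (IsLocalization.Away.lift (S := Localization.Away b) b hb).toAlgebra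
    IsScalarTower B (Localization.Away b) A.carrier ∧ IsEtaleChart A B₀ (Localization.Away b) := by
  let := (IsLocalization.Away.lift (S := Localization.Away b) b hb).toAlgebra
  have htower : IsScalarTower B (Localization.Away b) A.carrier :=
    .of_algebraMap_eq fun x => (IsLocalization.Away.lift_eq (S := Localization.Away b) b hb x).symm
  refine ⟨htower, h.isLocalHom, ?_, ?_, ?_⟩
  · have := h.etale
    infer_instance
  · rw [← h.comp_eq]
    ext x
    simp only [RingHom.comp_apply]
    rw [IsScalarTower.algebraMap_apply B₀ B (Localization.Away b),
      ← IsScalarTower.algebraMap_apply B (Localization.Away b) A.carrier]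
  · have := h.isLocalization
    have := IsLocalization.isLocalization_of_submonoid_le (Localization.Away b) A.carrier
      (Submonoid.powers b) ((maximalIdeal A.carrier).comap (algebraMap B A.carrier)).primeCompl (by
        rw [Submonoid.powers_le]
        change b ∉ (maximalIdeal A.carrier).comap (algebraMap B A.carrier)
        rwa [Ideal.mem_comap, mem_maximalIdeal, mem_nonunits_iff, not_not])
    exact IsLocalization.atPrime_comap_maximalIdeal (((maximalIdeal A.carrier).comap
      (algebraMap B A.carrier)).primeCompl.map (algebraMap B (Localization.Away b)))

omit [IsLocalRing R₀] [Algebra.FormallyUnramified B₀ R₀] in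
/-- A finite family of germs is defined on some étale chart. -/
theorem exists_mem_range (h : IsEtaleChart A B₀ B) {κ : Type*} [Finite κ] (f : κ → A.carrier) :
    ∃ (B' : Type u) (_ : CommRing B') (_ : Algebra B₀ B') (_ : Algebra B' A.carrier),
      IsEtaleChart A B₀ B' ∧ ∃ f' : κ → B', ∀ i, algebraMap B' A.carrier (f' i) = f i := by
  have := h.isLocalization
  obtain ⟨b, hb⟩ := IsLocalization.exist_integer_multiples_of_finite
    ((maximalIdeal A.carrier).comap (algebraMap B A.carrier)).primeCompl f
  choose a ha using hb
  have hu : IsUnit (algebraMap B A.carrier b) := IsLocalization.map_units A.carrier b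
  let := (IsLocalization.Away.lift (S := Localization.Away (b : B)) (b : B) hu).toAlgebra
  obtain ⟨htower, hchart⟩ := h.away hu
  refine ⟨Localization.Away (b : B), inferInstance, inferInstance, inferInstance, hchart,
    fun i => IsLocalization.mk' _ (a i) (⟨b, Submonoid.mem_powers _⟩ : Submonoid.powers (b : B)),
    fun i => ?_⟩
  refine hu.mul_left_cancel ?_
  rw [← Algebra.smul_def, ← Algebra.smul_def]
  refine Eq.trans ?_ (ha i)
  rw [Algebra.smul_def, IsScalarTower.algebraMap_apply B (Localization.Away (b : B)) A.carrier,
    ← map_mul, IsScalarTower.algebraMap_apply B (Localization.Away (b : B)) A.carrier (a i)]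
  congr 1
  exact IsLocalization.mk'_spec' (Localization.Away (b : B)) (a i)
    (⟨b, Submonoid.mem_powers _⟩ : Submonoid.powers (b : B))

omit [Algebra k B₀] [IsScalarTower k B₀ R₀] in
/-- The extension of a local ring of an étale neighbourhood given by the base change of
an étale algebra `E` over `P` along a homomorphism from `P` to the coordinate ring. -/
theorem exists_extends (h : IsEtaleChart A B₀ B) (hR₀ : IsAlgebraicSmoothLocalRing k R₀ n)
    {P E K : Type u} [CommRing P] [CommRing E] [Algebra P E] [Algebra.Etale P E] [Field K]
    (ρ : P →+* B) (η : A.carrier →+* K) [IsLocalHom η] (χ : E →+* K)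
    (hχ : χ.comp (algebraMap P E) = η.comp ((algebraMap B A.carrier).comp ρ)) :
    ∃ A', IsEtaleLocal B₀ A' ∧ ∃ ψ, A.Extends (algebraMap k R₀) n A' ψ ∧
      ∃ τ : E →+* A'.carrier,
        τ.comp (algebraMap P E) = ψ.comp ((algebraMap B A.carrier).comp ρ) ∧
      ∀ (b : B) (e : E), η (algebraMap B A.carrier b) = χ e →
        ψ (algebraMap B A.carrier b) - τ e ∈ maximalIdeal A'.carrier := by
  let := ρ.toAlgebra
  let := (η.comp (algebraMap B A.carrier)).toAlgebra
  let := (χ.comp (algebraMap P E)).toAlgebra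
  have : IsScalarTower P B K := .of_algebraMap_eq' hχ
  have := h.etale
  have := h.isLocalization
  let g₂ : E →ₐ[P] K := { χ with commutes' := fun _ => rfl }
  let Θ : B ⊗[P] E →ₐ[B] K := Algebra.TensorProduct.lift (Algebra.ofId B K) g₂
    fun _ _ => mul_comm _ _
  let Q : Ideal (B ⊗[P] E) := RingHom.ker Θ.toRingHom
  have hQ : Q.IsPrime := RingHom.ker_isPrime _
  let L := Localization.AtPrime Q
  let μ : B →+* L := (algebraMap (B ⊗[P] E) L).comp (algebraMap B (B ⊗[P] E))
  have hΘ : ∀ b : B, Θ (algebraMap B (B ⊗[P] E) b) = η (algebraMap B A.carrier b) := fun b =>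
    Θ.commutes b
  have hμ : ∀ y : ((maximalIdeal A.carrier).comap (algebraMap B A.carrier)).primeCompl,
      IsUnit (μ y) := by
    intro y
    have hy : IsUnit (algebraMap B A.carrier y) := IsLocalization.map_units A.carrier y
    refine IsLocalization.map_units L (⟨algebraMap B (B ⊗[P] E) y, ?_⟩ : Q.primeCompl)
    change ¬ Θ (algebraMap B (B ⊗[P] E) y) = 0
    rw [hΘ]
    exact (hy.map η).ne_zero
  let ψ : A.carrier →+* L := IsLocalization.lift hμ
  have hψ : ∀ b, ψ (algebraMap B A.carrier b) = μ b := fun b => IsLocalization.lift_eq hμ b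
  have hν : ∀ y : Q.primeCompl, IsUnit (Θ.toRingHom y) := fun y => isUnit_iff_ne_zero.2 y.2
  let η' : L →+* K := IsLocalization.lift hν
  have hη' : ∀ z, η' (algebraMap (B ⊗[P] E) L z) = Θ z := fun z => IsLocalization.lift_eq hν z
  have hη'ψ : η'.comp ψ = η := by
    refine IsLocalization.ringHom_ext
      ((maximalIdeal A.carrier).comap (algebraMap B A.carrier)).primeCompl ?_
    ext b
    simp only [RingHom.comp_apply, hψ]
    exact (hη' _).trans (hΘ b)
  have hloc : IsLocalHom (η'.comp ψ) := hη'ψ ▸ inferInstance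
  have hψl : IsLocalHom ψ := isLocalHom_of_comp ψ η'
  let A' : LocalExt R₀ := ⟨L, ψ.comp A.φ⟩
  let : Algebra (B ⊗[P] E) A'.carrier := inferInstanceAs (Algebra (B ⊗[P] E) L)
  have hloc' : IsLocalHom A.φ := h.isLocalHom
  have hchart : IsEtaleChart A' B₀ (B ⊗[P] E) := by
    refine ⟨?_, Algebra.Etale.comp B₀ B (B ⊗[P] E), ?_, ?_⟩
    · exact RingHom.isLocalHom_comp ψ A.φ
    · ext x
      change μ (algebraMap B₀ B x) = ψ (A.φ (algebraMap B₀ R₀ x))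
      rw [← hψ]
      exact congrArg ψ (RingHom.congr_fun h.comp_eq x)
    · have : IsLocalization Q.primeCompl A'.carrier :=
        inferInstanceAs (IsLocalization Q.primeCompl L)
      exact IsLocalization.atPrime_comap_maximalIdeal Q.primeCompl
  refine ⟨A', ⟨B ⊗[P] E, _, _, _, hchart⟩, ψ, ⟨rfl, fun ι _ _ F hι => ?_⟩,
    (algebraMap (B ⊗[P] E) L).comp (Algebra.TensorProduct.includeRight : E →ₐ[P] _).toRingHom,
    ?_, fun b e hbe => ?_⟩
  · let := (A.φ.comp (algebraMap k R₀)).toAlgebra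
    let := (A'.φ.comp (algebraMap k R₀)).toAlgebra
    let : Algebra A.carrier A'.carrier := ψ.toAlgebra
    have : IsScalarTower k A.carrier A'.carrier := .of_algebraMap_eq fun _ => rfl
    have : IsLocalHom (algebraMap A.carrier A'.carrier) := hψl
    let : Algebra B A'.carrier := inferInstanceAs (Algebra B L)
    have : IsScalarTower B A.carrier A'.carrier := .of_algebraMap_eq fun b => (hψ b).symm
    have : IsScalarTower B (B ⊗[P] E) A'.carrier :=
      inferInstanceAs (IsScalarTower B (B ⊗[P] E) L)
    have : IsLocalization Q.primeCompl A'.carrier :=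
        inferInstanceAs (IsLocalization Q.primeCompl L)
    have : Algebra.FormallyEtale (B ⊗[P] E) A'.carrier := .of_isLocalization Q.primeCompl
    have : Algebra.FormallyEtale B A'.carrier := .comp B (B ⊗[P] E) A'.carrier
    have : Algebra.FormallyEtale B A.carrier := .of_isLocalization
      ((maximalIdeal A.carrier).comap (algebraMap B A.carrier)).primeCompl
    have : Algebra.FormallyEtale A.carrier A'.carrier := .of_restrictScalars (R := B)
    have : Algebra.EssFiniteType (B ⊗[P] E) A'.carrier := .of_isLocalization _ Q.primeCompl
    have : Algebra.EssFiniteType B A'.carrier := .comp B (B ⊗[P] E) A'.carrier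
    have : Algebra.EssFiniteType A.carrier A'.carrier := .of_comp B A.carrier A'.carrier
    exact (h.isAlgebraicSmoothLocalRing hR₀).exists_isMap hι F
  · ext p
    simp only [RingHom.comp_apply, hψ]
    change algebraMap (B ⊗[P] E) L (1 ⊗ₜ algebraMap P E p) =
      algebraMap (B ⊗[P] E) L (algebraMap P B p ⊗ₜ 1)
    have : (1 : B) ⊗ₜ[P] algebraMap P E p = algebraMap P B p ⊗ₜ[P] (1 : E) := by
      rw [Algebra.algebraMap_eq_smul_one, Algebra.algebraMap_eq_smul_one (A := B),
        TensorProduct.tmul_smul, TensorProduct.smul_tmul']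
    rw [this]
  · rw [mem_maximalIdeal, mem_nonunits_iff]
    intro hu
    refine (hu.map η').ne_zero ?_
    rw [map_sub, hψ]
    change η' (algebraMap (B ⊗[P] E) L (algebraMap B (B ⊗[P] E) b)) -
      η' (algebraMap (B ⊗[P] E) L (1 ⊗ₜ e)) = 0
    rw [hη', hη', hΘ, hbe, sub_eq_zero]
    have : Θ (1 ⊗ₜ e) = g₂ e := by
      refine (Algebra.TensorProduct.lift_tmul _ _ _ (1 : B) e).trans ?_
      rw [map_one, one_mul]
    exact this.symm

end IsEtaleChart

end Charts

section EtaleClass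

open IsLocalRing TensorProduct

/-- A derivation which vanishes on the image of `P` vanishes on the image of any unramified
`P`-algebra. -/
theorem Derivation.apply_eq_zero_of_formallyUnramified {P E R : Type*} [CommRing P] [CommRing E]
    [CommRing R] [Algebra P E] [Algebra.FormallyUnramified P E] (τ : E →+* R)
    (D : Derivation ℤ R R) (h : ∀ p, D (τ (algebraMap P E p)) = 0) (e : E) : D (τ e) = 0 := by
  let := τ.toAlgebra
  let := (τ.comp (algebraMap P E)).toAlgebra
  have : IsScalarTower P E R := .of_algebraMap_eq fun _ => rfl
  let D' : Derivation P E R := Derivation.mk'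
    { toFun := fun e => D (τ e)
      map_add' := by simp
      map_smul' := fun p e => by
        rw [Algebra.smul_def, map_mul, Derivation.leibniz, h, smul_zero, add_zero, smul_eq_mul,
          RingHom.id_apply, Algebra.smul_def]
        rfl }
    (fun a b => by
      change D (τ (a * b)) = a • D (τ b) + b • D (τ a)
      rw [map_mul, Derivation.leibniz, Algebra.smul_def, Algebra.smul_def]
      rfl)
  have h1 := D'.liftKaehlerDifferential_comp_D e
  rw [Subsingleton.elim (KaehlerDifferential.D P E e) 0, map_zero] at h1
  exact h1.symm

variable {k B₀ R₀ : Type u} [Field k] [CharZero k] [CommRing B₀] [CommRing R₀] [IsLocalRing R₀]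
  [Algebra k B₀] [Algebra k R₀] [Algebra B₀ R₀] [IsScalarTower k B₀ R₀]
  [Algebra.FormallyUnramified B₀ R₀] {n : ℕ}

namespace IsEtaleChart

variable {A : LocalExt R₀} {B : Type u} [CommRing B] [Algebra B₀ B] [Algebra B A.carrier]

omit [CharZero k] [IsLocalRing R₀] [Algebra.FormallyUnramified B₀ R₀] in
theorem algebraMap_const (h : IsEtaleChart A B₀ B) (t : k) :
    algebraMap B A.carrier (algebraMap B₀ B (algebraMap k B₀ t)) = A.φ (algebraMap k R₀ t) := by
  rw [IsScalarTower.algebraMap_apply k B₀ R₀]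
  exact RingHom.congr_fun h.comp_eq _

/-- Near a given point, a system of coordinates is an étale map to affine space. -/
theorem exists_etale_mvPolynomial [Algebra.FiniteType k B₀] (h : IsEtaleChart A B₀ B)
    (hR₀ : IsAlgebraicSmoothLocalRing k R₀ n) {ι : Type} [Fintype ι] [DecidableEq ι]
    (F : Frame (A.φ.comp (algebraMap k R₀)) ι) (f : A.carrier) :
    ∃ (B' : Type u) (_ : CommRing B') (_ : Algebra B₀ B') (_ : Algebra B' A.carrier)
      (_ : Algebra (MvPolynomial ι k) B'), IsEtaleChart A B₀ B' ∧
      Algebra.Etale (MvPolynomial ι k) B' ∧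
      (∀ t, algebraMap (MvPolynomial ι k) B' (MvPolynomial.C t) =
        algebraMap B₀ B' (algebraMap k B₀ t)) ∧
      (∀ i, algebraMap B' A.carrier (algebraMap (MvPolynomial ι k) B' (MvPolynomial.X i)) =
        F.x i) ∧
      ∃ f' : B', algebraMap B' A.carrier f' = f := by
  obtain ⟨B, _, _, _, h, f', hf'⟩ := h.exists_mem_range (fun o : Option ι => o.elim f F.x)
  let P := MvPolynomial ι k
  let : Algebra k B := ((algebraMap B₀ B).comp (algebraMap k B₀)).toAlgebra
  let : Algebra P B := (MvPolynomial.aeval fun i => f' (some i)).toAlgebra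
  have hX : ∀ i, algebraMap P B (MvPolynomial.X i) = f' (some i) := fun i =>
    MvPolynomial.aeval_X _ i
  have hC : ∀ t, algebraMap P B (MvPolynomial.C t) = algebraMap k B t := fun t =>
    MvPolynomial.aeval_C _ t
  let : Algebra k A.carrier := (A.φ.comp (algebraMap k R₀)).toAlgebra
  let : Algebra P A.carrier := ((algebraMap B A.carrier).comp (algebraMap P B)).toAlgebra
  have : IsScalarTower k P A.carrier := .of_algebraMap_eq fun t => by
    change _ = algebraMap B A.carrier (algebraMap P B (MvPolynomial.C t))
    rw [hC]
    exact (h.algebraMap_const t).symm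
  have : IsScalarTower P B A.carrier := .of_algebraMap_eq fun _ => rfl
  have hA := h.isAlgebraicSmoothLocalRing hR₀
  have : Algebra.FormallyEtale P A.carrier :=
    Frame.formallyEtale_mvPolynomial hA F fun i => by
      change algebraMap B A.carrier (algebraMap P B (MvPolynomial.X i)) = _
      rw [hX, hf']
      rfl
  have := h.etale
  have := h.isLocalization
  have : IsScalarTower k P B := .of_algebraMap_eq fun t => (hC t).symm
  have : IsScalarTower k B₀ B := .of_algebraMap_eq fun t => rfl
  have : Algebra.FiniteType k B := .trans (S := B₀) ‹_› inferInstance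
  have : Algebra.FiniteType P B := .of_restrictScalars_finiteType k P B
  have : Algebra.FinitePresentation P B := Algebra.FinitePresentation.of_finiteType.1 this
  let q := (maximalIdeal A.carrier).comap (algebraMap B A.carrier)
  let e : A.carrier ≃ₐ[P] Localization.AtPrime q :=
    (IsLocalization.algEquiv q.primeCompl A.carrier (Localization.AtPrime q)).restrictScalars P
  have : Algebra.IsEtaleAt P q := .of_equiv e
  obtain ⟨g, hgq, hg⟩ := Algebra.exists_etale_of_isEtaleAt (R := P) q
  have hgu : IsUnit (algebraMap B A.carrier g) :=
    IsLocalization.map_units A.carrier (⟨g, hgq⟩ : q.primeCompl)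
  let := (IsLocalization.Away.lift (S := Localization.Away g) g hgu).toAlgebra
  obtain ⟨htower, hchart⟩ := h.away hgu
  refine ⟨Localization.Away g, inferInstance, inferInstance, inferInstance, inferInstance, hchart,
    hg, fun t => ?_, fun i => ?_, algebraMap B _ (f' none), ?_⟩
  · rw [IsScalarTower.algebraMap_apply P B (Localization.Away g), hC,
      IsScalarTower.algebraMap_apply B₀ B (Localization.Away g)]
    rfl
  · rw [IsScalarTower.algebraMap_apply P B (Localization.Away g), hX,
      ← IsScalarTower.algebraMap_apply B (Localization.Away g) A.carrier, hf']
    rfl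
  · rw [← IsScalarTower.algebraMap_apply B (Localization.Away g) A.carrier, hf']
    rfl

end IsEtaleChart

omit [Algebra.FormallyUnramified B₀ R₀] in
theorem isEtaleLocal_id {p : Ideal B₀} [p.IsPrime] [IsLocalization.AtPrime R₀ p] :
    IsEtaleLocal B₀ (⟨R₀, RingHom.id R₀⟩ : LocalExt R₀) := by
  refine ⟨B₀, inferInstance, inferInstance, ‹Algebra B₀ R₀›, ⟨inferInstanceAs (IsLocalHom (RingHom.id R₀)),
    inferInstance, rfl, ?_⟩⟩
  exact IsLocalization.atPrime_comap_maximalIdeal (A := R₀) p.primeCompl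

/-- The local rings of étale neighbourhoods of a closed point of a smooth algebraic variety over a
field of characteristic zero. -/
theorem IsAlgebraicSmoothLocalRing.isEtaleClass [Algebra.FiniteType k B₀]
    (hR₀ : IsAlgebraicSmoothLocalRing k R₀ n) :
    IsEtaleClass (algebraMap k R₀) n (IsEtaleLocal (R₀ := R₀) B₀) := by
  refine ⟨?_, ?_, ?_, ?_⟩
  · rintro A ⟨B, _, _, _, h⟩
    let := (A.φ.comp (algebraMap k R₀)).toAlgebra
    exact (h.isAlgebraicSmoothLocalRing hR₀).isSmoothLocalRing
  · rintro A ⟨B, _, _, _, h⟩ f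
    obtain ⟨B, _, _, _, h, f', hf'⟩ := h.exists_mem_range (fun _ : Unit => f)
    let := (A.φ.comp (algebraMap k R₀)).toAlgebra
    have hA := h.isAlgebraicSmoothLocalRing hR₀
    have := hA.isAlgebraic
    let K := ResidueField A.carrier
    have hint : IsIntegral k (residue A.carrier f) :=
      (Algebra.IsAlgebraic.isAlgebraic (R := k) (residue A.carrier f)).isIntegral
    let E := IntermediateField.adjoin k {residue A.carrier f}
    have : FiniteDimensional k E := IntermediateField.adjoin.finiteDimensional hint
    have : Algebra.FormallyEtale k E := .of_isSeparable k E
    have : Algebra.FinitePresentation k E := Algebra.FinitePresentation.of_finiteType.1 inferInstance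
    have : Algebra.Etale k E := ⟨inferInstance, inferInstance⟩
    obtain ⟨A', hA', ψ, hψ, τ, hτ, hm⟩ := h.exists_extends hR₀ (E := E)
      ((algebraMap B₀ B).comp (algebraMap k B₀)) (residue A.carrier) (algebraMap E K) (by
        ext t
        simp only [RingHom.comp_apply, h.algebraMap_const]
        rfl)
    refine ⟨A', hA', ψ, hψ, τ ⟨_, IntermediateField.mem_adjoin_simple_self k (residue A.carrier f)⟩,
      ?_, fun D hD => ?_⟩
    · have := hm (f' ()) ⟨_, IntermediateField.mem_adjoin_simple_self k (residue A.carrier f)⟩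
        (by rw [hf' ()]; rfl)
      simpa only [hf' ()] using this
    · refine D.apply_eq_zero_of_formallyUnramified (P := k) τ (fun t => ?_) _
      rw [← RingHom.comp_apply, hτ]
      simp only [RingHom.comp_apply, h.algebraMap_const]
      have e : ψ (A.φ (algebraMap k R₀ t)) = A'.φ (algebraMap k R₀ t) :=
        RingHom.congr_fun hψ.comp_eq _
      rw [e]
      exact hD t
  · rintro A ⟨B, _, _, _, h⟩ f hf d hd
    obtain ⟨B, _, _, _, h, f', hf'⟩ := h.exists_mem_range (fun _ : Unit => f)
    let : Algebra k B := ((algebraMap B₀ B).comp (algebraMap k B₀)).toAlgebra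
    let SP : StandardEtalePair B :=
      { f := Polynomial.X ^ d - Polynomial.C (f' ())
        monic_f := Polynomial.monic_X_pow_sub_C _ hd
        g := Polynomial.X
        cond := ⟨Polynomial.C (algebraMap k B (d : k)⁻¹), 0, d - 1, by
          have h1 : (d : Polynomial B) * Polynomial.C (algebraMap k B (d : k)⁻¹) = 1 := by
            rw [← Polynomial.C_eq_natCast, ← Polynomial.C_mul, ← map_natCast (algebraMap k B),
              ← map_mul, mul_inv_cancel₀ (by exact_mod_cast hd), map_one, map_one]
          simp only [Polynomial.derivative_sub, Polynomial.derivative_X_pow, Polynomial.derivative_C,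
            sub_zero, mul_zero, add_zero, Polynomial.C_eq_natCast]
          linear_combination (Polynomial.X ^ (d - 1)) * h1⟩ }
    let := ((residue A.carrier).comp (algebraMap B A.carrier)).toAlgebra
    have hmap : SP.HasMap (1 : ResidueField A.carrier) := by
      constructor
      · have : residue A.carrier f = 1 := by
          rw [← sub_eq_zero, ← map_one (residue A.carrier), ← map_sub, residue_eq_zero_iff]
          exact hf
        simp only [SP, map_sub, map_pow, Polynomial.aeval_X, Polynomial.aeval_C, one_pow]
        change 1 - residue A.carrier (algebraMap B A.carrier (f' ())) = 0
        rw [hf', this, sub_self]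
      · simp [SP]
    obtain ⟨A', hA', ψ, hψ, τ, hτ, -⟩ := h.exists_extends hR₀ (P := B) (E := SP.Ring)
      (RingHom.id B) (residue A.carrier) (SP.lift 1 hmap).toRingHom (by
        ext b
        exact (SP.lift 1 hmap).commutes b)
    refine ⟨A', hA', ψ, hψ, τ SP.X, ?_⟩
    have h1 : SP.X ^ d = algebraMap B SP.Ring (f' ()) := by
      have := (StandardEtalePair.hasMap_X (P := SP)).1
      simpa [SP, sub_eq_zero] using this
    rw [← map_pow, h1, ← RingHom.comp_apply, hτ]
    simp [hf']
  · rintro A ⟨B, _, _, _, h⟩ ι _ _ F hι i f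
    obtain ⟨B, _, _, _, _, h, hP, hC, hX, f', hf'⟩ := h.exists_etale_mvPolynomial hR₀ F f
    -- the composition of the coordinates with the projection along the `i`-th axis
    let ρ : MvPolynomial ι k →+* B := MvPolynomial.eval₂Hom ((algebraMap B₀ B).comp (algebraMap k B₀))
      fun j => if j = i then 0 else algebraMap (MvPolynomial ι k) B (MvPolynomial.X j)
    have hρC : ∀ t, ρ (MvPolynomial.C t) = algebraMap B₀ B (algebraMap k B₀ t) := fun t =>
      MvPolynomial.eval₂Hom_C _ _ t
    have hρX : ∀ j, ρ (MvPolynomial.X j) =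
        if j = i then 0 else algebraMap (MvPolynomial ι k) B (MvPolynomial.X j) := fun t =>
      MvPolynomial.eval₂Hom_X' _ _ t
    obtain ⟨A', hA', ψ, hψ, τ, hτ, hm⟩ := h.exists_extends hR₀ (E := B) ρ (residue A.carrier)
      ((residue A.carrier).comp (algebraMap B A.carrier)) (by
        refine MvPolynomial.ringHom_ext (fun t => ?_) fun j => ?_
        · simp only [RingHom.comp_apply, hC, hρC]
        · have h0 : ∀ j, residue A.carrier (F.x j) = 0 := fun j => by
            rw [residue_eq_zero_iff]; exact F.x_mem j
          simp only [RingHom.comp_apply, hX, hρX, h0]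
          split_ifs
          · simp
          · rw [hX, h0])
    refine ⟨A', hA', ψ, hψ, τ f', fun F' hF' => ⟨?_, ?_⟩⟩
    · refine (F'.d i).apply_eq_zero_of_formallyUnramified (P := MvPolynomial ι k) τ (fun p => ?_) _
      rw [← RingHom.comp_apply, hτ]
      induction p using MvPolynomial.induction_on with
      | C t =>
        simp only [RingHom.comp_apply, hρC, h.algebraMap_const]
        have e : ψ (A.φ (algebraMap k R₀ t)) = A'.φ (algebraMap k R₀ t) :=
          RingHom.congr_fun hψ.comp_eq _
        rw [e]
        exact F'.d_const i t
      | add p q hp hq => rw [map_add, map_add, hp, hq, add_zero]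
      | mul_X p j hp =>
        rw [map_mul, Derivation.leibniz, hp, smul_zero, add_zero]
        have : F'.d i ((ψ.comp ((algebraMap B A.carrier).comp ρ)) (MvPolynomial.X j)) = 0 := by
          simp only [RingHom.comp_apply, hρX]
          split_ifs with hj
          · simp
          · rw [hX, ← hF'.map_x, F'.d_of_ne (Ne.symm hj)]
        rw [this, smul_zero]
    · obtain ⟨B', _, _, _, h'⟩ := hA'
      let := (A'.φ.comp (algebraMap k R₀)).toAlgebra
      have := (h'.isAlgebraicSmoothLocalRing hR₀).isNoetherianRing
      let Q := A'.carrier ⧸ Ideal.span {F'.x i}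
      have hle : Ideal.span {F'.x i} ≤ maximalIdeal A'.carrier :=
        (Ideal.span_singleton_le_iff_mem _).2 (F'.x_mem i)
      have : Nontrivial Q := Ideal.Quotient.nontrivial_iff.2
        (ne_top_of_le_ne_top (maximalIdeal.isMaximal A'.carrier).ne_top hle)
      have : IsLocalRing Q := .of_surjective' (Ideal.Quotient.mk _) Ideal.Quotient.mk_surjective
      let π : A'.carrier →+* Q := Ideal.Quotient.mk _
      have hπ : π (F'.x i) = 0 := Ideal.Quotient.mk_singleton_self _
      let : Algebra (MvPolynomial ι k) Q := (π.comp (τ.comp (algebraMap _ B))).toAlgebra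
      let g₂ : B →ₐ[MvPolynomial ι k] Q := { π.comp τ with commutes' := fun _ => rfl }
      let g₁ : B →ₐ[MvPolynomial ι k] Q :=
        { π.comp (ψ.comp (algebraMap B A.carrier)) with
          commutes' := fun p => by
            change (π.comp (ψ.comp (algebraMap B A.carrier))).comp (algebraMap _ B) p =
              (π.comp (τ.comp (algebraMap _ B))) p
            rw [hτ]
            congr 1
            refine MvPolynomial.ringHom_ext (fun t => ?_) fun j => ?_
            · simp only [RingHom.comp_apply, hC, hρC]
            · simp only [RingHom.comp_apply, hρX]
              split_ifs with hj
              · rw [hX, ← hF'.map_x, hj, hπ]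
                simp
              · rfl }
      have hI := Ideal.iInf_pow_eq_bot_of_isLocalRing (maximalIdeal Q) (maximalIdeal.isMaximal Q).ne_top
      have hg : g₁ = g₂ := by
        refine Algebra.FormallyUnramified.ext_of_iInf (maximalIdeal Q) hI fun b => ?_
        rw [Ideal.Quotient.eq]
        change π (ψ (algebraMap B A.carrier b)) - π (τ b) ∈ maximalIdeal Q
        rw [← map_sub, mem_maximalIdeal, mem_nonunits_iff]
        have hloc : IsLocalHom π := .of_surjective π Ideal.Quotient.mk_surjective
        intro hu
        exact (mem_maximalIdeal _).1 (hm b b rfl) (isUnit_of_map_unit π _ hu)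
      rw [← Ideal.mem_span_singleton, ← Ideal.Quotient.eq_zero_iff_mem, map_sub, sub_eq_zero, ← hf']
      exact AlgHom.congr_fun hg f'

end EtaleClass

/-! ### Division of analytic functions by a coordinate -/

section Division

open Filter
open scoped NNReal ENNReal

variable {𝕜 E F : Type*} [NontriviallyNormedField 𝕜] [NormedAddCommGroup E] [NormedSpace 𝕜 E]
  [NormedAddCommGroup F] [NormedSpace 𝕜 F]

/-- The power series of `(f(x) - f(π x)) / ℓ(x)`, where `p` is that of `f`, and
`x = π x + ℓ(x) e` for all `x`. -/
noncomputable def FormalMultilinearSeries.divLinear (p : FormalMultilinearSeries 𝕜 E F)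
    (π : E →L[𝕜] E) (e : E) : FormalMultilinearSeries 𝕜 E F := fun m =>
  ∑ i : Fin (m + 1), ((p (m + 1)).curryMid i e).compContinuousLinearMap
    fun j => if i.succAbove j < i then ContinuousLinearMap.id 𝕜 E else π

theorem FormalMultilinearSeries.norm_divLinear_le (p : FormalMultilinearSeries 𝕜 E F)
    {π : E →L[𝕜] E} (hπ : ‖π‖ ≤ 1) (e : E) (m : ℕ) :
    ‖p.divLinear π e m‖ ≤ (m + 1) * (‖p (m + 1)‖ * ‖e‖) := by
  have h : ∀ i : Fin (m + 1), ‖((p (m + 1)).curryMid i e).compContinuousLinearMap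
      fun j => if i.succAbove j < i then ContinuousLinearMap.id 𝕜 E else π‖ ≤
        ‖p (m + 1)‖ * ‖e‖ := fun i => by
    refine (ContinuousMultilinearMap.norm_compContinuousLinearMap_le _ _).trans ?_
    have h1 : ‖(p (m + 1)).curryMid i e‖ ≤ ‖p (m + 1)‖ * ‖e‖ := by
      refine ((ContinuousMultilinearMap.curryMid i (p (m + 1))).le_opNorm e).trans
        (mul_le_mul_of_nonneg_right ?_ (norm_nonneg _))
      exact ((ContinuousMultilinearMap.curryMidEquiv 𝕜 (fun _ => E) F i).norm_map _).le
    refine (mul_le_mul_of_nonneg_left (Finset.prod_le_one (fun _ _ => norm_nonneg _) fun j _ => ?_)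
      (norm_nonneg _)).trans (by rw [mul_one]; exact h1)
    split_ifs
    · exact ContinuousLinearMap.norm_id_le
    · exact hπ
  refine (norm_sum_le _ _).trans ((Finset.sum_le_sum fun i _ => h i).trans ?_)
  simp

theorem FormalMultilinearSeries.smul_divLinear (p : FormalMultilinearSeries 𝕜 E F)
    {π : E →L[𝕜] E} {ℓ : E → 𝕜} {e : E} (h : ∀ x, x = π x + ℓ x • e) (m : ℕ) (x : E) :
    ℓ x • p.divLinear π e m (fun _ => x) = p (m + 1) (fun _ => x) - p (m + 1) fun _ => π x := by
  have key := (p (m + 1)).toMultilinearMap.map_sub_map_piecewise (fun _ => x) (fun _ => π x)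
    Finset.univ
  rw [Finset.piecewise_univ] at key
  change p (m + 1) (fun _ => x) - p (m + 1) (fun _ => π x) = _ at key
  rw [key, FormalMultilinearSeries.divLinear, _root_.sum_apply, Finset.smul_sum]
  refine Finset.sum_congr rfl fun i _ => ?_
  rw [ContinuousMultilinearMap.compContinuousLinearMap_apply,
    ContinuousMultilinearMap.curryMid_apply]
  change _ = p (m + 1) _
  have e1 : (fun j => if j ∈ Finset.univ → j < i then x else if i = j then x - π x else π x) =
      Function.update (i.insertNth e fun j => (if i.succAbove j < i then
        ContinuousLinearMap.id 𝕜 E else π) x : Fin (m + 1) → E) i (ℓ x • e) := by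
    funext j
    rcases eq_or_ne j i with rfl | hj
    · rw [Function.update_self]
      simp only [Finset.mem_univ, lt_irrefl, imp_false, not_true, if_false, if_true]
      rw [sub_eq_iff_eq_add, add_comm]
      exact h x
    · rw [Function.update_of_ne hj]
      obtain ⟨j, rfl⟩ := Fin.exists_succAbove_eq hj
      rw [Fin.insertNth_apply_succAbove]
      simp only [Finset.mem_univ, forall_const, (Fin.succAbove_ne i j).symm, if_false]
      split_ifs <;> rfl
  rw [e1, ContinuousMultilinearMap.map_update_smul]
  congr 2
  rw [Function.eq_update_iff]
  exact ⟨by simp, fun _ _ => rfl⟩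

theorem AnalyticAt.exists_sub_eq_smul [CompleteSpace F] {f : E → F} (hf : AnalyticAt 𝕜 f 0)
    {π : E →L[𝕜] E} (hπ : ‖π‖ ≤ 1) {ℓ : E → 𝕜} {e : E} (h : ∀ x, x = π x + ℓ x • e) :
    ∃ q : E → F, AnalyticAt 𝕜 q 0 ∧ ∀ᶠ x in 𝓝 0, f x - f (π x) = ℓ x • q x := by
  obtain ⟨p, ρ, hp⟩ := hf
  obtain ⟨r, hr0, hr⟩ := ENNReal.lt_iff_exists_nnreal_btwn.1 hp.r_pos
  have hr0' : 0 < r := by exact_mod_cast hr0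
  obtain ⟨C, hC, hpC⟩ := p.norm_mul_pow_le_of_lt_radius (hr.trans_le hp.r_le)
  set Q := p.divLinear π e
  have hQ : ((r / 2 : ℝ≥0) : ℝ≥0∞) ≤ Q.radius := by
    refine Q.le_radius_of_bound (C / r * ‖e‖) fun m => ?_
    have h2 : ((m : ℝ) + 1) ≤ 2 ^ m := by exact_mod_cast Nat.lt_two_pow_self (n := m)
    have hr' : (0 : ℝ) < r := hr0'
    calc ‖Q m‖ * ((r / 2 : ℝ≥0) : ℝ) ^ m
        ≤ ((m + 1) * (‖p (m + 1)‖ * ‖e‖)) * ((r / 2 : ℝ≥0) : ℝ) ^ m := by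
          gcongr
          exact p.norm_divLinear_le hπ e m
      _ = ((m + 1) / 2 ^ m) * ((‖p (m + 1)‖ * (r : ℝ) ^ (m + 1)) / r * ‖e‖) := by
          push_cast
          rw [div_pow, pow_succ]
          field_simp
      _ ≤ 1 * (C / r * ‖e‖) := by
          have h1 : ((m : ℝ) + 1) / 2 ^ m ≤ 1 := (div_le_one (by positivity)).2 h2
          have h3 := hpC (m + 1)
          gcongr
      _ = _ := one_mul _
  have hQ0 : 0 < Q.radius := lt_of_lt_of_le (by positivity) hQ
  refine ⟨Q.sum, (Q.hasFPowerSeriesOnBall hQ0).analyticAt, ?_⟩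
  filter_upwards [Metric.eball_mem_nhds (0 : E) hp.r_pos, Metric.eball_mem_nhds (0 : E) hQ0] with x h1 h2
  have h3 : π x ∈ Metric.eball (0 : E) ρ := by
    rw [Metric.mem_eball, edist_zero_right] at h1 ⊢
    refine lt_of_le_of_lt ?_ h1
    rw [← ofReal_norm, ← ofReal_norm]
    exact ENNReal.ofReal_le_ofReal ((π.le_opNorm x).trans (by
      simpa using mul_le_mul_of_nonneg_right hπ (norm_nonneg x)))
  have s1 := hp.hasSum h1
  have s2 := hp.hasSum h3
  have s3 := ((Q.hasFPowerSeriesOnBall hQ0).hasSum h2).const_smul (ℓ x)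
  simp only [zero_add] at s1 s2 s3
  have s4 := s1.sub s2
  rw [hasSum_nat_add_iff' 1 |>.symm] at s4
  simp only [Finset.range_one, Finset.sum_singleton] at s4
  have e0 : p 0 (fun _ => x) - p 0 (fun _ => π x) = 0 := by
    rw [sub_eq_zero]
    congr 1
    ext j
    exact j.elim0
  rw [e0, sub_zero] at s4
  refine s4.unique (s3.congr_fun ?_)
  intro m
  exact (p.smul_divLinear h m x).symm

end Division

section Identity

open Filter ContinuousMultilinearMap Asymptotics

variable {𝕜 E F : Type*} [NontriviallyNormedField 𝕜] [NormedAddCommGroup E] [NormedSpace 𝕜 E]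
  [NormedAddCommGroup F] [NormedSpace 𝕜 F]

/-- An analytic function which vanishes to infinite order at `0` vanishes near `0`. -/
theorem AnalyticAt.eventually_eq_zero_of_isBigO {f : E → F} (hf : AnalyticAt 𝕜 f 0)
    (h : ∀ N : ℕ, f =O[𝓝 0] fun y => ‖y‖ ^ N) : ∀ᶠ y in 𝓝 0, f y = 0 := by
  obtain ⟨p, ρ, hp⟩ := hf
  have hp0 : ∀ m (y : E), p m (fun _ => y) = 0 := by
    intro m
    induction m using Nat.strong_induction_on with
    | _ m ih =>
      refine IsBigO.continuousMultilinearMap_apply_eq_zero ?_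
      have h1 := hp.hasFPowerSeriesAt.isBigO_sub_partialSum_pow (m + 1)
      refine ((h (m + 1)).sub h1).congr_left fun y => ?_
      simp only [zero_add, FormalMultilinearSeries.partialSum, sub_sub_cancel]
      rw [Finset.sum_range_succ, Finset.sum_eq_zero fun i hi => ih i (Finset.mem_range.1 hi) y,
        zero_add]
  filter_upwards [Metric.eball_mem_nhds (0 : E) hp.r_pos] with y hy
  have := hp.hasSum hy
  simp only [hp0, zero_add] at this
  exact this.unique hasSum_zero

theorem AnalyticAt.eventually_eq_zero_or_of_mul_eq_zero {𝕜 E : Type*} [RCLike 𝕜]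
    [NormedAddCommGroup E] [NormedSpace 𝕜 E] {f g : E → 𝕜} {x : E} (hf : AnalyticAt 𝕜 f x)
    (hg : AnalyticAt 𝕜 g x) (h : ∀ᶠ y in 𝓝 x, f y * g y = 0) :
    (∀ᶠ y in 𝓝 x, f y = 0) ∨ ∀ᶠ y in 𝓝 x, g y = 0 := by
  obtain ⟨ε, hε, hball⟩ := Metric.eventually_nhds_iff_ball.1
    (hf.eventually_analyticAt.and (hg.eventually_analyticAt.and h))
  by_cases hg0 : ∀ y ∈ Metric.ball x ε, g y = 0
  · exact .inr (eventually_of_mem (Metric.ball_mem_nhds x hε) hg0)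
  · push Not at hg0
    obtain ⟨y, hy, hgy⟩ := hg0
    left
    have hfy : f =ᶠ[𝓝 y] 0 := by
      filter_upwards [(hball y hy).2.1.continuousAt.eventually_ne hgy,
        Metric.isOpen_ball.mem_nhds hy] with z hz hzb
      exact (mul_eq_zero.1 (hball z hzb).2.2).resolve_right hz
    have hpre : IsPreconnected (Metric.ball x ε) := by
      let : NormedSpace ℝ E := NormedSpace.restrictScalars ℝ 𝕜 E
      exact (convex_ball x ε).isPreconnected
    have := AnalyticOnNhd.eqOn_zero_of_preconnected_of_eventuallyEq_zero
      (f := f) (𝕜 := 𝕜) (fun z hz => (hball z hz).1) hpre hy hfy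
    exact eventually_of_mem (Metric.ball_mem_nhds x hε) this

end Identity

/-! ### Local rings of analytic manifolds -/

section GermChart

open Filter IsLocalRing

variable {𝕜 : Type u} [RCLike 𝕜] {R : Type u} [CommRing R] {c : 𝕜 →+* R} {E : Type u}
  [NormedAddCommGroup E] [NormedSpace 𝕜 E] {p : E} {T : R →+* Germ (𝓝 p) 𝕜}

/-- The homomorphism `T` identifies the ring `R`, with constants `c`, with the ring of germs at `p`
of analytic functions. -/
structure IsGermChart (c : 𝕜 →+* R) (p : E) (T : R →+* Germ (𝓝 p) 𝕜) : Prop where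
  injective : Function.Injective T
  mem_range_iff : ∀ f : E → 𝕜, (∃ g, T g = (f : Germ (𝓝 p) 𝕜)) ↔ AnalyticAt 𝕜 f p
  map_const : ∀ t, T (c t) = ((fun _ => t : E → 𝕜) : Germ (𝓝 p) 𝕜)

/-- The directional derivative of germs of functions. -/
noncomputable def germDeriv (w : E) : Germ (𝓝 p) 𝕜 → Germ (𝓝 p) 𝕜 :=
  Germ.map' (fun f y => fderiv 𝕜 f y w) fun _ _ h => h.fderiv.fun_comp fun L => L w

/-- Composition of germs of functions with a continuous map. -/
def germComp {E' : Type u} [NormedAddCommGroup E'] {p' : E'} (g : E' → E)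
    (hg : Tendsto g (𝓝 p') (𝓝 p)) : Germ (𝓝 p) 𝕜 →+* Germ (𝓝 p') 𝕜 where
  toFun f := f.compTendsto g hg
  map_one' := rfl
  map_zero' := rfl
  map_mul' f₁ f₂ := Germ.inductionOn₂ f₁ f₂ fun _ _ => rfl
  map_add' f₁ f₂ := Germ.inductionOn₂ f₁ f₂ fun _ _ => rfl

namespace IsGermChart

theorem exists_rep (h : IsGermChart c p T) (f : R) :
    ∃ F : E → 𝕜, AnalyticAt 𝕜 F p ∧ T f = (F : Germ (𝓝 p) 𝕜) := by
  obtain ⟨F, hF⟩ : ∃ F : E → 𝕜, T f = (F : Germ (𝓝 p) 𝕜) :=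
    Germ.inductionOn (T f) fun F => ⟨F, rfl⟩
  exact ⟨F, (h.mem_range_iff F).1 ⟨f, hF⟩, hF⟩

theorem exists_map_eq (h : IsGermChart c p T) {F : E → 𝕜} (hF : AnalyticAt 𝕜 F p) :
    ∃ f, T f = (F : Germ (𝓝 p) 𝕜) :=
  (h.mem_range_iff F).2 hF

theorem comp_equiv {R' : Type u} [CommRing R'] (h : IsGermChart c p T) (e : R' ≃+* R)
    {c' : 𝕜 →+* R'} (hc : ∀ t, e (c' t) = c t) : IsGermChart c' p (T.comp (e : R' →+* R)) :=
  ⟨h.injective.comp e.injective, fun f => by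
    rw [← h.mem_range_iff]
    exact ⟨fun ⟨g, hg⟩ => ⟨e g, hg⟩, fun ⟨g, hg⟩ => ⟨e.symm g, by simpa using hg⟩⟩,
    fun t => by simp [hc, h.map_const]⟩

theorem isUnit_iff (h : IsGermChart c p T) {f : R} {F : E → 𝕜} (hF : T f = (F : Germ (𝓝 p) 𝕜)) :
    IsUnit f ↔ F p ≠ 0 := by
  have hFa := (h.mem_range_iff F).1 ⟨f, hF⟩
  constructor
  · rintro ⟨w, rfl⟩ h0
    obtain ⟨G, hG, e⟩ := h.exists_rep (↑w⁻¹ : R)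
    have : ((F * G : E → 𝕜) : Germ (𝓝 p) 𝕜) = ((1 : E → 𝕜) : Germ (𝓝 p) 𝕜) := by
      rw [Germ.coe_mul, ← hF, ← e, ← map_mul, Units.mul_inv, map_one]; rfl
    have := (Germ.coe_eq.1 this).self_of_nhds
    simp [h0] at this
  · intro h0
    obtain ⟨g, hg⟩ := h.exists_map_eq (hFa.inv h0)
    refine IsUnit.of_mul_eq_one g (h.injective ?_)
    rw [map_mul, hF, hg, map_one, ← Germ.coe_mul]
    refine Germ.coe_eq.2 ?_
    filter_upwards [hFa.continuousAt.eventually_ne h0] with y hy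
    exact mul_inv_cancel₀ hy

variable [IsLocalRing R]

theorem mem_maximalIdeal_iff (h : IsGermChart c p T) {f : R} {F : E → 𝕜}
    (hF : T f = (F : Germ (𝓝 p) 𝕜)) : f ∈ maximalIdeal R ↔ F p = 0 := by
  rw [mem_maximalIdeal, mem_nonunits_iff, h.isUnit_iff hF, not_not]

theorem isDomain (h : IsGermChart c p T) : IsDomain R := by
  have : NoZeroDivisors R := ⟨fun {f g} hfg => by
    obtain ⟨F, hF, eF⟩ := h.exists_rep f
    obtain ⟨G, hG, eG⟩ := h.exists_rep g
    have e : ((F * G : E → 𝕜) : Germ (𝓝 p) 𝕜) = ((0 : E → 𝕜) : Germ (𝓝 p) 𝕜) := by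
      rw [Germ.coe_mul, ← eF, ← eG, ← map_mul, hfg, map_zero]; rfl
    refine (hF.eventually_eq_zero_or_of_mul_eq_zero hG (Germ.coe_eq.1 e)).imp (fun h0 => ?_)
      fun h0 => ?_
    · refine h.injective ?_
      rw [eF, map_zero]
      exact Germ.coe_eq.2 h0
    · refine h.injective ?_
      rw [eG, map_zero]
      exact Germ.coe_eq.2 h0⟩
  exact NoZeroDivisors.to_isDomain R

theorem eq_zero_of_forall_mem_pow {T : R →+* Germ (𝓝 (0 : E)) 𝕜} (h : IsGermChart c 0 T) {f : R}
    (hf : ∀ N : ℕ, f ∈ maximalIdeal R ^ N) : f = 0 := by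
  -- the functions vanishing to order `N` at `0`
  have key : ∀ N : ℕ, ∀ f ∈ maximalIdeal R ^ N, ∀ F : E → 𝕜, T f = (F : Germ (𝓝 (0 : E)) 𝕜) →
      F =O[𝓝 0] fun y => ‖y‖ ^ N := by
    intro N
    induction N with
    | zero =>
      intro f _ F hF
      simpa using ((h.mem_range_iff F).1 ⟨f, hF⟩).continuousAt.isBigO_one ℝ
    | succ N ih =>
      intro f hf
      rw [pow_succ] at hf
      refine Submodule.mul_induction_on hf (fun a ha b hb F hF => ?_) fun a b ha hb F hF => ?_
      · obtain ⟨A, hA, eA⟩ := h.exists_rep a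
        obtain ⟨B, hB, eB⟩ := h.exists_rep b
        have h1 : B =O[𝓝 0] fun y => ‖y‖ := by
          have := hB.differentiableAt.isBigO_sub
          simp only [(h.mem_maximalIdeal_iff eB).1 hb, sub_zero] at this
          exact this.norm_right
        rw [map_mul, eA, eB, ← Germ.coe_mul, Germ.coe_eq] at hF
        simp only [pow_succ]
        exact ((ih a ha A eA).mul h1).congr' hF .rfl
      · obtain ⟨A, hA, eA⟩ := h.exists_rep a
        obtain ⟨B, hB, eB⟩ := h.exists_rep b
        rw [map_add, eA, eB, ← Germ.coe_add, Germ.coe_eq] at hF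
        exact ((ha A eA).add (hb B eB)).congr' hF .rfl
  obtain ⟨F, hF, e⟩ := h.exists_rep f
  refine h.injective ?_
  rw [e, map_zero]
  exact Germ.coe_eq.2 (hF.eventually_eq_zero_of_isBigO fun N => key N f (hf N) F e)

omit [IsLocalRing R] in
theorem exists_chart_zero (h : IsGermChart c p T) :
    ∃ T' : R →+* Germ (𝓝 (0 : E)) 𝕜, IsGermChart c 0 T' := by
  have ht : Tendsto (fun y : E => y + p) (𝓝 0) (𝓝 p) := by
    simpa using (continuous_add_const p).tendsto (0 : E)
  have ht' : Tendsto (fun y : E => y - p) (𝓝 p) (𝓝 0) := by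
    have := (continuous_id.sub continuous_const : Continuous fun y : E => y - p).tendsto p
    rwa [show (id - fun _ => p : E → E) p = 0 from sub_self p] at this
  refine ⟨(germComp _ ht).comp T, ⟨fun f g hfg => ?_, fun f => ⟨?_, fun hf => ?_⟩, fun t => ?_⟩⟩
  · obtain ⟨F, -, eF⟩ := h.exists_rep f
    obtain ⟨G, -, eG⟩ := h.exists_rep g
    refine h.injective ?_
    rw [RingHom.comp_apply, RingHom.comp_apply, eF, eG] at hfg
    have hfg' : (fun y => F (y + p)) =ᶠ[𝓝 0] fun y => G (y + p) := Germ.coe_eq.1 hfg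
    rw [eF, eG, Germ.coe_eq]
    filter_upwards [ht'.eventually hfg'] with y hy
    simpa using hy
  · rintro ⟨g, hg⟩
    obtain ⟨G, hG, eG⟩ := h.exists_rep g
    rw [RingHom.comp_apply, eG] at hg
    have hg' : (fun y => G (y + p)) =ᶠ[𝓝 0] f := Germ.coe_eq.1 hg
    exact AnalyticAt.congr (AnalyticAt.comp_of_eq hG (analyticAt_id.add analyticAt_const)
      (zero_add p)) hg'
  · obtain ⟨g, hg⟩ := h.exists_map_eq (F := fun y => f (y - p))
      (AnalyticAt.comp_of_eq hf (analyticAt_id.sub analyticAt_const) (sub_self p))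
    refine ⟨g, ?_⟩
    rw [RingHom.comp_apply, hg]
    exact Germ.coe_eq.2 (.of_forall fun y => congrArg f (add_sub_cancel_right y p))
  · rw [RingHom.comp_apply, h.map_const]
    rfl

/-- Any generators of the maximal ideal, as many as the dimension, are the coordinates of a chart,
by the inverse function theorem. -/
theorem exists_chart [FiniteDimensional 𝕜 E] (h : IsGermChart c p T) {ι : Type} [Fintype ι]
    (hι : Fintype.card ι = Module.finrank 𝕜 E) (x : ι → R)
    (hx : maximalIdeal R = Ideal.span (Set.range x)) :
    ∃ (ψ : (ι → 𝕜) → E) (hψ : Tendsto ψ (𝓝 0) (𝓝 p)), IsGermChart c 0 ((germComp ψ hψ).comp T) ∧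
      ∀ i, (germComp ψ hψ).comp T (x i) =
        ((fun y => y i : (ι → 𝕜) → 𝕜) : Germ (𝓝 (0 : ι → 𝕜)) 𝕜) := by
  have : CompleteSpace E := FiniteDimensional.complete 𝕜 E
  choose X hX eX using fun i => h.exists_rep (x i)
  have hX0 : ∀ i, X i p = 0 := fun i => (h.mem_maximalIdeal_iff (eX i)).1
    (hx ▸ Ideal.subset_span ⟨i, rfl⟩)
  let Φ : E → ι → 𝕜 := fun y i => X i y
  have hΦ : AnalyticAt 𝕜 Φ p := analyticAt_pi_iff.2 hX
  have hΦ0 : Φ p = 0 := funext hX0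
  have hinj : Function.Injective (fderiv 𝕜 Φ p) := by
    refine (injective_iff_map_eq_zero _).2 fun w hw => ?_
    have hXw : ∀ i, fderiv 𝕜 (X i) p w = 0 := fun i => by
      rw [((hasFDerivAt_pi'.1 hΦ.differentiableAt.hasFDerivAt i).fderiv : fderiv 𝕜 (X i) p = _)]
      exact congrFun hw i
    by_contra hw0
    obtain ⟨ℓ, hℓ⟩ := exists_dual_vector 𝕜 w (norm_ne_zero_iff.2 hw0)
    have hℓw : ℓ w ≠ 0 := by
      rw [hℓ.2]
      simpa using hw0
    have hℓa : AnalyticAt 𝕜 (fun y => ℓ (y - p)) p :=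
      (ℓ.analyticAt _).comp (analyticAt_id.sub analyticAt_const)
    obtain ⟨f, hf⟩ := h.exists_map_eq hℓa
    have hfm : f ∈ Ideal.span (Set.range x) := by
      rw [← hx, h.mem_maximalIdeal_iff hf]; simp
    obtain ⟨a, ha⟩ := (Submodule.mem_span_range_iff_exists_fun R).1 hfm
    choose A hA eA using fun i => h.exists_rep (a i)
    have e1 : (fun y => ∑ i, A i y * X i y) =ᶠ[𝓝 p] fun y => ℓ (y - p) := by
      refine Germ.coe_eq.1 ?_
      rw [← hf, ← ha, map_sum]
      simp only [smul_eq_mul, map_mul, eA, eX]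
      rw [show (fun y => ∑ i, A i y * X i y) = ∑ i, A i * X i by ext y; simp]
      exact map_sum (Germ.coeRingHom (𝓝 p)) _ _
    have e2 := e1.fderiv_eq (𝕜 := 𝕜)
    have e3 : fderiv 𝕜 (fun y => ∑ i, A i y * X i y) p w = 0 := by
      have hs := HasFDerivAt.fun_sum (u := Finset.univ) fun i _ =>
        (hA i).differentiableAt.hasFDerivAt.mul (hX i).differentiableAt.hasFDerivAt
      have hs' : HasFDerivAt (fun y => ∑ i, A i y * X i y) _ p := hs
      rw [hs'.fderiv, _root_.sum_apply]
      exact Finset.sum_eq_zero fun i _ => by simp [hXw, hX0]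
    have e4 : HasFDerivAt (fun y => ℓ (y - p)) ℓ p := by
      simp only [map_sub]
      exact ℓ.hasFDerivAt.sub_const _
    rw [e2, e4.fderiv] at e3
    exact hℓw e3
  let L : E ≃L[𝕜] (ι → 𝕜) := (LinearEquiv.ofInjectiveOfFinrankEq
    (fderiv 𝕜 Φ p : E →ₗ[𝕜] (ι → 𝕜)) hinj (by simp [hι])).toContinuousLinearEquiv
  have hL : fderiv 𝕜 Φ p = (L : E →L[𝕜] (ι → 𝕜)) := by ext; rfl
  have hs : HasStrictFDerivAt Φ (L : E →L[𝕜] (ι → 𝕜)) p := hL ▸ hΦ.hasStrictFDerivAt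
  let Φh := hs.toOpenPartialHomeomorph Φ
  have hp : p ∈ Φh.source := hs.mem_toOpenPartialHomeomorph_source
  have hsymm : AnalyticAt 𝕜 Φh.symm 0 := hΦ0 ▸ Φh.analyticAt_symm' (i := L) hp hΦ hL
  have hsymm0 : Φh.symm 0 = p := by
    rw [← hΦ0]; exact Φh.left_inv hp
  have ht : Tendsto Φh.symm (𝓝 0) (𝓝 p) := by
    simpa [ContinuousAt, hsymm0] using hsymm.continuousAt
  have ht' : Tendsto Φ (𝓝 p) (𝓝 0) := by
    simpa [ContinuousAt, hΦ0] using hΦ.continuousAt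
  have hleft : ∀ᶠ y in 𝓝 p, Φh.symm (Φ y) = y := Φh.eventually_left_inverse hp
  have hright : ∀ᶠ y in 𝓝 (0 : ι → 𝕜), Φ (Φh.symm y) = y :=
    Φh.eventually_right_inverse (hΦ0 ▸ Φh.map_source hp)
  refine ⟨Φh.symm, ht, ⟨fun f g hfg => ?_, fun f => ⟨?_, fun hf => ?_⟩,
    fun t => ?_⟩, fun i => ?_⟩
  · obtain ⟨F, -, eF⟩ := h.exists_rep f
    obtain ⟨G, -, eG⟩ := h.exists_rep g
    refine h.injective ?_
    rw [RingHom.comp_apply, RingHom.comp_apply, eF, eG] at hfg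
    have hfg' : (fun y => F (Φh.symm y)) =ᶠ[𝓝 0] fun y => G (Φh.symm y) := Germ.coe_eq.1 hfg
    rw [eF, eG, Germ.coe_eq]
    filter_upwards [ht'.eventually hfg', hleft] with y h1 h2
    rwa [h2] at h1
  · rintro ⟨g, hg⟩
    obtain ⟨G, hG, eG⟩ := h.exists_rep g
    rw [RingHom.comp_apply, eG] at hg
    have hg' : (fun y => G (Φh.symm y)) =ᶠ[𝓝 0] f := Germ.coe_eq.1 hg
    exact AnalyticAt.congr (AnalyticAt.comp_of_eq hG hsymm hsymm0) hg'
  · obtain ⟨g, hg⟩ := h.exists_map_eq (F := f ∘ Φ) (AnalyticAt.comp_of_eq hf hΦ hΦ0)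
    refine ⟨g, ?_⟩
    rw [RingHom.comp_apply, hg]
    refine Germ.coe_eq.2 ?_
    filter_upwards [hright] with y hy
    exact congrArg f hy
  · rw [RingHom.comp_apply, h.map_const]
    rfl
  · rw [RingHom.comp_apply, eX]
    refine Germ.coe_eq.2 ?_
    filter_upwards [hright] with y hy
    exact congrFun hy i

section Coordinates

variable {ι : Type} [Fintype ι] [DecidableEq ι] {T : R →+* Germ (𝓝 (0 : ι → 𝕜)) 𝕜} {x : ι → R}

theorem exists_frame (h : IsGermChart c 0 T)
    (hT : ∀ i, T (x i) = ((fun y => y i : (ι → 𝕜) → 𝕜) : Germ (𝓝 (0 : ι → 𝕜)) 𝕜))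
    (hx : maximalIdeal R = Ideal.span (Set.range x)) :
    ∃ F : Frame c ι, F.x = x ∧ ∀ i f, T (F.d i f) = germDeriv (Pi.single i 1) (T f) := by
  have hd : ∀ (i : ι) (f : R), ∃ g, T g = germDeriv (Pi.single i 1) (T f) := fun i f => by
    obtain ⟨F, hF, eF⟩ := h.exists_rep f
    have : AnalyticAt 𝕜 (fun y => fderiv 𝕜 F y (Pi.single i 1)) 0 :=
      
      ((ContinuousLinearMap.apply 𝕜 𝕜 (Pi.single i (1 : 𝕜) : ι → 𝕜)).analyticAt
        (fderiv 𝕜 F 0)).comp hF.fderiv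
    obtain ⟨g, hg⟩ := h.exists_map_eq this
    exact ⟨g, by rw [hg, eF]; rfl⟩
  choose d hd using hd
  let D : ι → Derivation ℤ R R := fun i => Derivation.mk'
    (AddMonoidHom.toIntLinearMap (AddMonoidHom.mk' (d i) fun f g => h.injective (by
      obtain ⟨F, hF, eF⟩ := h.exists_rep f
      obtain ⟨G, hG, eG⟩ := h.exists_rep g
      rw [map_add, hd, hd, hd, map_add, eF, eG]
      refine Germ.coe_eq.2 ?_
      filter_upwards [hF.eventually_analyticAt, hG.eventually_analyticAt] with y h1 h2
      exact congrArg (fun L : (ι → 𝕜) →L[𝕜] 𝕜 => L (Pi.single i 1))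
        (fderiv_add h1.differentiableAt h2.differentiableAt))))
    fun f g => h.injective (by
      change T (d i (f * g)) = T (f * d i g + g * d i f)
      obtain ⟨F, hF, eF⟩ := h.exists_rep f
      obtain ⟨G, hG, eG⟩ := h.exists_rep g
      rw [map_add, map_mul, map_mul, hd, hd, hd, map_mul, eF, eG]
      refine Germ.coe_eq.2 ?_
      filter_upwards [hF.eventually_analyticAt, hG.eventually_analyticAt] with y h1 h2
      exact congrArg (fun L : (ι → 𝕜) →L[𝕜] 𝕜 => L (Pi.single i 1))
        (fderiv_mul h1.differentiableAt h2.differentiableAt))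
  have hD : ∀ i f, T (D i f) = germDeriv (Pi.single i 1) (T f) := hd
  have hconst : ∀ i t, D i (c t) = 0 := fun i t => h.injective (by
    rw [hD, h.map_const, map_zero]
    refine Germ.coe_eq.2 (.of_forall fun y => ?_)
    simp)
  have hDx : ∀ i j, D i (x j) = if i = j then 1 else 0 := fun i j => h.injective (by
    rw [hD, hT]
    have : ∀ y : ι → 𝕜, fderiv 𝕜 (fun y : ι → 𝕜 => y j) y (Pi.single i 1) = if i = j then 1 else 0 := by
      intro y
      have e : fderiv 𝕜 (fun y : ι → 𝕜 => y j) y = ContinuousLinearMap.proj j :=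
        (ContinuousLinearMap.proj (R := 𝕜) (φ := fun _ : ι => 𝕜) j).hasFDerivAt.fderiv
      rw [e]
      simp [Pi.single_apply, eq_comm]
    split_ifs with hij
    · rw [map_one]
      exact Germ.coe_eq.2 (.of_forall fun y => (this y).trans (if_pos hij))
    · rw [map_zero]
      exact Germ.coe_eq.2 (.of_forall fun y => (this y).trans (if_neg hij)))
  refine ⟨⟨x, D, hx, hconst, hDx, fun D' hD' f => ?_⟩, rfl, hD⟩
  -- a derivation which kills the constants and the coordinates takes values in all `𝔪 ^ N`
  let D₀ : Derivation ℤ R R := D' - ∑ i, D' (x i) • D i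
  have hD₀ : ∀ f, D₀ f = D' f - ∑ i, D' (x i) * D i f := fun f => by
    rw [Derivation.sub_apply, ← Derivation.coeFnAddMonoidHom_apply (∑ i, D' (x i) • D i), map_sum,
      Finset.sum_apply]
    rfl
  have h1 : ∀ t, D₀ (c t) = 0 := fun t => by simp [hD₀, hD', hconst]
  have h2 : ∀ i, D₀ (x i) = 0 := fun i => by simp [hD₀, hDx]
  have h3 : ∀ N : ℕ, ∀ f, D₀ f ∈ maximalIdeal R ^ N := by
    intro N
    induction N with
    | zero => simp
    | succ N ih =>
      intro f
      obtain ⟨F, hF, eF⟩ := h.exists_rep f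
      have hm : f - c (F 0) ∈ maximalIdeal R := by
        have : T (f - c (F 0)) = ((F - fun _ => F 0 : (ι → 𝕜) → 𝕜) : Germ (𝓝 (0 : ι → 𝕜)) 𝕜) := by
          rw [map_sub, eF, h.map_const]; rfl
        rw [h.mem_maximalIdeal_iff this]
        simp
      rw [hx] at hm
      obtain ⟨a, ha⟩ := (Submodule.mem_span_range_iff_exists_fun R).1 hm
      have e : D₀ f = ∑ i, x i * D₀ (a i) := by
        have := congrArg D₀ ha
        rw [map_sub, h1, sub_zero, map_sum] at this
        rw [← this]
        refine Finset.sum_congr rfl fun i _ => ?_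
        rw [smul_eq_mul, Derivation.leibniz, h2, smul_zero, zero_add, smul_eq_mul]
      rw [e, pow_succ']
      exact sum_mem fun i _ => Ideal.mul_mem_mul (hx ▸ Ideal.subset_span ⟨i, rfl⟩) (ih _)
  have := h.eq_zero_of_forall_mem_pow fun N => h3 N f
  rwa [hD₀, sub_eq_zero] at this

/-- The projection of affine space along the `i`-th axis. -/
noncomputable def axisProj (𝕜 : Type u) [RCLike 𝕜] {ι : Type} [Fintype ι] [DecidableEq ι] (i : ι) :
    (ι → 𝕜) →L[𝕜] (ι → 𝕜) :=
  ContinuousLinearMap.pi fun j => if j = i then 0 else ContinuousLinearMap.proj j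

theorem axisProj_apply (i j : ι) (y : ι → 𝕜) : axisProj 𝕜 i y j = if j = i then 0 else y j := by
  simp only [axisProj, ContinuousLinearMap.coe_pi']
  split_ifs <;> rfl

theorem norm_axisProj_le (i : ι) : ‖axisProj 𝕜 i‖ ≤ 1 := by
  refine ContinuousLinearMap.opNorm_le_bound _ zero_le_one fun y => ?_
  rw [one_mul, pi_norm_le_iff_of_nonneg (norm_nonneg _)]
  intro j
  rw [axisProj_apply]
  split_ifs
  · simp
  · exact norm_le_pi_norm y j

theorem axisProj_add (i : ι) (y : ι → 𝕜) : y = axisProj 𝕜 i y + y i • Pi.single i 1 := by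
  ext j
  rw [Pi.add_apply, axisProj_apply, Pi.smul_apply, Pi.single_apply]
  split_ifs with h
  · simp [h]
  · simp

omit [IsLocalRing R] in
/-- Hadamard's lemma. -/
theorem exists_retract (h : IsGermChart c 0 T)
    (hT : ∀ i, T (x i) = ((fun y => y i : (ι → 𝕜) → 𝕜) : Germ (𝓝 (0 : ι → 𝕜)) 𝕜)) (i : ι) (f : R)
    {F : (ι → 𝕜) → 𝕜} (hF : T f = (F : Germ (𝓝 (0 : ι → 𝕜)) 𝕜)) :
    ∃ f₀, T f₀ = ((F ∘ axisProj 𝕜 i : (ι → 𝕜) → 𝕜) : Germ (𝓝 (0 : ι → 𝕜)) 𝕜) ∧ x i ∣ f - f₀ := by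
  have hFa := (h.mem_range_iff F).1 ⟨f, hF⟩
  obtain ⟨f₀, hf₀⟩ := h.exists_map_eq (F := F ∘ axisProj 𝕜 i)
    (hFa.comp_of_eq ((axisProj 𝕜 i).analyticAt 0) (map_zero _))
  obtain ⟨q, hq, e⟩ := hFa.exists_sub_eq_smul (norm_axisProj_le i) (axisProj_add i)
  obtain ⟨g, hg⟩ := h.exists_map_eq hq
  refine ⟨f₀, hf₀, g, h.injective ?_⟩
  rw [map_sub, map_mul, hF, hf₀, hT, hg, ← Germ.coe_sub, ← Germ.coe_mul, Germ.coe_eq]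
  exact e

omit [IsLocalRing R] in
theorem dvd_iff (h : IsGermChart c 0 T)
    (hT : ∀ i, T (x i) = ((fun y => y i : (ι → 𝕜) → 𝕜) : Germ (𝓝 (0 : ι → 𝕜)) 𝕜)) (i : ι) {f : R}
    {F : (ι → 𝕜) → 𝕜} (hF : T f = (F : Germ (𝓝 (0 : ι → 𝕜)) 𝕜)) :
    x i ∣ f ↔ ∀ᶠ y in 𝓝 0, F (axisProj 𝕜 i y) = 0 := by
  constructor
  · rintro ⟨g, rfl⟩
    obtain ⟨G, hG, eG⟩ := h.exists_rep g
    rw [map_mul, hT, eG, ← Germ.coe_mul, Germ.coe_eq] at hF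
    have ht : Tendsto (axisProj 𝕜 i) (𝓝 0) (𝓝 0) := by
      simpa using (axisProj 𝕜 i).continuous.tendsto 0
    filter_upwards [ht.eventually hF] with y hy
    rw [← hy, Pi.mul_apply, axisProj_apply, if_pos rfl, zero_mul]
  · intro h0
    obtain ⟨f₀, hf₀, hd⟩ := h.exists_retract hT i f hF
    have : f₀ = 0 := h.injective (by rw [hf₀, map_zero]; exact Germ.coe_eq.2 h0)
    rwa [this, sub_zero] at hd

omit [IsLocalRing R] in
theorem prime (h : IsGermChart c 0 T)
    (hT : ∀ i, T (x i) = ((fun y => y i : (ι → 𝕜) → 𝕜) : Germ (𝓝 (0 : ι → 𝕜)) 𝕜)) (i : ι) :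
    Prime (x i) := by
  refine ⟨fun h0 => ?_, fun hu => ?_, fun f g hfg => ?_⟩
  · have := hT i
    rw [h0, map_zero] at this
    have h1 : (fun _ => 0) =ᶠ[𝓝 (0 : ι → 𝕜)] fun y => y i := Germ.coe_eq.1 this
    have h2 : Tendsto (fun t : 𝕜 => (Pi.single i t : ι → 𝕜)) (𝓝[≠] 0) (𝓝 0) := by
      have : Continuous fun t : 𝕜 => (Pi.single i t : ι → 𝕜) :=
        continuous_single (A := fun _ : ι => 𝕜) i
      simpa using (this.tendsto 0).mono_left nhdsWithin_le_nhds
    obtain ⟨t, ht, ht'⟩ := ((h2.eventually h1).and self_mem_nhdsWithin).exists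
    simp only [Pi.single_eq_same] at ht
    exact ht' ht.symm
  · rw [h.isUnit_iff (hT i)] at hu
    exact hu rfl
  · obtain ⟨F, hF, eF⟩ := h.exists_rep f
    obtain ⟨G, hG, eG⟩ := h.exists_rep g
    rw [h.dvd_iff hT i (F := F * G) (by rw [map_mul, eF, eG]; rfl)] at hfg
    rw [h.dvd_iff hT i eF, h.dvd_iff hT i eG]
    exact AnalyticAt.eventually_eq_zero_or_of_mul_eq_zero
      (hF.comp_of_eq ((axisProj 𝕜 i).analyticAt 0) (map_zero _))
      (hG.comp_of_eq ((axisProj 𝕜 i).analyticAt 0) (map_zero _)) hfg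

end Coordinates

theorem isSmoothLocalRing [FiniteDimensional 𝕜 E] (h : IsGermChart c p T) :
    IsSmoothLocalRing c (Module.finrank 𝕜 E) := by
  refine ⟨h.isDomain, fun f hf => ?_, fun ι _ _ x hι hx i => ?_, fun ι _ _ x hι hx => ?_⟩
  · obtain ⟨T', h'⟩ := h.exists_chart_zero
    exact h'.eq_zero_of_forall_mem_pow hf
  · obtain ⟨_, _, h', hT'⟩ := h.exists_chart hι x hx
    exact h'.prime hT' i
  · obtain ⟨_, _, h', hT'⟩ := h.exists_chart hι x hx
    obtain ⟨F, hF, -⟩ := h'.exists_frame hT' hx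
    exact ⟨F, hF⟩

theorem exists_sub_const_mem (h : IsGermChart c p T) (f : R) : ∃ t, f - c t ∈ maximalIdeal R := by
  obtain ⟨F, hF, eF⟩ := h.exists_rep f
  refine ⟨F p, ?_⟩
  have : T (f - c (F p)) = ((F - fun _ => F p : E → 𝕜) : Germ (𝓝 p) 𝕜) := by
    rw [map_sub, eF, h.map_const]; rfl
  rw [h.mem_maximalIdeal_iff this]
  simp

theorem exists_root (h : IsGermChart c p T) {f : R} (hf : f - 1 ∈ maximalIdeal R) {d : ℕ}
    (hd : d ≠ 0) : ∃ w, w ^ d = f := by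
  obtain ⟨F, hF, eF⟩ := h.exists_rep f
  have hF1 : F p = 1 := by
    have : T (f - 1) = ((F - 1 : E → 𝕜) : Germ (𝓝 p) 𝕜) := by
      rw [map_sub, eF, map_one]; rfl
    simpa [sub_eq_zero] using (h.mem_maximalIdeal_iff this).1 hf
  -- the branch of the `d`-th root near `1`
  have hpow : AnalyticAt 𝕜 (fun t : 𝕜 => t ^ d) 1 := analyticAt_id.pow d
  have hpow' : deriv (fun t : 𝕜 => t ^ d) 1 ≠ 0 := by simpa using hd
  let ρ : 𝕜 → 𝕜 := hpow.hasStrictDerivAt.localInverse _ _ _ hpow'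
  have hρ : AnalyticAt 𝕜 ρ (F p) := by
    have := hpow.analyticAt_localInverse hpow'
    rw [hF1]
    simpa using this
  have hρ' : ∀ᶠ t in 𝓝 (F p), ρ t ^ d = t := by
    rw [hF1]
    have := HasStrictDerivAt.eventually_right_inverse hpow.hasStrictDerivAt hpow'
    rwa [one_pow] at this
  obtain ⟨w, hw⟩ := h.exists_map_eq (hρ.comp hF)
  refine ⟨w, h.injective ?_⟩
  rw [map_pow, hw, eF, ← Germ.coe_pow, Germ.coe_eq]
  exact hF.continuousAt.eventually hρ'

end IsGermChart

/-- In the analytic case no extensions of the local ring are needed. -/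
theorem IsGermChart.isEtaleClass {R₀ : Type u} [CommRing R₀] {c₀ : 𝕜 →+* R₀} [FiniteDimensional 𝕜 E]
    {T : R₀ →+* Germ (𝓝 p) 𝕜} (h : IsGermChart c₀ p T) :
    IsEtaleClass c₀ (Module.finrank 𝕜 E) fun A : LocalExt R₀ => Function.Bijective A.φ := by
  have hA : ∀ A : LocalExt R₀, Function.Bijective A.φ →
      ∃ T' : A.carrier →+* Germ (𝓝 p) 𝕜, IsGermChart (A.φ.comp c₀) p T' := fun A hA =>
    ⟨_, h.comp_equiv (RingEquiv.ofBijective A.φ hA).symm fun t =>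
      (RingEquiv.ofBijective A.φ hA).symm_apply_apply _⟩
  refine ⟨fun A h𝒜 => ?_, fun A h𝒜 f => ⟨A, h𝒜, RingHom.id _, .refl A, ?_⟩,
    fun A h𝒜 f hf d hd => ⟨A, h𝒜, RingHom.id _, .refl A, ?_⟩,
    fun A h𝒜 ι _ _ F hι i f => ⟨A, h𝒜, RingHom.id _, .refl A, ?_⟩⟩
  all_goals obtain ⟨T', h'⟩ := hA A h𝒜
  · exact h'.isSmoothLocalRing
  · obtain ⟨t, ht⟩ := h'.exists_sub_const_mem f
    exact ⟨_, ht, fun D hD => hD t⟩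
  · exact h'.exists_root hf hd
  · obtain ⟨_, _, h'', hT''⟩ := h'.exists_chart hι F.x F.span_eq
    obtain ⟨G, hG, eG⟩ := h''.exists_rep f
    obtain ⟨f₀, hf₀, hdvd⟩ := h''.exists_retract hT'' i f eG
    obtain ⟨F₁, hF₁, hd⟩ := h''.exists_frame hT'' F.span_eq
    have hF₁0 : F₁.d i f₀ = 0 := h''.injective (by
      rw [hd, hf₀, map_zero]
      refine Germ.coe_eq.2 ?_
      have ht : Tendsto (axisProj 𝕜 i) (𝓝 0) (𝓝 0) := by
        simpa using (axisProj 𝕜 i).continuous.tendsto 0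
      filter_upwards [ht.eventually hG.eventually_analyticAt] with y hy
      rw [fderiv_comp y hy.differentiableAt (axisProj 𝕜 i).differentiableAt,
        ContinuousLinearMap.fderiv, ContinuousLinearMap.comp_apply]
      have : axisProj 𝕜 i (Pi.single i 1) = 0 := by
        ext j
        rw [axisProj_apply]
        split_ifs with hj
        · rfl
        · simp [hj]
      rw [this, map_zero])
    refine ⟨f₀, fun F' hF' => ?_⟩
    have hx : F'.x = F.x := funext fun j => hF'.map_x j
    refine ⟨?_, by rw [hx]; exact hdvd⟩
    rw [← hF₁0]
    refine F₁.ext_derivation (F'.d_const i) (F₁.d_const i) (fun j => ?_) f₀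
    rw [F₁.d_x, hF₁, ← hx, F'.d_x]

end GermChart

/-! ### Local coordinates of locally ringed spaces -/

section LocallyRinged

open IsLocalRing

variable {X Y X₀ : LocallyRingedSpace.{u}}

theorem mem_vanishingLocus_iff {U : Opens X} {f : X.presheaf.obj (op U)} {x : X} (hx : x ∈ U) :
    x ∈ vanishingLocus f ↔ X.presheaf.germ U x hx f ∈ maximalIdeal (X.presheaf.stalk x) :=
  ⟨fun ⟨_, h⟩ => h, fun h => ⟨hx, h⟩⟩

theorem germ_restrict {U V : Opens X} (h : V ≤ U) (f : X.presheaf.obj (op U)) {x : X} (hx : x ∈ V) :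
    X.presheaf.germ V x hx (X.presheaf.map (homOfLE h).op f) = X.presheaf.germ U x (h hx) f :=
  TopCat.Presheaf.germ_res_apply _ _ _ _ _

theorem vanishingLocus_map {U V : Opens X} (h : V ≤ U) (f : X.presheaf.obj (op U)) :
    vanishingLocus (X.presheaf.map (homOfLE h).op f) = vanishingLocus f ∩ V := by
  ext x
  constructor
  · rintro ⟨hx, h'⟩
    rw [TopCat.Presheaf.germ_res_apply] at h'
    exact ⟨⟨h hx, h'⟩, hx⟩
  · rintro ⟨⟨_, h'⟩, hx⟩
    refine ⟨hx, ?_⟩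
    rw [TopCat.Presheaf.germ_res_apply]
    exact h'

theorem vanishingLocus_app (p : Y ⟶ X) {U : Opens X} (f : X.presheaf.obj (op U)) :
    vanishingLocus (U := (Opens.map p.base).obj U) (p.c.app (op U) f) =
      (p.base : Y → X) ⁻¹' vanishingLocus f := by
  ext y
  constructor
  · rintro ⟨hy, h⟩
    refine ⟨hy, ?_⟩
    rw [mem_maximalIdeal, ← map_mem_nonunits_iff (p.stalkMap y).hom]
    change p.stalkMap y _ ∈ nonunits _
    have e := LocallyRingedSpace.stalkMap_germ_apply p U y hy f
    exact e.symm ▸ h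
  · rintro ⟨hy, h⟩
    refine ⟨hy, ?_⟩
    rw [mem_maximalIdeal, ← map_mem_nonunits_iff (p.stalkMap y).hom] at h
    have e := LocallyRingedSpace.stalkMap_germ_apply p U y hy f
    exact e ▸ h

theorem stalkMap_stalkConst {k : Type u} [Field k] (p : Y ⟶ X) (c : k →+* X.presheaf.obj (op ⊤))
    (y : Y) : (p.stalkMap y).hom.comp (stalkConst c (p.base y)) =
      stalkConst (pullbackConst c p) y := by
  ext t
  exact LocallyRingedSpace.stalkMap_germ_apply p ⊤ y trivial (c t)

/-- Germs extend to sections, and equalities of germs to equalities of sections. -/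
theorem exists_section_of_associated {U : Opens X} {a : X} (ha : a ∈ U) (f : X.presheaf.obj (op U))
    {g : X.presheaf.stalk a} (h : Associated g (X.presheaf.germ U a ha f)) :
    ∃ (V : Opens X) (haV : a ∈ V) (g' : X.presheaf.obj (op V)), V ≤ U ∧
      X.presheaf.germ V a haV g' = g ∧ vanishingLocus g' = vanishingLocus f ∩ V := by
  obtain ⟨w, hw⟩ := h.symm
  obtain ⟨W, haW, w', hw'⟩ := X.presheaf.exists_germ_eq (w : X.presheaf.stalk a)
  obtain ⟨V, i, haV, hV⟩ := X.toRingedSpace.isUnit_res_of_isUnit_germ W w' a haW (by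
    rw [hw']; exact w.isUnit)
  let V' : Opens X := V ⊓ U
  have h1 : V' ≤ W := inf_le_left.trans (leOfHom i)
  have haV' : a ∈ V' := ⟨haV, ha⟩
  refine ⟨V', haV', X.presheaf.map (homOfLE (inf_le_right : V' ≤ U)).op f *
    X.presheaf.map (homOfLE h1).op w', inf_le_right, ?_, ?_⟩
  · rw [map_mul, germ_restrict, germ_restrict, hw', hw]
  · ext x
    have key : ∀ hx : x ∈ V', IsUnit (X.presheaf.germ W x (h1 hx) w') := fun hx => by
      have := hV.map (X.presheaf.germ V x hx.1).hom
      have e := X.presheaf.germ_res_apply i x hx.1 w'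
      exact e ▸ this
    constructor
    · rintro ⟨hx, h'⟩
      refine ⟨⟨hx.2, ?_⟩, hx⟩
      rw [map_mul, germ_restrict, germ_restrict] at h'
      exact ((maximalIdeal.isMaximal _).isPrime.mem_or_mem h').resolve_right
        fun h0 => (mem_maximalIdeal _).1 h0 (key hx)
    · rintro ⟨⟨hxU, h'⟩, hx⟩
      refine ⟨hx, ?_⟩
      rw [map_mul, germ_restrict]
      exact Ideal.mul_mem_right _ _ h'

namespace LocalCoordinates

variable {a : X} {s r n : ℕ}

/-- The coordinates of the frame `F` are the coordinates `(u, v)`. -/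
structure IsFrame {k : Type u} [Field k] {c : k →+* X.presheaf.stalk a} (C : LocalCoordinates X a s r)
    (F : Frame c (Fin s ⊕ Fin r)) : Prop where
  x_inl : ∀ i, F.x (.inl i) = C.uGerm i
  x_inr : ∀ j, F.x (.inr j) = C.vGerm j

theorem range_elim (C : LocalCoordinates X a s r) : maximalIdeal (X.presheaf.stalk a) =
    Ideal.span (Set.range (Sum.elim C.uGerm C.vGerm)) := by
  rw [Set.Sum.elim_range]
  exact C.maximalIdeal_eq

theorem exists_isFrame {k : Type u} [Field k] {c : k →+* X.presheaf.stalk a}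
    (C : LocalCoordinates X a s r) (hR : IsSmoothLocalRing c n) (hn : s + r = n) :
    ∃ F : Frame c (Fin s ⊕ Fin r), C.IsFrame F := by
  obtain ⟨F, hF⟩ := hR.exists_frame (Fin s ⊕ Fin r) _ (by simpa using hn) C.range_elim
  exact ⟨F, fun i => by rw [hF]; rfl, fun j => by rw [hF]; rfl⟩

theorem IsFrame.mono_eq {k : Type u} [Field k] {c : k →+* X.presheaf.stalk a}
    {C : LocalCoordinates X a s r} {F : Frame c (Fin s ⊕ Fin r)} (h : C.IsFrame F)
    (γ : Fin s → ℕ) : F.mono γ = C.uMonomial γ := by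
  simp only [Frame.mono, h.x_inl, uMonomial]

theorem IsFrame.isLogJacobian_iff {k : Type u} [Field k] {c : k →+* X.presheaf.obj (op ⊤)}
    {C : LocalCoordinates X a s r} {F : Frame (stalkConst c a) (Fin s ⊕ Fin r)} (h : C.IsFrame F)
    {m : ℕ} (g : Fin m → X.presheaf.stalk a)
    (L : Matrix (Fin m) (Fin s ⊕ Fin r) (X.presheaf.stalk a)) :
    C.IsLogJacobian c g L ↔ ∀ q, L q = F.vec (g q) := by
  constructor
  · rintro ⟨A, B, hAB, rfl⟩ q
    have key : ∀ l, F.d l (g q) = ∑ i, A q i * F.d l (F.x (.inl i)) +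
        ∑ j, B q j * F.d l (F.x (.inr j)) := fun l => by
      have := congrArg (fun ω : OneForms (stalkConst c a) => ω ⟨F.d l, F.d_const l⟩) (hAB q)
      simp only [LinearMap.add_apply, LinearMap.sum_apply, LinearMap.smul_apply, smul_eq_mul] at this
      simp only [h.x_inl, h.x_inr]
      exact this
    ext l
    cases l with
    | inl i =>
      have := key (.inl i)
      simp only [F.d_x] at this
      simp [Frame.vec, this, h.x_inl]
    | inr j =>
      have := key (.inr j)
      simp only [F.d_x] at this
      simp [Frame.vec, this]
  · intro hL
    refine ⟨Matrix.of fun q i => F.d (.inl i) (g q), Matrix.of fun q j => F.d (.inr j) (g q),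
      fun q => ?_, ?_⟩
    · ext D
      simp only [LinearMap.add_apply, LinearMap.sum_apply, LinearMap.smul_apply, smul_eq_mul]
      change D.1 (g q) = ∑ i, F.d (.inl i) (g q) * D.1 (C.uGerm i) +
        ∑ j, F.d (.inr j) (g q) * D.1 (C.vGerm j)
      rw [F.eq_sum D.1 D.2, Fintype.sum_sum_type]
      simp only [h.x_inl, h.x_inr, mul_comm]
    · ext q l
      rw [hL]
      cases l <;> simp [Frame.vec, h.x_inl]

theorem IsFrame.logMinorsIdeal_eq {k : Type u} [Field k] {c₀ : k →+* X₀.presheaf.obj (op ⊤)}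
    {σ : X ⟶ X₀} {C : LocalCoordinates X a s r}
    {F : Frame (stalkConst (pullbackConst c₀ σ) a) (Fin s ⊕ Fin r)} (h : C.IsFrame F) (m : ℕ) :
    C.logMinorsIdeal c₀ σ m = minorsIdeal (F.vec '' Set.range (σ.stalkMap a)) m := by
  unfold logMinorsIdeal minorsIdeal
  congr 1
  ext δ
  simp only [h.isLogJacobian_iff]
  constructor
  · rintro ⟨f, L, J, hL, rfl⟩
    refine ⟨L, J, fun q => ⟨_, ⟨f q, rfl⟩, (hL q).symm⟩, rfl⟩
  · rintro ⟨g, J, hg, rfl⟩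
    choose f' hf' hg using hg
    choose f hf using hf'
    exact ⟨f, g, J, fun q => by rw [hf, hg], rfl⟩

/-- The pull-back of local coordinates by a morphism which is étale at the point `b`. -/
noncomputable def pullback (p : Y ⟶ X) {b : Y} (C : LocalCoordinates X (p.base b) s r)
    (h : (maximalIdeal (X.presheaf.stalk (p.base b))).map (p.stalkMap b).hom =
      maximalIdeal (Y.presheaf.stalk b)) : LocalCoordinates Y b s r where
  U := (Opens.map p.base).obj C.U
  mem := C.mem
  u i := p.c.app (op C.U) (C.u i)
  v j := p.c.app (op C.U) (C.v j)
  maximalIdeal_eq := by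
    rw [← h, C.maximalIdeal_eq, Ideal.map_span, Set.image_union, ← Set.range_comp, ← Set.range_comp]
    congr 3 <;> funext i <;> exact LocallyRingedSpace.stalkMap_germ_apply p C.U b C.mem _

theorem pullback_uGerm (p : Y ⟶ X) {b : Y} (C : LocalCoordinates X (p.base b) s r) (h) (i : Fin s) :
    (C.pullback p h).uGerm i = p.stalkMap b (C.uGerm i) :=
  (LocallyRingedSpace.stalkMap_germ_apply p C.U b C.mem _).symm

theorem pullback_vGerm (p : Y ⟶ X) {b : Y} (C : LocalCoordinates X (p.base b) s r) (h) (j : Fin r) :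
    (C.pullback p h).vGerm j = p.stalkMap b (C.vGerm j) :=
  (LocallyRingedSpace.stalkMap_germ_apply p C.U b C.mem _).symm

theorem pullback_inter_eq (p : Y ⟶ X) {b : Y} (C : LocalCoordinates X (p.base b) s r) (h)
    {D : Set X} (hD : D ∩ C.U = ⋃ i, vanishingLocus (C.u i)) :
    (p.base : Y → X) ⁻¹' D ∩ ((C.pullback p h).U : Set Y) = ⋃ i, vanishingLocus ((C.pullback p h).u i) := by
  have := congrArg ((p.base : Y → X) ⁻¹' ·) hD
  simp only [Set.preimage_inter, Set.preimage_iUnion] at this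
  refine this.trans (Set.iUnion_congr fun i => ?_)
  exact (vanishingLocus_app p (C.u i)).symm

theorem IsAdapted.inter_eq {ι : Type v} {E : ι → Set X} {C : LocalCoordinates X a s r}
    (h : C.IsAdapted E) : (⋃ i, E i) ∩ C.U = ⋃ i, vanishingLocus (C.u i) := by
  obtain ⟨e, -, he, he'⟩ := h
  rw [Set.iUnion_inter]
  apply Set.Subset.antisymm
  · refine Set.iUnion_subset fun i => ?_
    by_cases hi : i ∈ Set.range e
    · obtain ⟨j, rfl⟩ := hi
      rw [he]
      exact Set.subset_iUnion (fun j => vanishingLocus (C.u j)) j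
    · rw [he' i hi]
      exact Set.empty_subset _
  · refine Set.iUnion_subset fun j => ?_
    rw [← he]
    exact Set.subset_iUnion (fun i => E i ∩ C.U) (e j)

theorem exists_of_associated (C : LocalCoordinates X a s r) (x : Fin s ⊕ Fin r → X.presheaf.stalk a)
    (hx : maximalIdeal (X.presheaf.stalk a) = Ideal.span (Set.range x))
    (hu : ∀ i, Associated (x (.inl i)) (C.uGerm i)) {D : Set X}
    (hD : D ∩ C.U = ⋃ i, vanishingLocus (C.u i)) :
    ∃ C' : LocalCoordinates X a s r, (∀ i, C'.uGerm i = x (.inl i)) ∧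
      (∀ j, C'.vGerm j = x (.inr j)) ∧ D ∩ C'.U = ⋃ i, vanishingLocus (C'.u i) := by
  choose V haV g hVU hg hgV using fun i => exists_section_of_associated C.mem (C.u i) (hu i)
  have hex : ∀ j, ∃ (W : Opens X) (haW : a ∈ W) (f : X.presheaf.obj (op W)),
      X.presheaf.germ W a haW f = x (.inr j) := fun j => X.presheaf.exists_germ_eq (x (.inr j))
  choose W haW f hf using hex
  let U' : Opens X := C.U ⊓ (⟨⋂ i, (V i : Set X), isOpen_iInter_of_finite fun i => (V i).isOpen⟩ ⊓
    ⟨⋂ j, (W j : Set X), isOpen_iInter_of_finite fun j => (W j).isOpen⟩)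
  have hU'V : ∀ i, U' ≤ V i := fun i y hy => Set.mem_iInter.1 hy.2.1 i
  have hU'W : ∀ j, U' ≤ W j := fun j y hy => Set.mem_iInter.1 hy.2.2 j
  have haU' : a ∈ U' := ⟨C.mem, Set.mem_iInter.2 haV, Set.mem_iInter.2 haW⟩
  have e1 : ∀ i, X.presheaf.germ U' a haU' (X.presheaf.map (homOfLE (hU'V i)).op (g i)) =
      x (.inl i) := fun i => by rw [germ_restrict, hg]
  have e2 : ∀ j, X.presheaf.germ U' a haU' (X.presheaf.map (homOfLE (hU'W j)).op (f j)) =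
      x (.inr j) := fun j => by rw [germ_restrict, hf]
  refine ⟨⟨U', haU', fun i => X.presheaf.map (homOfLE (hU'V i)).op (g i),
    fun j => X.presheaf.map (homOfLE (hU'W j)).op (f j), ?_⟩, e1, e2, ?_⟩
  · simp only [e1, e2]
    rw [hx]
    congr 1
    ext y
    simp
  · have h1 : D ∩ U' = (D ∩ C.U) ∩ U' := by
      rw [Set.inter_assoc, Set.inter_eq_right.2 (show (U' : Set X) ⊆ C.U from fun y hy => hy.1)]
    change D ∩ U' = _
    rw [h1, hD, Set.iUnion_inter]
    refine Set.iUnion_congr fun i => ?_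
    rw [vanishingLocus_map (hU'V i), hgV, Set.inter_assoc,
      Set.inter_eq_right.2 (show (U' : Set X) ⊆ V i from hU'V i)]

end LocalCoordinates

/-- The hypersurfaces `(u_i = 0)`, for local coordinates at `a`, satisfy the Nullstellensatz. -/
def HasNullstellensatz (X : LocallyRingedSpace.{u}) (n : ℕ) (a : X) : Prop :=
  ∀ (s r : ℕ) (C : LocalCoordinates X a s r), s + r = n → ∀ (i : Fin s) (V : Opens X) (ha : a ∈ V)
    (f : X.presheaf.obj (op V)), vanishingLocus (C.u i) ∩ V ⊆ vanishingLocus f →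
      ∃ N : ℕ, C.uGerm i ∣ X.presheaf.germ V a ha f ^ N

variable {a : X} {s r s' r' n : ℕ}

/-- Functions `u_i`, `u'_i` defining the components of the same divisor are associated. -/
theorem HasNullstellensatz.exists_associated {k : Type u} [Field k] {c : k →+* X.presheaf.stalk a}
    (h : HasNullstellensatz X n a) (hR : IsSmoothLocalRing c n) (C : LocalCoordinates X a s r)
    (C' : LocalCoordinates X a s' r') (hn : s + r = n) (hn' : s' + r' = n) {D : Set X}
    (hD : D ∩ C.U = ⋃ i, vanishingLocus (C.u i)) (hD' : D ∩ C'.U = ⋃ i, vanishingLocus (C'.u i))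
    (i : Fin s) : ∃ i', Associated (C'.uGerm i') (C.uGerm i) := by
  have := hR.isDomain
  have hp : Prime (C.uGerm i) :=
    hR.prime (Fin s ⊕ Fin r) _ (by simpa using hn) C.range_elim (.inl i)
  have hp' : ∀ i', Prime (C'.uGerm i') := fun i' =>
    hR.prime (Fin s' ⊕ Fin r') _ (by simpa using hn') C'.range_elim (.inl i')
  obtain ⟨N, hN⟩ := h s r C hn i C'.U C'.mem (∏ i', C'.u i') (by
    rintro x ⟨hx, hx'⟩
    have h1 : x ∈ D ∩ C.U := hD ▸ Set.mem_iUnion.2 ⟨i, hx⟩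
    have h2 : x ∈ ⋃ i', vanishingLocus (C'.u i') := hD' ▸ ⟨h1.1, hx'⟩
    obtain ⟨i', h3⟩ := Set.mem_iUnion.1 h2
    refine ⟨hx', ?_⟩
    rw [map_prod]
    exact Ideal.mem_of_dvd _ (Finset.dvd_prod_of_mem _ (Finset.mem_univ i')) h3.2)
  have h4 := hp.dvd_of_dvd_pow hN
  rw [map_prod] at h4
  obtain ⟨i', -, h5⟩ := (hp.dvd_finsetProd_iff _).1 h4
  exact ⟨i', (hp.associated_of_dvd (hp' i') h5).symm⟩

variable {k : Type u} [Field k] [CharZero k] {c₀ : k →+* X₀.presheaf.obj (op ⊤)} {σ : X ⟶ X₀} {D : Set X}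

omit [CharZero k] in
theorem pulledBackCotangent_eq : pulledBackCotangent c₀ σ a = Submodule.span _
    (differential (stalkConst (pullbackConst c₀ σ) a) '' Set.range (σ.stalkMap a)) := by
  rw [← Set.range_comp]
  rfl

omit [CharZero k] in
theorem LocalCoordinates.IsFrame.image_monoV {C : LocalCoordinates X a s r}
    {c : k →+* X.presheaf.stalk a} {F : Frame c (Fin s ⊕ Fin r)} (h : C.IsFrame F)
    (e : Fin s ⊕ Fin r → Fin s → ℕ) :
    differential c '' Set.range (F.monoV e) =
      Set.range (fun i => differential c (C.uMonomial (e (.inl i)))) ∪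
       Set.range (fun j => differential c (C.uMonomial (e (.inr j)) * C.vGerm j)) := by
  rw [← Set.range_comp]
  ext ω
  simp [Frame.monoV, h.mono_eq, h.x_inr]

theorem hasHsiangPatiCoordinates_of_isPartialSystem
    (hR : IsSmoothLocalRing (stalkConst (pullbackConst c₀ σ) a) n) (C : LocalCoordinates X a s r)
    (hn : s + r = n) (hD : D ∩ C.U = ⋃ i, vanishingLocus (C.u i))
    (F : Frame (stalkConst (pullbackConst c₀ σ) a) (Fin s ⊕ Fin r))
    (hF : ∀ i, Associated (F.x (.inl i)) (C.uGerm i)) {Γ : ℕ → Fin s → ℕ} {S : MonomialData s r}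
    (hS : IsPartialSystem F (Set.range (σ.stalkMap a)) Γ Finset.univ S) :
    HasHsiangPatiCoordinates c₀ σ n D a := by
  obtain ⟨C', hu, hv, hD'⟩ := C.exists_of_associated F.x F.span_eq hF hD
  have hC' : C'.IsFrame F := ⟨fun i => (hu i).symm, fun j => (hv j).symm⟩
  refine ⟨s, r, C', fun i => S.e (.inl i), fun j => S.e (.inr j), hn, hD', hS.linearIndependent, ?_, ?_⟩
  · have hc := fun l l' => hS.chain l (Finset.mem_univ l) l' (Finset.mem_univ l')
    have h1 : Set.range (fun i => S.e (.inl i)) ∪ Set.range (fun j => S.e (.inr j)) =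
        Set.range S.e := by
      ext e; simp
    rw [h1]
    rintro _ ⟨l, rfl⟩ _ ⟨l', rfl⟩ -
    exact hc l l'
  · rw [← hC'.image_monoV, pulledBackCotangent_eq, F.span_differential_eq_iff (n := n) hR, hS.span_eq,
      ← Set.range_comp]
    rfl

theorem HasHsiangPatiCoordinates.exists_minorsIdeal_eq (h : HasHsiangPatiCoordinates c₀ σ n D a)
    (hR : IsSmoothLocalRing (stalkConst (pullbackConst c₀ σ) a) n) (hX : HasNullstellensatz X n a)
    (C : LocalCoordinates X a s r) (hn : s + r = n) (hD : D ∩ C.U = ⋃ i, vanishingLocus (C.u i))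
    (F : Frame (stalkConst (pullbackConst c₀ σ) a) (Fin s ⊕ Fin r)) (hF : C.IsFrame F) {m : ℕ}
    (hm : m ≤ n) :
    ∃ γ, minorsIdeal (F.vec '' Set.range (σ.stalkMap a)) m = Ideal.span {F.mono γ} := by
  obtain ⟨s', r', C', α, β, hn', hD', hα, hc, hspan⟩ := h
  obtain ⟨F', hF'⟩ := C'.exists_isFrame hR hn'
  let e : Fin s' ⊕ Fin r' → Fin s' → ℕ := Sum.elim α β
  have hspan' : pulledBackCotangent c₀ σ a = Submodule.span _
      (differential _ '' Set.range (F'.monoV e)) := by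
    rw [hF'.image_monoV e]; exact hspan
  rw [pulledBackCotangent_eq, F'.span_differential_eq_iff hR] at hspan'
  have hc' : ∀ l l', e l ≤ e l' ∨ e l' ≤ e l := fun l l' => by
    have hmem : ∀ l, e l ∈ Set.range α ∪ Set.range β := fun l => by
      cases l with
      | inl i => exact .inl ⟨i, rfl⟩
      | inr j => exact .inr ⟨j, rfl⟩
    exact hc.total (hmem l) (hmem l')
  obtain ⟨γ', hγ'⟩ := F'.exists_minorsIdeal_eq (Set.range (σ.stalkMap a)) e hα hc' (by
    rw [hspan', ← Set.range_comp]; rfl) m (by omega)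
  have h1 : ∀ i, ∃ i', Associated (F'.x (.inl i')) (F.x (.inl i)) := fun i => by
    simp only [hF.x_inl, hF'.x_inl]
    exact hX.exists_associated hR C C' hn hn' hD hD' i
  have h2 : ∀ i', ∃ i, Associated (F.x (.inl i)) (F'.x (.inl i')) := fun i' => by
    simp only [hF.x_inl, hF'.x_inl]
    exact hX.exists_associated hR C' C hn' hn hD' hD i'
  obtain ⟨γ, hγ⟩ := F'.exists_associated_mono F h2 γ'
  refine ⟨γ, ?_⟩
  rw [F.minorsIdeal_vec_eq F' h1 h2, hγ']
  have := hR.isDomain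
  exact Ideal.span_singleton_eq_span_singleton.2 hγ.symm

omit [CharZero k] in
/-- The condition on the Fitting ideals in terms of a frame. The ideal generated by the minors of
order `0`, which is the unit ideal, is included. -/
theorem exists_minorsIdeal_eq_of_logMinorsIdeal {C : LocalCoordinates X a s r}
    {F : Frame (stalkConst (pullbackConst c₀ σ) a) (Fin s ⊕ Fin r)} (hF : C.IsFrame F)
    (h : ∀ l < n, ∃ γ : Fin s → ℕ, C.logMinorsIdeal c₀ σ (n - l) = Ideal.span {C.uMonomial γ}) :
    ∃ Γ : ℕ → Fin s → ℕ, Γ 0 = 0 ∧ ∀ m ≤ n,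
      minorsIdeal (F.vec '' Set.range (σ.stalkMap a)) m = Ideal.span {F.mono (Γ m)} := by
  have h' : ∀ m, ∃ γ : Fin s → ℕ, (m = 0 → γ = 0) ∧ (m ≤ n →
      minorsIdeal (F.vec '' Set.range (σ.stalkMap a)) m = Ideal.span {F.mono γ}) := by
    intro m
    rcases Nat.eq_zero_or_pos m with rfl | hm
    · refine ⟨0, fun _ => rfl, fun _ => ?_⟩
      rw [minorsIdeal_zero]
      simp [Frame.mono]
    · by_cases hmn : m ≤ n
      · obtain ⟨γ, hγ⟩ := h (n - m) (by omega)
        refine ⟨γ, fun e => absurd e hm.ne', fun _ => ?_⟩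
        rw [hF.mono_eq, ← hγ, hF.logMinorsIdeal_eq, Nat.sub_sub_self hmn]
      · exact ⟨0, fun _ => rfl, fun h => absurd h hmn⟩
  choose Γ h0 hΓ using h'
  exact ⟨Γ, h0 0 rfl, hΓ⟩

omit [CharZero k] in
theorem Frame.exists_isMap_ringEquiv {R R' : Type u} [CommRing R] [IsLocalRing R] [CommRing R']
    [IsLocalRing R'] {c : k →+* R} {c' : k →+* R'} (e : R ≃+* R') (hc : ∀ t, e (c t) = c' t)
    {ι : Type} [Fintype ι] [DecidableEq ι] (F : Frame c ι) :
    ∃ F' : Frame c' ι, F.IsMap (e : R →+* R') F' := by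
  -- transport of derivations along `e`
  have tr : ∀ {R R' : Type u} [CommRing R] [CommRing R'] (e : R ≃+* R') (D : Derivation ℤ R R),
      ∃ D' : Derivation ℤ R' R', ∀ f, D' f = e (D (e.symm f)) := by
    intro R R' _ _ e D
    refine ⟨Derivation.mk' (AddMonoidHom.toIntLinearMap (AddMonoidHom.mk'
      (fun f => e (D (e.symm f))) fun f g => by simp)) fun f g => ?_, fun f => rfl⟩
    change e (D (e.symm (f * g))) = f * e (D (e.symm g)) + g * e (D (e.symm f))
    simp [Derivation.leibniz]
  choose d hd using fun i => tr e (F.d i)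
  refine ⟨⟨fun i => e (F.x i), d, ?_, fun i t => ?_, fun i j => ?_, fun D hD f => ?_⟩, fun i => rfl,
    fun i f => by simp [hd]⟩
  · have : (maximalIdeal R).map (e : R →+* R') = maximalIdeal R' := by
      rw [Ideal.map_comap_of_equiv]
      ext f
      simp [mem_maximalIdeal, mem_nonunits_iff]
    rw [← this, F.span_eq, Ideal.map_span, ← Set.range_comp]
    rfl
  · rw [hd, ← hc]
    simp [F.d_const]
  · rw [hd]
    simp [F.d_x]
  · obtain ⟨D', hD'⟩ := tr e.symm D
    have h1 := F.eq_sum D' (fun t => by simp [hD', hc, hD]) (e.symm f)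
    have h2 := congrArg e h1
    simp only [hD', RingEquiv.symm_symm, RingEquiv.apply_symm_apply, map_sum, map_mul] at h2
    rw [h2]
    simp only [hd]

end LocallyRinged

/-! ### Analytic manifolds -/

section AnalyticSpaces

open Filter IsLocalRing

variable (𝕜 : Type u) [RCLike 𝕜] (N : ℕ)

theorem extend_val_apply {U : Opens (Fin N → 𝕜)} (f : U → 𝕜) {y : Fin N → 𝕜} (hy : y ∈ U) :
    Function.extend Subtype.val f 0 y = f ⟨y, hy⟩ :=
  Subtype.val_injective.extend_apply f 0 ⟨y, hy⟩

/-- The germ at `x` of a function on an open neighbourhood of `x`. -/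
noncomputable def analyticGerm {U : Opens (Fin N → 𝕜)} {x : Fin N → 𝕜} (hx : x ∈ U) :
    analyticFunctions 𝕜 N U →+* Germ (𝓝 x) 𝕜 where
  toFun f := (Function.extend Subtype.val f.1 0 : (Fin N → 𝕜) → 𝕜)
  map_one' := Germ.coe_eq.2 <| by
    filter_upwards [U.isOpen.mem_nhds hx] with y hy
    exact Subtype.val_injective.extend_apply _ _ ⟨y, hy⟩
  map_zero' := Germ.coe_eq.2 <| by
    filter_upwards [U.isOpen.mem_nhds hx] with y hy
    exact Subtype.val_injective.extend_apply _ _ ⟨y, hy⟩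
  map_mul' f g := Germ.coe_eq.2 <| by
    filter_upwards [U.isOpen.mem_nhds hx] with y hy
    change _ = Function.extend Subtype.val f.1 0 y * Function.extend Subtype.val g.1 0 y
    rw [extend_val_apply 𝕜 N _ hy, extend_val_apply 𝕜 N _ hy, extend_val_apply 𝕜 N _ hy]
    rfl
  map_add' f g := Germ.coe_eq.2 <| by
    filter_upwards [U.isOpen.mem_nhds hx] with y hy
    change _ = Function.extend Subtype.val f.1 0 y + Function.extend Subtype.val g.1 0 y
    rw [extend_val_apply 𝕜 N _ hy, extend_val_apply 𝕜 N _ hy, extend_val_apply 𝕜 N _ hy]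
    rfl

theorem analyticGerm_eq_iff {U : Opens (Fin N → 𝕜)} {x : Fin N → 𝕜} (hx : x ∈ U)
    (f : analyticFunctions 𝕜 N U) (F : (Fin N → 𝕜) → 𝕜) :
    analyticGerm 𝕜 N hx f = (F : Germ (𝓝 x) 𝕜) ↔ ∀ᶠ y in 𝓝 x, ∀ hy : y ∈ U, f.1 ⟨y, hy⟩ = F y := by
  refine Germ.coe_eq.trans ⟨fun h => ?_, fun h => ?_⟩
  · filter_upwards [h] with y hy hyU
    rw [← hy]
    exact (Subtype.val_injective.extend_apply f.1 0 ⟨y, hyU⟩).symm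
  · filter_upwards [h, U.isOpen.mem_nhds hx] with y hy hyU
    rw [← hy hyU]
    exact Subtype.val_injective.extend_apply f.1 0 ⟨y, hyU⟩

/-- The cocone of germs of functions over the sections of the sheaf of analytic functions. -/
noncomputable def analyticGermCocone (x : TopCat.of (Fin N → 𝕜)) :
    Limits.Cocone ((OpenNhds.inclusion x).op ⋙ analyticPresheaf 𝕜 N) :=
  ⟨CommRingCat.of (Germ (@nhds (Fin N → 𝕜) _ x) 𝕜),
    { app := fun U => CommRingCat.ofHom (analyticGerm 𝕜 N (x := x) U.unop.2)
      naturality := fun U V i => by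
        ext f
        change analyticGerm 𝕜 N (x := x) V.unop.2 _ = analyticGerm 𝕜 N (x := x) U.unop.2 f
        refine (analyticGerm_eq_iff 𝕜 N _ _ _).2 ?_
        refine .of_forall fun y hy => ?_
        exact (Subtype.val_injective.extend_apply f.1 0 ⟨y, leOfHom i.unop hy⟩).symm }⟩

/-- The germ of functions defined by an element of the stalk of the sheaf of analytic functions. -/
noncomputable def analyticStalkToGerm (x : TopCat.of (Fin N → 𝕜)) :
    (analyticPresheaf 𝕜 N).stalk x →+* Germ (@nhds (Fin N → 𝕜) _ x) 𝕜 :=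
  (Limits.colimit.desc _ (analyticGermCocone 𝕜 N x)).hom

theorem analyticStalkToGerm_germ {U : Opens (TopCat.of (Fin N → 𝕜))} {x : TopCat.of (Fin N → 𝕜)}
    (hx : x ∈ U) (f : analyticFunctions 𝕜 N U) :
    analyticStalkToGerm 𝕜 N x ((analyticPresheaf 𝕜 N).germ U x hx f) =
      analyticGerm 𝕜 N (x := x) hx f :=
  congrArg (fun g => g.hom f)
    (Limits.colimit.ι_desc (analyticGermCocone 𝕜 N x) (op (⟨U, hx⟩ : OpenNhds x)))

theorem isGermChart_analyticStalkToGerm (x : TopCat.of (Fin N → 𝕜)) :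
    IsGermChart (stalkConst (X := analyticAffineSpace 𝕜 N) (analyticAffineSpace.constants 𝕜 N) x) x
      (analyticStalkToGerm 𝕜 N x) := by
  refine ⟨?_, fun F => ⟨?_, fun hF => ?_⟩, fun t => ?_⟩
  · refine (injective_iff_map_eq_zero (analyticStalkToGerm 𝕜 N x)).2 fun s hs => ?_
    obtain ⟨U, hxU, f, rfl⟩ := (analyticPresheaf 𝕜 N).exists_germ_eq s
    replace hs := (analyticStalkToGerm_germ 𝕜 N hxU f).symm.trans hs
    obtain ⟨W, hW, hWo, hxW⟩ := eventually_nhds_iff.1 ((analyticGerm_eq_iff 𝕜 N hxU f 0).1 hs)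
    let V : Opens (Fin N → 𝕜) := ⟨W, hWo⟩ ⊓ U
    have hVU : V ≤ U := inf_le_right
    have hxV : x ∈ V := ⟨hxW, hxU⟩
    have e : (analyticPresheaf 𝕜 N).germ U x hxU f =
        (analyticPresheaf 𝕜 N).germ V x hxV (analyticRestrict 𝕜 N hVU f) :=
      ((analyticPresheaf 𝕜 N).germ_res_apply (homOfLE hVU) x hxV f).symm
    have e0 : analyticRestrict 𝕜 N hVU f = 0 := by
      ext y
      exact hW y y.2.1 y.2.2
    rw [e, e0]
    exact map_zero ((analyticPresheaf 𝕜 N).germ V x hxV).hom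
  · rintro ⟨s, hs⟩
    obtain ⟨U, hxU, f, rfl⟩ := (analyticPresheaf 𝕜 N).exists_germ_eq s
    replace hs := (analyticGerm_eq_iff 𝕜 N (x := x) hxU f F).1
      ((analyticStalkToGerm_germ 𝕜 N hxU f).symm.trans hs)
    obtain ⟨G, hG, h⟩ := f.2 ⟨x, hxU⟩
    rw [nhds_subtype, eventually_comap] at h
    refine hG.congr ?_
    filter_upwards [hs, h, U.isOpen.mem_nhds hxU] with y h1 h2 hy
    rw [← h1 hy, h2 ⟨y, hy⟩ rfl]
  · obtain ⟨W, hW, hWo, hxW⟩ := eventually_nhds_iff.1 hF.eventually_analyticAt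
    let f : analyticFunctions 𝕜 N ⟨W, hWo⟩ := ⟨fun y => F y, fun y => ⟨F, hW y y.2, by simp⟩⟩
    refine ⟨(analyticPresheaf 𝕜 N).germ ⟨W, hWo⟩ x hxW f, ?_⟩
    refine (analyticStalkToGerm_germ 𝕜 N (x := x) hxW f).trans ?_
    exact (analyticGerm_eq_iff 𝕜 N (x := x) hxW f F).2 (.of_forall fun _ _ => rfl)
  · refine (analyticStalkToGerm_germ 𝕜 N (U := ⊤) (x := x) trivial _).trans ?_
    exact (analyticGerm_eq_iff 𝕜 N (U := ⊤) (x := x) trivial _ _).2 (.of_forall fun _ _ => rfl)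

theorem mem_vanishingLocus_analyticAffineSpace {U : Opens (analyticAffineSpace 𝕜 N)}
    {x : analyticAffineSpace 𝕜 N} (f : analyticFunctions 𝕜 N U) (hx : x ∈ U) :
    x ∈ vanishingLocus (X := analyticAffineSpace 𝕜 N) (U := U) f ↔ f.1 ⟨x, hx⟩ = 0 := by
  refine (mem_vanishingLocus_iff (X := analyticAffineSpace 𝕜 N) hx).trans ?_
  have e := analyticStalkToGerm_germ 𝕜 N hx f
  obtain ⟨F, hF⟩ : ∃ F : (Fin N → 𝕜) → 𝕜, analyticGerm 𝕜 N (x := x) hx f =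
    (F : Germ (@nhds (Fin N → 𝕜) _ x) 𝕜) := ⟨_, rfl⟩
  refine ((isGermChart_analyticStalkToGerm 𝕜 N x).mem_maximalIdeal_iff (e.trans hF)).trans ?_
  rw [((analyticGerm_eq_iff 𝕜 N (x := x) hx f F).1 hF).self_of_nhds hx]

variable {𝕜} {X : LocallyRingedSpace.{u}} {c : 𝕜 →+* X.presheaf.obj (op ⊤)} {n : ℕ}

/-- A chart at `a`, with the property that inclusions of zero loci of functions near `a` are
inclusions of zero sets of the representing functions. -/
theorem IsAnalyticManifold.exists_isGermChart (h : IsAnalyticManifold c n) (a : X) :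
    ∃ (p : Fin n → 𝕜) (T : X.presheaf.stalk a →+* Germ (𝓝 p) 𝕜), IsGermChart (stalkConst c a) p T ∧
      ∀ (U V : Opens X) (hU : a ∈ U) (hV : a ∈ V) (f : X.presheaf.obj (op U))
        (g : X.presheaf.obj (op V)), vanishingLocus f ∩ V ⊆ vanishingLocus g →
        Germ.LiftRel (fun s t => s = 0 → t = 0) (T (X.presheaf.germ U a hU f))
          (T (X.presheaf.germ V a hV g)) := by
  obtain ⟨W, j, haW, hj, hopen⟩ := h.exists_chart a
  let i : X.restrict W.isOpenEmbedding ⟶ X := X.ofRestrict W.isOpenEmbedding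
  let a' : X.restrict W.isOpenEmbedding := ⟨a, haW⟩
  have hij : IsIso (j.stalkMap a') := inferInstance
  have hii : IsIso (i.stalkMap a') := inferInstance
  let p : Fin n → 𝕜 := j.base a'
  let ej : (analyticAffineSpace 𝕜 n).presheaf.stalk (j.base a') ≃+*
      (X.restrict W.isOpenEmbedding).presheaf.stalk a' := (asIso (j.stalkMap a')).commRingCatIsoToRingEquiv
  let ei : X.presheaf.stalk a ≃+* (X.restrict W.isOpenEmbedding).presheaf.stalk a' :=
    (asIso (i.stalkMap a')).commRingCatIsoToRingEquiv
  let e : X.presheaf.stalk a ≃+* (analyticAffineSpace 𝕜 n).presheaf.stalk (j.base a') :=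
    ei.trans ej.symm
  have hc : ∀ t, e (stalkConst c a t) = stalkConst (X := analyticAffineSpace 𝕜 n)
      (analyticAffineSpace.constants 𝕜 n) p t := fun t => by
    have h1 : ei (stalkConst c a t) = stalkConst (pullbackConst c i) a' t :=
      RingHom.congr_fun (stalkMap_stalkConst i c a') t
    have h2 : ej (stalkConst (X := analyticAffineSpace 𝕜 n)
      (analyticAffineSpace.constants 𝕜 n) p t) = stalkConst (pullbackConst _ j) a' t :=
      RingHom.congr_fun (stalkMap_stalkConst j _ a') t
    change ej.symm (ei _) = _
    rw [RingEquiv.symm_apply_eq, h1, h2, hj]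
  have hT := (isGermChart_analyticStalkToGerm 𝕜 n p).comp_equiv e hc
  have hrep : ∀ (U : Opens X) (hU : a ∈ U) (f : X.presheaf.obj (op U)) (F : (Fin n → 𝕜) → 𝕜),
      analyticStalkToGerm 𝕜 n p (e (X.presheaf.germ U a hU f)) = (F : Germ (𝓝 p) 𝕜) →
      ∀ᶠ x : X.restrict W.isOpenEmbedding in 𝓝 a',
        i.base x ∈ vanishingLocus f ↔ F (j.base x) = 0 := by
    intro U hU f F hF
    obtain ⟨V, hpV, g, hg⟩ :=
      (analyticAffineSpace 𝕜 n).presheaf.exists_germ_eq (e (X.presheaf.germ U a hU f))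
    have h1 : j.stalkMap a' ((analyticAffineSpace 𝕜 n).presheaf.germ V (j.base a') hpV g) =
        i.stalkMap a' (X.presheaf.germ U a hU f) := by
      have : ej (e (X.presheaf.germ U a hU f)) = ei (X.presheaf.germ U a hU f) :=
        ej.apply_symm_apply _
      rw [← hg] at this
      exact this
    have h2 := (LocallyRingedSpace.stalkMap_germ_apply j V a' hpV g).symm.trans
      (h1.trans (LocallyRingedSpace.stalkMap_germ_apply i U a' hU f))
    obtain ⟨O, haO, i₁, i₂, h3⟩ := (X.restrict W.isOpenEmbedding).presheaf.germ_eq a' _ _ _ _ h2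
    have h4 : analyticStalkToGerm 𝕜 n p ((analyticAffineSpace 𝕜 n).presheaf.germ V (j.base a') hpV g) =
        (F : Germ (𝓝 p) 𝕜) := by rw [hg]; exact hF
    have h5 := (analyticGerm_eq_iff 𝕜 n hpV g F).1
      ((analyticStalkToGerm_germ 𝕜 n hpV g).symm.trans h4)
    have hjc : Tendsto (j.base : X.restrict W.isOpenEmbedding → (Fin n → 𝕜)) (𝓝 a') (𝓝 p) :=
      (j.base.hom.continuous.tendsto a')
    filter_upwards [O.isOpen.mem_nhds haO, hjc.eventually h5] with x hxO hx5
    have hxV : j.base x ∈ V := leOfHom i₁ hxO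
    have h6 : x ∈ vanishingLocus (X := X.restrict W.isOpenEmbedding)
        (U := (Opens.map i.base).obj U) (i.c.app (op U) f) ↔
        x ∈ vanishingLocus (X := X.restrict W.isOpenEmbedding)
        (U := (Opens.map j.base).obj V) (j.c.app (op V) g) := by
      have e1 := vanishingLocus_map (leOfHom i₁) (j.c.app (op V) g)
      have e2 := vanishingLocus_map (leOfHom i₂) (i.c.app (op U) f)
      have e3 := e1.symm.trans ((congrArg vanishingLocus h3).trans e2)
      have e4 : x ∈ _ ↔ x ∈ _ := Set.ext_iff.1 e3 x
      exact ⟨fun hx => (e4.2 ⟨hx, hxO⟩).1, fun hx => (e4.1 ⟨hx, hxO⟩).1⟩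
    rw [vanishingLocus_app, vanishingLocus_app] at h6
    rw [← hx5 hxV]
    exact h6.trans (mem_vanishingLocus_analyticAffineSpace 𝕜 n g hxV)
  refine ⟨p, _, hT, fun U V hU hV f g hfg => ?_⟩
  obtain ⟨F, -, hF⟩ := hT.exists_rep (X.presheaf.germ U a hU f)
  obtain ⟨G, -, hG⟩ := hT.exists_rep (X.presheaf.germ V a hV g)
  rw [hF, hG, Germ.liftRel_coe]
  have h1 := hrep U hU f F hF
  have h2 := hrep V hV g G hG
  have h3 : ∀ᶠ x : X.restrict W.isOpenEmbedding in 𝓝 a', i.base x ∈ V :=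
    (i.base.hom.continuous.tendsto a').eventually (V.isOpen.mem_nhds hV)
  have H : {x : X.restrict W.isOpenEmbedding | F (j.base x) = 0 → G (j.base x) = 0} ∈ 𝓝 a' := by
    filter_upwards [h1, h2, h3] with x h1 h2 h3 h0
    exact h2.1 (hfg ⟨h1.2 h0, h3⟩)
  exact hopen.base_open.isOpenMap.nhds_le a' H

theorem IsAnalyticManifold.isSmoothLocalRing (h : IsAnalyticManifold c n) (a : X) :
    IsSmoothLocalRing (stalkConst c a) n := by
  obtain ⟨p, T, hT, -⟩ := h.exists_isGermChart a
  simpa using hT.isSmoothLocalRing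

theorem IsAnalyticManifold.isEtaleClass (h : IsAnalyticManifold c n) (a : X) :
    IsEtaleClass (stalkConst c a) n
      fun A : LocalExt (X.presheaf.stalk a) => Function.Bijective A.φ := by
  obtain ⟨p, T, hT, -⟩ := h.exists_isGermChart a
  simpa using hT.isEtaleClass

theorem IsAnalyticManifold.hasNullstellensatz (h : IsAnalyticManifold c n) (a : X) :
    HasNullstellensatz X n a := by
  intro s r C hn i V ha f hf
  obtain ⟨p, T, hT, hrel⟩ := h.exists_isGermChart a
  refine ⟨1, ?_⟩
  rw [pow_one]
  obtain ⟨ψ, hψ, hT', hx⟩ := hT.exists_chart (by simpa using hn) _ C.range_elim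
  have h1 := hrel C.U V C.mem ha (C.u i) f hf
  have h2 := hx (.inl i)
  obtain ⟨F, -, hF⟩ := hT.exists_rep (X.presheaf.germ V a ha f)
  obtain ⟨G, -, hG⟩ := hT.exists_rep (C.uGerm i)
  change Germ.LiftRel _ (T (C.uGerm i)) _ at h1
  rw [hF, hG, Germ.liftRel_coe] at h1
  change germComp ψ hψ (T (C.uGerm i)) = _ at h2
  rw [hG] at h2
  have h2' : (fun y => G (ψ y)) =ᶠ[𝓝 0] fun y => y (.inl i) := Germ.coe_eq.1 h2
  have h3 : (germComp ψ hψ).comp T (X.presheaf.germ V a ha f) =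
      ((fun y => F (ψ y) : (Fin s ⊕ Fin r → 𝕜) → 𝕜) : Germ (𝓝 (0 : Fin s ⊕ Fin r → 𝕜)) 𝕜) := by
    rw [RingHom.comp_apply, hF]; rfl
  refine (hT'.dvd_iff hx (.inl i) h3).2 ?_
  have ht : Tendsto (IsGermChart.axisProj 𝕜 (.inl i : Fin s ⊕ Fin r)) (𝓝 0) (𝓝 0) := by
    simpa using (IsGermChart.axisProj 𝕜 (.inl i : Fin s ⊕ Fin r)).continuous.tendsto 0
  filter_upwards [ht.eventually (hψ.eventually h1), ht.eventually h2'] with y h4 h5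
  refine h4 (h5.trans ?_)
  rw [IsGermChart.axisProj_apply, if_pos rfl]

/-- The equivalence in the analytic case. -/
theorem hasPrincipalMonomialFittingIdeals_iff_analytic {X₀ : LocallyRingedSpace.{u}}
    {c₀ : 𝕜 →+* X₀.presheaf.obj (op ⊤)} {σ : X ⟶ X₀} {ι : Type v} {E : ι → Set X}
    (h : IsAnalyticResolution c₀ σ n E) :
    HasPrincipalMonomialFittingIdeals c₀ σ n E ↔ ResolvesCotangentSheafAnalytic c₀ σ n E := by
  have := h.smooth.t2
  constructor
  · intro H a
    obtain ⟨s, r, C, hn, hC, hγ⟩ := H a isClosed_singleton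
    have hR := h.smooth.isSmoothLocalRing a
    obtain ⟨F, hF⟩ := C.exists_isFrame hR hn
    obtain ⟨Γ, hΓ, hG⟩ := exists_minorsIdeal_eq_of_logMinorsIdeal hF hγ
    obtain ⟨B, hB, F', hF', S, hS⟩ := (h.smooth.isEtaleClass a).exists_isPartialSystem hn
      Function.bijective_id F hΓ hG
    let e := (RingEquiv.ofBijective B.φ hB).symm
    have he : ∀ f, e (B.φ f) = f := (RingEquiv.ofBijective B.φ hB).symm_apply_apply
    obtain ⟨F'', hF''⟩ := F'.exists_isMap_ringEquiv e
      (c' := stalkConst (pullbackConst c₀ σ) a) fun t => he _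
    have hS' := hS.map hF''
    have himg : (e : B.carrier →+* X.presheaf.stalk a) '' (B.φ '' Set.range (σ.stalkMap a)) =
        Set.range (σ.stalkMap a) := by
      rw [← Set.image_comp]
      exact (Set.image_congr fun f _ => he f).trans (Set.image_id _)
    rw [himg] at hS'
    refine hasHsiangPatiCoordinates_of_isPartialSystem hR C hn hC.inter_eq F'' (fun i => ?_) hS'
    rw [hF''.map_x, ← hF.x_inl]
    have := (hF' i).map (e : B.carrier →+* X.presheaf.stalk a)
    rwa [RingHom.coe_coe, he] at this
  · intro H a ha
    obtain ⟨s, r, C, hn, hC⟩ := h.isDesingularization.snc a ha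
    have hR := h.smooth.isSmoothLocalRing a
    obtain ⟨F, hF⟩ := C.exists_isFrame hR hn
    refine ⟨s, r, C, hn, hC, fun l hl => ?_⟩
    obtain ⟨γ, hγ⟩ := (H a).exists_minorsIdeal_eq hR (h.smooth.hasNullstellensatz a) C hn
      hC.inter_eq F hF (Nat.sub_le n l)
    exact ⟨γ, by rw [hF.logMinorsIdeal_eq, hγ, hF.mono_eq]⟩

end AnalyticSpaces

/-! ### Algebraic varieties -/

section Schemes

open IsLocalRing TensorProduct

section Algebra

variable {k B R : Type u} [Field k] [CommRing B] [CommRing R] [IsLocalRing R] [Algebra k B]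
  [Algebra k R] [Algebra B R] [IsScalarTower k B R] {n : ℕ}

/-- A localization of a standard smooth algebra at a maximal ideal. -/
theorem IsAlgebraicSmoothLocalRing.of_isStandardSmooth
    [Algebra.IsStandardSmoothOfRelativeDimension n k B] (p : Ideal B) [p.IsMaximal]
    [IsLocalization.AtPrime R p] (hx : ∃ x : Fin n → R, maximalIdeal R = Ideal.span (Set.range x)) :
    IsAlgebraicSmoothLocalRing k R n := by
  have : Algebra.IsStandardSmooth k B :=
    Algebra.IsStandardSmoothOfRelativeDimension.isStandardSmooth n
  have : Nontrivial B := (algebraMap B R).domain_nontrivial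
  have : Algebra.FormallyEtale B R := .of_isLocalization p.primeCompl
  have : IsNoetherianRing B := Algebra.FiniteType.isNoetherianRing k B
  have : Module.Free B (Ω[B⁄k]) := inferInstance
  have : Module.Finite B (Ω[B⁄k]) := inferInstance
  let e := KaehlerDifferential.tensorKaehlerEquivOfFormallyEtale k B R
  refine ⟨IsLocalization.isNoetherianRing p.primeCompl R inferInstance, ?_,
    .equiv e, .of_equiv e, ?_, ?_, hx⟩
  · let : Field (B ⧸ p) := Ideal.Quotient.field p
    have : Module.Finite k (B ⧸ p) := finite_of_finite_type_of_isJacobsonRing k (B ⧸ p)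
    have hle : p ≤ (maximalIdeal R).comap (algebraMap B R) :=
      (IsLocalization.AtPrime.under_maximalIdeal R p).ge
    let q : B ⧸ p →ₐ[k] ResidueField R :=
      Ideal.Quotient.liftₐ p (IsScalarTower.toAlgHom k B (ResidueField R)) fun b hb => by
        have : algebraMap B R b ∈ maximalIdeal R := hle hb
        change algebraMap B (ResidueField R) b = 0
        rw [IsScalarTower.algebraMap_apply B R (ResidueField R)]
        exact (residue_eq_zero_iff _).2 this
    have hq : Function.Surjective q := by
      intro y
      obtain ⟨z, hz⟩ := (IsLocalization.AtPrime.equivQuotMaximalIdeal p R).surjective y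
      obtain ⟨b, rfl⟩ := Ideal.Quotient.mk_surjective z
      refine ⟨Ideal.Quotient.mk p b, Eq.trans ?_ hz⟩
      rfl
    have : Module.Finite k (ResidueField R) := .of_surjective q.toLinearMap hq
    infer_instance
  · rw [← e.finrank_eq, Module.finrank_baseChange]
    exact Module.finrank_eq_of_rank_eq
      (Algebra.IsStandardSmoothOfRelativeDimension.rank_kaehlerDifferential n)
  · have : Algebra.FormallySmooth B R := inferInstance
    exact .comp k B R

end Algebra

variable {k : Type u} [Field k] {X Y : Scheme.{u}} {n : ℕ}

/-- A smooth variety is covered by affine open subsets with standard smooth coordinate rings. -/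
theorem exists_isAffineOpen_isStandardSmooth (π : X ⟶ Spec (.of k))
    (hπ : SmoothOfRelativeDimension n π) (a : X) :
    ∃ V : X.Opens, IsAffineOpen V ∧ a ∈ V ∧ RingHom.IsStandardSmoothOfRelativeDimension n
      ((X.presheaf.map (homOfLE (le_top : V ≤ ⊤)).op).hom.comp (schemeConst π)) := by
  obtain ⟨U, hU, V, hV, haV, e, h⟩ := hπ.exists_isStandardSmoothOfRelativeDimension a
  obtain rfl : U = ⊤ := by
    refine top_le_iff.1 fun x _ => ?_
    have : x = π a := @Subsingleton.elim (PrimeSpectrum k) inferInstance x (π a)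
    exact this ▸ e haV
  refine ⟨V, hV, haV, ?_⟩
  have e1 := h.comp (RingHom.IsStandardSmoothOfRelativeDimension.equiv
    (Scheme.ΓSpecIso (.of k)).symm.commRingCatIsoToRingEquiv)
  rw [add_zero] at e1
  exact e1

/-- The local equations of a closed set generate its ideal up to radical. -/
theorem hasNullstellensatz (a : X) : HasNullstellensatz X.toLocallyRingedSpace n a := by
  intro s r C _ i V ha f hf
  obtain ⟨W, hW, haW, hWC⟩ := exists_isAffineOpen_mem_and_subset (x := a) (U := C.U ⊓ V) ⟨C.mem, ha⟩
  have hWU : W ≤ C.U := fun x hx => (hWC hx).1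
  have hWV : W ≤ V := fun x hx => (hWC hx).2
  let u' : Γ(X, W) := X.presheaf.map (homOfLE hWU).op (C.u i)
  let f' : Γ(X, W) := X.presheaf.map (homOfLE hWV).op f
  have hle : X.basicOpen f' ≤ X.basicOpen u' := by
    intro x hx
    have hxW : x ∈ W := X.basicOpen_le _ hx
    by_contra hxu
    have h := (Scheme.mem_basicOpen X f' x hxW).1 hx
    have h1 : x ∈ vanishingLocus (X := X.toLocallyRingedSpace) (C.u i) := by
      refine ⟨hWU hxW, ?_⟩
      have := mt (Scheme.mem_basicOpen X u' x hxW).2 hxu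
      have e : X.presheaf.germ W x hxW u' = X.presheaf.germ C.U x (hWU hxW) (C.u i) :=
        TopCat.Presheaf.germ_res_apply _ _ _ _ _
      rw [e] at this
      exact this
    obtain ⟨_, h2⟩ := hf ⟨h1, hWV hxW⟩
    have e : X.presheaf.germ W x hxW f' = X.presheaf.germ V x (hWV hxW) f :=
      TopCat.Presheaf.germ_res_apply _ _ _ _ _
    rw [e] at h
    exact h2 h
  have : IsLocalization.Away f' Γ(X, X.basicOpen f') := hW.isLocalization_basicOpen f'
  have hu : IsUnit (algebraMap Γ(X, W) Γ(X, X.basicOpen f') u') := by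
    have h1 := (X.toRingedSpace.isUnit_res_basicOpen u').map
      (X.presheaf.map (homOfLE hle).op).hom
    have e : (X.presheaf.map (homOfLE hle).op).hom
      (X.presheaf.map (homOfLE (X.basicOpen_le u')).op u') =
        X.presheaf.map (homOfLE (X.basicOpen_le f')).op u' := by
      rw [← CommRingCat.comp_apply, ← Functor.map_comp]
      rfl
    exact e ▸ h1
  obtain ⟨w, hw⟩ := hu.exists_right_inv
  obtain ⟨⟨g, _, N, rfl⟩, hg⟩ := IsLocalization.surj (Submonoid.powers f') w
  have h3 : algebraMap Γ(X, W) Γ(X, X.basicOpen f') (f' ^ N) = algebraMap _ _ (u' * g) := by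
    rw [map_mul, ← hg, ← mul_assoc, hw, one_mul]
  obtain ⟨⟨_, M, rfl⟩, h4⟩ := (IsLocalization.eq_iff_exists (Submonoid.powers f') _).1 h3
  refine ⟨M + N, X.presheaf.germ W a haW (f' ^ M * g), ?_⟩
  have e1 : X.presheaf.germ W a haW u' = C.uGerm i := TopCat.Presheaf.germ_res_apply _ _ _ _ _
  have e2 : X.presheaf.germ W a haW f' = X.presheaf.germ V a ha f :=
    TopCat.Presheaf.germ_res_apply _ _ _ _ _
  have h5 : f' ^ (M + N) = u' * (f' ^ M * g) := by
    rw [pow_add]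
    refine Eq.trans h4 ?_
    ring
  refine Eq.trans ?_ ((congrArg (X.presheaf.germ W a haW) h5).trans ?_)
  · rw [map_pow, e2]
  · rw [map_mul, e1]

end Schemes

/-! ### Étale morphisms of varieties -/

section Schemes

open IsLocalRing TensorProduct

variable {k : Type u} [Field k] {X Y : Scheme.{u}} {n : ℕ}

/-- The local ring of an étale neighbourhood. -/
theorem exists_isEtaleChart_stalk (p : Y ⟶ X) [Etale p] (b : Y) {V : X.Opens} (hV : IsAffineOpen V)
    (hb : p b ∈ V) :
    letI : Algebra Γ(X, V) (X.presheaf.stalk (p b)) := (X.presheaf.germ V (p b) hb).hom.toAlgebra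
    IsEtaleLocal Γ(X, V) (⟨Y.presheaf.stalk b, (p.stalkMap b).hom⟩ : LocalExt (X.presheaf.stalk (p b))) := by
  let : Algebra Γ(X, V) (X.presheaf.stalk (p b)) := (X.presheaf.germ V (p b) hb).hom.toAlgebra
  obtain ⟨W, hW, hbW, hWV⟩ := exists_isAffineOpen_mem_and_subset (x := b) (U := p ⁻¹ᵁ V) hb
  have hWV' : W ≤ p ⁻¹ᵁ V := hWV
  let : Algebra Γ(X, V) Γ(Y, W) := (p.appLE V W hWV').hom.toAlgebra
  let A : LocalExt (X.presheaf.stalk (p b)) := ⟨Y.presheaf.stalk b, (p.stalkMap b).hom⟩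
  let : Algebra Γ(Y, W) A.carrier := (Y.presheaf.germ W b hbW).hom.toAlgebra
  refine ⟨Γ(Y, W), inferInstance, inferInstance, inferInstance,
    ⟨inferInstanceAs (IsLocalHom (p.stalkMap b).hom), p.etale_appLE hV hW hWV', ?_, ?_⟩⟩
  · ext f
    change Y.presheaf.germ W b hbW (p.appLE V W hWV' f) = p.stalkMap b (X.presheaf.germ V (p b) hb f)
    rw [Scheme.Hom.germ_stalkMap_apply]
    exact TopCat.Presheaf.germ_res_apply _ _ _ _ _
  · have : IsLocalization (hW.primeIdealOf ⟨b, hbW⟩).asIdeal.primeCompl A.carrier :=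
      hW.isLocalization_stalk ⟨b, hbW⟩
    exact IsLocalization.atPrime_comap_maximalIdeal (hW.primeIdealOf ⟨b, hbW⟩).asIdeal.primeCompl

/-- Local rings of étale algebras are local rings of étale neighbourhoods. -/
theorem IsEtaleLocal.exists_etale {a : X} {V : X.Opens} (hV : IsAffineOpen V) (ha : a ∈ V)
    {A : LocalExt (X.presheaf.stalk a)}
    (h : letI : Algebra Γ(X, V) (X.presheaf.stalk a) := (X.presheaf.germ V a ha).hom.toAlgebra
      IsEtaleLocal Γ(X, V) A) :
    ∃ (U : Scheme.{u}) (p : U ⟶ X) (b : U) (e : A.carrier ≃+* U.presheaf.stalk b) (hb : p b = a),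
      Etale p ∧ ∀ (W : X.Opens) (hW : a ∈ W) (f : Γ(X, W)), e (A.φ (X.presheaf.germ W a hW f)) =
        U.presheaf.germ (p ⁻¹ᵁ W) b (show p b ∈ W from hb ▸ hW) (p.app W f) := by
  let : Algebra Γ(X, V) (X.presheaf.stalk a) := (X.presheaf.germ V a ha).hom.toAlgebra
  obtain ⟨B, _, _, _, h⟩ := h
  have := h.isLocalization
  have := h.isLocalHom
  have := h.etale
  let φ : Γ(X, V) ⟶ CommRingCat.of B := CommRingCat.ofHom (algebraMap Γ(X, V) B)
  let p : Spec (.of B) ⟶ X := Spec.map φ ≫ hV.fromSpec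
  let q : Ideal B := (maximalIdeal A.carrier).comap (algebraMap B A.carrier)
  let b : Spec (.of B) := (⟨q, inferInstance⟩ : PrimeSpectrum B)
  have hpe : Etale p := by
    have : Etale (Spec.map φ) := (HasRingHomProperty.Spec_iff (P := @Etale)).2
      ((RingHom.etale_algebraMap).2 h.etale)
    infer_instance
  have hb : p b = a := by
    have h1 : Spec.map φ b = hV.primeIdealOf ⟨a, ha⟩ := by
      rw [hV.primeIdealOf_eq_map_closedPoint]
      refine PrimeSpectrum.ext ?_
      change q.comap (algebraMap Γ(X, V) B) = (maximalIdeal _).comap (algebraMap Γ(X, V) (X.presheaf.stalk a))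
      rw [Ideal.comap_comap, h.comp_eq, ← Ideal.comap_comap,
        show (maximalIdeal A.carrier).comap A.φ = maximalIdeal _ from
          ((IsLocalRing.local_hom_TFAE A.φ).out 0 4).1 h.isLocalHom]
    change hV.fromSpec (Spec.map φ b) = a
    rw [h1, hV.fromSpec_primeIdealOf]
  let : Algebra B ((Spec (.of B)).presheaf.stalk b) :=
    (StructureSheaf.toStalk B (⟨q, inferInstance⟩ : PrimeSpectrum B)).hom.toAlgebra
  have : IsLocalization.AtPrime ((Spec (.of B)).presheaf.stalk b) q :=
    StructureSheaf.IsLocalization.to_stalk B (⟨q, inferInstance⟩ : PrimeSpectrum B)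
  let e : A.carrier ≃ₐ[B] (Spec (.of B)).presheaf.stalk b :=
    IsLocalization.algEquiv q.primeCompl _ _
  have hsp : p b ⤳ a := specializes_of_eq hb
  -- both homomorphisms are determined by their restrictions to the sections over `V`
  have key : ((e : A.carrier →+* _).comp A.φ) =
      (p.stalkMap b).hom.comp (X.presheaf.stalkSpecializes hsp).hom := by
    have : IsLocalization (hV.primeIdealOf ⟨a, ha⟩).asIdeal.primeCompl (X.presheaf.stalk a) :=
      hV.isLocalization_stalk ⟨a, ha⟩
    refine IsLocalization.ringHom_ext (hV.primeIdealOf ⟨a, ha⟩).asIdeal.primeCompl ?_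
    rw [RingHom.comp_assoc, ← h.comp_eq]
    ext f
    have e1 : e (algebraMap B A.carrier (φ f)) =
      algebraMap B ((Spec (.of B)).presheaf.stalk b) (φ f) := e.commutes _
    refine e1.trans ?_
    have hbV : p b ∈ V := hb ▸ ha
    have e2 : X.presheaf.stalkSpecializes hsp (X.presheaf.germ V a ha f) =
        X.presheaf.germ V (p b) hbV f := by
      rw [← CommRingCat.comp_apply, TopCat.Presheaf.germ_stalkSpecializes]
    have e3 := Scheme.Hom.germ_stalkMap_apply p V b hbV f
    refine Eq.trans ?_ ((congrArg (p.stalkMap b) e2).trans e3).symm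
    let b' : Spec Γ(X, V) := Spec.map φ b
    have hb' : b' ∈ hV.fromSpec ⁻¹ᵁ V := hbV
    have e4 : (Spec Γ(X, V)).presheaf.germ (hV.fromSpec ⁻¹ᵁ V) b' hb' (hV.fromSpec.app V f) =
        (Spec Γ(X, V)).presheaf.germ ⊤ b' trivial ((Scheme.ΓSpecIso Γ(X, V)).inv f) := by
      rw [hV.fromSpec_app_self]
      exact TopCat.Presheaf.germ_res_apply _ _ _ _ _
    have e5 := Scheme.Hom.germ_stalkMap_apply (Spec.map φ) (hV.fromSpec ⁻¹ᵁ V) b hb'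
      (hV.fromSpec.app V f)
    have e6 := Scheme.Hom.germ_stalkMap_apply (Spec.map φ) ⊤ b trivial
      ((Scheme.ΓSpecIso Γ(X, V)).inv f)
    have e7 : (Spec.map φ).appTop ((Scheme.ΓSpecIso Γ(X, V)).inv f) =
        (Scheme.ΓSpecIso (.of B)).inv (φ f) :=
      congrArg (fun g => g.hom f) (Scheme.ΓSpecIso_inv_naturality φ).symm
    have e8 : (Spec (.of B)).presheaf.germ ⊤ b trivial ((Scheme.ΓSpecIso (.of B)).inv (φ f)) =
        algebraMap B ((Spec (.of B)).presheaf.stalk b) (φ f) := rfl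
    have e9 : p.app V f = (Spec.map φ).app (hV.fromSpec ⁻¹ᵁ V) (hV.fromSpec.app V f) := by
      rw [Scheme.Hom.comp_app]
      rfl
    rw [e9, ← e8, ← e7]
    exact e6.symm.trans ((congrArg ((Spec.map φ).stalkMap b) e4).symm.trans e5)
  refine ⟨_, p, b, e.toRingEquiv, hb, hpe, fun W hW f => ?_⟩
  have hbW : p b ∈ W := hb ▸ hW
  refine (RingHom.congr_fun key (X.presheaf.germ W a hW f)).trans ?_
  have e2 : X.presheaf.stalkSpecializes hsp (X.presheaf.germ W a hW f) =
      X.presheaf.germ W (p b) hbW f := by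
    rw [← CommRingCat.comp_apply, TopCat.Presheaf.germ_stalkSpecializes]
  exact (congrArg (p.stalkMap b) e2).trans (Scheme.Hom.germ_stalkMap_apply p W b hbW f)

end Schemes

section Schemes

open IsLocalRing TensorProduct

section Etale

variable {k R R' : Type u} [Field k] [CharZero k] [CommRing R] [IsLocalRing R] [CommRing R']
  [IsLocalRing R'] [Algebra k R] {n : ℕ}

/-- The local ring `A` of an étale neighbourhood of a smooth variety is smooth, has the same
coordinates, and is faithfully flat, so that equalities of ideals can be checked after extension
to `A`. -/
theorem IsEtaleLocal.isSmoothLocalRing {B : Type u} [CommRing B] [Algebra B R]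
    (q : Ideal B) [q.IsPrime] [IsLocalization.AtPrime R q] {A : LocalExt R} (h : IsEtaleLocal B A)
    (hR : IsAlgebraicSmoothLocalRing k R n) :
    IsSmoothLocalRing (A.φ.comp (algebraMap k R)) n ∧
      (maximalIdeal R).map A.φ = maximalIdeal A.carrier ∧
      (∀ I J : Ideal R, I.map A.φ = J.map A.φ → I = J) ∧
      ∀ {ι : Type} [Fintype ι] [DecidableEq ι], Fintype.card ι = n →
        ∀ F : Frame (algebraMap k R) ι, ∃ F' : Frame (A.φ.comp (algebraMap k R)) ι,
          F.IsMap A.φ F' := by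
  obtain ⟨B', _, _, _, h⟩ := h
  have : Algebra.FormallyUnramified B R := .of_isLocalization q.primeCompl
  let := (A.φ.comp (algebraMap k R)).toAlgebra
  let := A.φ.toAlgebra
  have : IsScalarTower k R A.carrier := .of_algebraMap_eq fun _ => rfl
  have := h.formallyEtale.1
  have := h.formallyEtale.2
  have : IsLocalHom (algebraMap R A.carrier) := h.isLocalHom
  have hA : IsAlgebraicSmoothLocalRing k A.carrier n := hR.of_formallyEtale
  have := hR.isNoetherianRing
  refine ⟨hA.isSmoothLocalRing, Algebra.FormallyUnramified.map_maximalIdeal, fun I J hIJ => ?_,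
    fun hι F => hR.exists_isMap hι F⟩
  have : Module.Flat R A.carrier := by
    let := (A.φ.comp (algebraMap B R)).toAlgebra
    have : IsScalarTower B R A.carrier := .of_algebraMap_eq fun _ => rfl
    have : IsScalarTower B B' A.carrier := .of_algebraMap_eq' h.comp_eq.symm
    have := h.etale
    have := h.isLocalization
    have : Module.Flat B' A.carrier := IsLocalization.flat A.carrier
      ((maximalIdeal A.carrier).comap (algebraMap B' A.carrier)).primeCompl
    have : Module.Flat B A.carrier := .trans B B' A.carrier
    exact (Module.flat_iff_of_isLocalization R q.primeCompl _).2 this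
  have : Module.FaithfullyFlat R A.carrier := .of_flat_of_isLocalHom
  rw [← Ideal.comap_map_eq_self_of_faithfullyFlat (B := A.carrier) I,
    ← Ideal.comap_map_eq_self_of_faithfullyFlat (B := A.carrier) J]
  exact congrArg (Ideal.comap _) hIJ

end Etale

variable {k : Type u} [Field k] [CharZero k] {X Y X₀ : Scheme.{u}} {n : ℕ}

/-- The conclusions of `IsEtaleLocal.isSmoothLocalRing` for an étale morphism of schemes. -/
theorem isSmoothLocalRing_of_etale (p : Y ⟶ X) [Etale p] (b : Y) (c : k →+* X.presheaf.stalk (p b))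
    (hR : letI := c.toAlgebra; IsAlgebraicSmoothLocalRing k (X.presheaf.stalk (p b)) n) :
    IsSmoothLocalRing ((p.stalkMap b).hom.comp c) n ∧
      (maximalIdeal (X.presheaf.stalk (p b))).map (p.stalkMap b).hom =
        maximalIdeal (Y.presheaf.stalk b) ∧
      (∀ I J : Ideal (X.presheaf.stalk (p b)), I.map (p.stalkMap b).hom = J.map (p.stalkMap b).hom →
        I = J) ∧
      ∀ {ι : Type} [Fintype ι] [DecidableEq ι], Fintype.card ι = n → ∀ F : Frame c ι,
        ∃ F' : Frame ((p.stalkMap b).hom.comp c) ι, F.IsMap (p.stalkMap b).hom F' := by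
  let := c.toAlgebra
  obtain ⟨V, hV, hb, -⟩ := exists_isAffineOpen_mem_and_subset (x := p b) (U := ⊤) trivial
  let : Algebra Γ(X, V) (X.presheaf.stalk (p b)) := (X.presheaf.germ V (p b) hb).hom.toAlgebra
  have : IsLocalization.AtPrime (X.presheaf.stalk (p b)) (hV.primeIdealOf ⟨p b, hb⟩).asIdeal :=
    hV.isLocalization_stalk ⟨p b, hb⟩
  exact (exists_isEtaleChart_stalk p b hV hb).isSmoothLocalRing
    (hV.primeIdealOf ⟨p b, hb⟩).asIdeal hR

/-- The local ring of a smooth variety at a closed point, together with an affine neighbourhood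
whose étale algebras provide the extensions of local rings needed to find Hsiang–Pati
coordinates. -/
theorem exists_isAffineOpen_isEtaleClass (π : X ⟶ Spec (.of k))
    (hπ : SmoothOfRelativeDimension n π) {a : X} (ha : IsClosed {a})
    (hx : ∃ x : Fin n → X.presheaf.stalk a,
      maximalIdeal (X.presheaf.stalk a) = Ideal.span (Set.range x)) :
    letI := (stalkConst (X := X.toLocallyRingedSpace) (schemeConst π) a).toAlgebra
    IsAlgebraicSmoothLocalRing k (X.presheaf.stalk a) n ∧ ∃ (V : X.Opens) (_ : IsAffineOpen V) (haV : a ∈ V),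
      letI : Algebra Γ(X, V) (X.presheaf.stalk a) := (X.presheaf.germ V a haV).hom.toAlgebra
      IsEtaleLocal Γ(X, V) ⟨X.presheaf.stalk a, RingHom.id _⟩ ∧
      IsEtaleClass (algebraMap k (X.presheaf.stalk a)) n
        (IsEtaleLocal (R₀ := X.presheaf.stalk a) Γ(X, V)) := by
  let := (stalkConst (X := X.toLocallyRingedSpace) (schemeConst π) a).toAlgebra
  obtain ⟨V, hV, haV, h⟩ := exists_isAffineOpen_isStandardSmooth π hπ a
  let : Algebra Γ(X, V) (X.presheaf.stalk a) := (X.presheaf.germ V a haV).hom.toAlgebra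
  let : Algebra k Γ(X, V) := 
    ((X.presheaf.map (homOfLE (le_top : V ≤ ⊤)).op).hom.comp (schemeConst π)).toAlgebra
  have : Algebra.IsStandardSmoothOfRelativeDimension n k Γ(X, V) := h
  have : Algebra.IsStandardSmooth k Γ(X, V) :=
    Algebra.IsStandardSmoothOfRelativeDimension.isStandardSmooth n
  have : IsScalarTower k Γ(X, V) (X.presheaf.stalk a) := .of_algebraMap_eq fun t =>
    (TopCat.Presheaf.germ_res_apply X.presheaf (homOfLE le_top) a haV (schemeConst π t)).symm
  let p := (hV.primeIdealOf ⟨a, haV⟩).asIdeal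
  have hloc : IsLocalization.AtPrime (X.presheaf.stalk a) p :=
    hV.isLocalization_stalk ⟨a, haV⟩
  have : p.IsMaximal := hV.primeIdealOf_isMaximal_of_isClosed ⟨a, haV⟩ ha
  have hR : IsAlgebraicSmoothLocalRing k (X.presheaf.stalk a) n := .of_isStandardSmooth p hx
  have : Algebra.FormallyUnramified Γ(X, V) (X.presheaf.stalk a) :=
    .of_isLocalization p.primeCompl
  exact ⟨hR, V, hV, haV, isEtaleLocal_id (p := p), hR.isEtaleClass⟩

end Schemes

/-! ### The equivalence in the algebraic case -/

section Schemes

open IsLocalRing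

variable {k : Type u} [Field k] [CharZero k] {X X₀ : Scheme.{u}} {n : ℕ}

theorem LocalCoordinates.exists_span {X : LocallyRingedSpace.{u}} {a : X} {s r : ℕ}
    (C : LocalCoordinates X a s r) (hn : s + r = n) :
    ∃ x : Fin n → X.presheaf.stalk a,
      maximalIdeal (X.presheaf.stalk a) = Ideal.span (Set.range x) := by
  subst hn
  refine ⟨Sum.elim C.uGerm C.vGerm ∘ finSumFinEquiv.symm, C.range_elim.trans ?_⟩
  rw [finSumFinEquiv.symm.surjective.range_comp]

theorem range_stalkMap_comp {X Y Z : LocallyRingedSpace.{u}} (p : X ⟶ Y) (q : Y ⟶ Z) (x : X) :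
    Set.range ((p ≫ q).stalkMap x) = p.stalkMap x '' Set.range (q.stalkMap (p.base x)) := by
  rw [← Set.range_comp]
  congr 1
  funext f
  exact congrArg (fun g => g.hom f) (LocallyRingedSpace.stalkMap_comp p q x)

/-- The equivalence in the algebraic case. -/
theorem hasPrincipalMonomialFittingIdeals_iff_algebraic {f : X₀ ⟶ Spec (.of k)} {σ : X ⟶ X₀}
    {ι : Type v} {E : ι → Set X} (h : IsAlgebraicResolution f σ n E) :
    HasPrincipalMonomialFittingIdeals (schemeConst f) σ.toLRSHom n E ↔
      ResolvesCotangentSheafAlgebraic f σ n E := by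
  constructor
  · intro H a ha
    obtain ⟨s, r, C, hn, hC, hγ⟩ := H a ha
    obtain ⟨hR, V, hV, haV, hid, hcl⟩ := exists_isAffineOpen_isEtaleClass (σ ≫ f) h.smooth ha
      (C.exists_span hn)
    let := (stalkConst (X := X.toLocallyRingedSpace) (schemeConst (σ ≫ f)) a).toAlgebra
    have hRs : IsSmoothLocalRing
      (stalkConst (pullbackConst (schemeConst f) σ.toLRSHom) a) n := hR.isSmoothLocalRing
    obtain ⟨F, hF⟩ := C.exists_isFrame hRs hn
    obtain ⟨Γ, hΓ, hG⟩ := exists_minorsIdeal_eq_of_logMinorsIdeal hF hγ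
    obtain ⟨B, hB, F', hF', S, hS⟩ := hcl.exists_isPartialSystem hn hid F hΓ hG
    obtain ⟨U, p, b, e, hb, hp, he⟩ := hB.exists_etale hV haV
    refine ⟨U, p, b, hp, hb, ?_⟩
    subst hb
    obtain ⟨hR', hm, -, -⟩ := isSmoothLocalRing_of_etale p b _ hR
    have he' : ∀ g : X.presheaf.stalk (p b), e (B.φ g) = p.stalkMap b g := fun g => by
      obtain ⟨W, hW, g, rfl⟩ := X.presheaf.exists_germ_eq g
      exact (he W hW g).trans (Scheme.Hom.germ_stalkMap_apply p W b hW g).symm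
    have hc := stalkMap_stalkConst p.toLRSHom (pullbackConst (schemeConst f) σ.toLRSHom) b
    obtain ⟨F'', hF''⟩ := F'.exists_isMap_ringEquiv e
      (c' := stalkConst (pullbackConst (schemeConst f) (p ≫ σ).toLRSHom) b)
      fun t => (he' _).trans (RingHom.congr_fun hc t)
    have hS' := hS.map hF''
    have himg : (e : B.carrier →+* U.presheaf.stalk b) '' (B.φ '' Set.range (σ.toLRSHom.stalkMap (p b))) =
        Set.range ((p ≫ σ).toLRSHom.stalkMap b) := by
      rw [← Set.image_comp]
      exact (Set.image_congr fun g _ => he' g).trans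
        (range_stalkMap_comp p.toLRSHom σ.toLRSHom b).symm
    rw [himg] at hS'
    have hRc : IsSmoothLocalRing
        (stalkConst (pullbackConst (schemeConst f) (p ≫ σ).toLRSHom) b) n := hc ▸ hR'
    refine hasHsiangPatiCoordinates_of_isPartialSystem hRc
      (LocalCoordinates.pullback p.toLRSHom C hm) hn
      (LocalCoordinates.pullback_inter_eq p.toLRSHom C hm hC.inter_eq) F'' (fun i => ?_) hS'
    have e1 : e (B.φ (F.x (.inl i))) =
        (LocalCoordinates.pullback p.toLRSHom C hm).uGerm i := by
      rw [he', hF.x_inl]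
      exact (LocalCoordinates.pullback_uGerm p.toLRSHom C hm i).symm
    rw [hF''.map_x, ← e1]
    exact (hF' i).map (e : B.carrier →+* U.presheaf.stalk b)
  · intro H a ha
    obtain ⟨s, r, C, hn, hC⟩ := h.isDesingularization.snc a ha
    obtain ⟨hR, -⟩ := exists_isAffineOpen_isEtaleClass (σ ≫ f) h.smooth ha (C.exists_span hn)
    let := (stalkConst (X := X.toLocallyRingedSpace) (schemeConst (σ ≫ f)) a).toAlgebra
    have hRs : IsSmoothLocalRing
      (stalkConst (pullbackConst (schemeConst f) σ.toLRSHom) a) n := hR.isSmoothLocalRing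
    obtain ⟨F, hF⟩ := C.exists_isFrame hRs hn
    refine ⟨s, r, C, hn, hC, fun l hl => ?_⟩
    obtain ⟨U, p, b, hp, rfl, hHP⟩ := H a ha
    obtain ⟨hR', hm, hinj, hmap⟩ := isSmoothLocalRing_of_etale p b _ hR
    have hc := stalkMap_stalkConst p.toLRSHom (pullbackConst (schemeConst f) σ.toLRSHom) b
    obtain ⟨F', hF'⟩ : ∃ F' : Frame (stalkConst (pullbackConst (schemeConst f) (p ≫ σ).toLRSHom) b)
        (Fin s ⊕ Fin r), F.IsMap (p.stalkMap b).hom F' := by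
      have := hmap (by simpa using hn) F
      exact hc ▸ this
    have hRc : IsSmoothLocalRing
        (stalkConst (pullbackConst (schemeConst f) (p ≫ σ).toLRSHom) b) n := hc ▸ hR'
    let C' := LocalCoordinates.pullback p.toLRSHom C hm
    have hF'C : C'.IsFrame F' := ⟨fun i => by
      rw [hF'.map_x, hF.x_inl]
      exact (LocalCoordinates.pullback_uGerm p.toLRSHom C hm i).symm, fun j => by
      rw [hF'.map_x, hF.x_inr]
      exact (LocalCoordinates.pullback_vGerm p.toLRSHom C hm j).symm⟩
    obtain ⟨γ, hγ⟩ := hHP.exists_minorsIdeal_eq hRc (hasNullstellensatz b) C' hn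
      (LocalCoordinates.pullback_inter_eq p.toLRSHom C hm hC.inter_eq) F' hF'C (Nat.sub_le n l)
    refine ⟨γ, ?_⟩
    rw [hF.logMinorsIdeal_eq, ← hF.mono_eq]
    -- the equality of ideals descends from the faithfully flat extension of local rings
    refine hinj _ _ ?_
    rw [← minorsIdeal_map, Ideal.map_span, Set.image_singleton, ← hF'.map_mono, ← hγ]
    congr 1
    have hr : Set.range ((p ≫ σ).toLRSHom.stalkMap b) =
        (p.stalkMap b).hom '' Set.range (σ.toLRSHom.stalkMap (p b)) :=
      range_stalkMap_comp p.toLRSHom σ.toLRSHom b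
    rw [hr, ← Set.image_comp, ← Set.image_comp]
    exact Set.image_congr fun g _ => (hF'.map_vec g).symm

end Schemes

theorem theorem1p2 :
    -- algebraic varieties over a field of characteristic zero
    (∀ {k : Type u} [Field k] [CharZero k] {X X₀ : Scheme.{u}} (f : X₀ ⟶ Spec (.of k))
      (σ : X ⟶ X₀) (n : ℕ) {ι : Type v} (E : ι → Set X),
      IsAlgebraicVariety f → IsAlgebraicResolution f σ n E →
      (HasPrincipalMonomialFittingIdeals (schemeConst f) σ.toLRSHom n E ↔
        ResolvesCotangentSheafAlgebraic f σ n E)) ∧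
    -- real- and complex-analytic varieties
    (∀ {𝕜 : Type u} [RCLike 𝕜] {X X₀ : LocallyRingedSpace.{u}}
      (c₀ : 𝕜 →+* X₀.presheaf.obj (op ⊤)) (σ : X ⟶ X₀) (n : ℕ) {ι : Type v} (E : ι → Set X),
      IsAnalyticVariety c₀ → IsAnalyticResolution c₀ σ n E →
      (HasPrincipalMonomialFittingIdeals c₀ σ n E ↔
        ResolvesCotangentSheafAnalytic c₀ σ n E)) :=
  ⟨fun _ _ _ _ _ _ h => hasPrincipalMonomialFittingIdeals_iff_algebraic h,
    fun _ _ _ _ _ _ h => hasPrincipalMonomialFittingIdeals_iff_analytic h⟩
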